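/- **Proposition (Regularized Wasserstein proximal dynamics).** Let $T>0$, $\beta>0$, let $V\in C^1(\mathbb R^d)$ be bounded below, and let $\rho_0$ be a probability density on $\mathbb R^d$ with finite second moment. Consider the mean-field control problem $$\inf_{\rho,v,q}\ \int_0^T\!\!\int_{\mathbb R^d}\tfrac12\|v(t,x)\|^2\rho(t,x)\,dx\,dt+\int_{\mathbb R^d}V(x)q(x)\,dx,$$ where the infimum is over all measurable drifts $v:[0,T]\times\mathbb R^d\to\mathbb R^d$ and jointly measurable families $\rho(t,\cdot)$, $t\in[0,T]$, of probability densities with finite second moment, such that both integrals converge and $$\partial_t\rho+\nabla\cdot(\rho v)=\beta\Delta\rho,\qquad \rho(0,\cdot)=\rho_0,\qquad \rho(T,\cdot)=q .$$ The equation is understood weakly: for all compactly supported $\varphi\in C^2(\mathbb R\times\mathbb R^d)$, $$\int\varphi(T,x)\rho(T,x)\,dx-\int\varphi(0,x)\rho(0,x)\,dx=\int_0^T\!\!\int(\partial_t\varphi+v\cdot\nabla\varphi+\beta\Delta\varphi)\rho\,dx\,dt .$$ Let $\mathrm{WProx}_{T\mathcal V,\beta}(\rho_0)$ denote the terminal density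 $q$ of an optimizer $(\rho,v,q)$. For a function $\Phi$ on $[0,T]\times\mathbb R^d$ put $$\mathcal L(\rho,v,q,\Phi)=\int_0^T\!\!\int\tfrac12\|v\|^2\rho+\int Vq+\int\Phi(T,\cdot)q-\int\Phi(0,\cdot)\rho_0-\int_0^T\!\!\int(\partial_t\Phi+v\cdot\nabla\Phi+\beta\Delta\Phi)\rho .$$ Then there is a function $\Phi:[0,T]\times\mathbb R^d\to\mathbb R$, continuous on $[0,T]\times\mathbb R^d$ and $C^2$ on $(0,T)\times\mathbb R^d$, with $$\partial_t\Phi+\tfrac12\|\nabla\Phi\|^2=-\beta\Delta\Phi\ \text{ on }(0,T)\times\mathbb R^d,\qquad \Phi(T,x)=-V(x),$$ such that the following hold. 1. The problem has an optimizer $(\rho,\nabla\Phi,q)$ for which $\rho$ is $C^2$ on $(0,T)\times\mathbb R^d$ and satisfies there, pointwise, the Fokker–Planck equation $\partial_t\rho+\nabla\cdot(\rho\nabla\Phi)=\beta\Delta\rho$, with $\rho(0,x)=\rho_0(x)$. 2. Its terminal density is the regularized proximal: $\rho(T,x)=q(x)=\mathrm{WProx}_{T\mathcal V,\beta}(\rho_0)(x)$.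 The terminal densities of any two optimizers agree almost everywhere, so that $\mathrm{WProx}_{T\mathcal V,\beta}(\rho_0)$ is well defined. 3. Every optimizer $(\rho',v',q')$ satisfies $\rho'=\rho$ and $\rho'(v'-\nabla\Phi)=0$ almost everywhere on $(0,T)\times\mathbb R^d$, the weak equation $\partial_t\rho'+\nabla\cdot(\rho'\nabla\Phi)=\beta\Delta\rho'$, $\rho'(0,\cdot)=\rho_0$, and $\rho'(T,\cdot)=q'$. Moreover $\Phi$ is a Lagrange multiplier at $(\rho',v',q')$: the integrals in $\mathcal L(\rho',v',q',\Phi)$ converge, $\mathcal L(\rho',v',q',\Phi)$ equals the optimal cost, and $\mathcal L(\rho',v',q',\Phi)\le\mathcal L(\tilde\rho,\tilde v,\tilde q,\Phi)$ for all $(\tilde\rho,\tilde v,\tilde q)$ as above, not required to satisfy the differential constraint, for which the integrals in $\mathcal L$ converge. -/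

import Mathlib

open MeasureTheory

namespace RegWProx

/-- Euclidean space `ℝ^d` with the Euclidean norm. -/
abbrev Space (d : ℕ) := EuclideanSpace ℝ (Fin d)

/-- `q` is a probability density (with respect to Lebesgue measure) with finite second moment. -/
structure IsP2Density {d : ℕ} (q : Space d → ℝ) : Prop where
  nonneg : ∀ x, 0 ≤ q x
  integrable : Integrable q
  integral_eq_one : ∫ x, q x = 1
  second_moment : Integrable (fun x => ‖x‖ ^ 2 * q x)

/-- Lebesgue measure on the space-time slab `(0, T) × ℝ^d`. -/
noncomputable def slab (d : ℕ) (T : ℝ) : Measure (ℝ × Space d) :=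
  (volume.restrict (Set.Ioo 0 T)).prod volume

/-- The divergence of a vector field on `ℝ^d`. -/
noncomputable def divergence {d : ℕ} (F : Space d → Space d) (x : Space d) : ℝ :=
  ∑ i, fderiv ℝ F x (EuclideanSpace.single i 1) i

/-- The backward operator `∂ₜφ + b · ∇φ + β Δφ` with drift `b`. -/
noncomputable def backwardOp {d : ℕ} (β : ℝ) (b : ℝ → Space d → Space d) (φ : ℝ → Space d → ℝ)
    (t : ℝ) (x : Space d) : ℝ :=
  deriv (fun s => φ s x) t + inner ℝ (b t x) (gradient (φ t) x)
    + β * Laplacian.laplacian (φ t) x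

/-- `ρ` solves `∂ₜρ + ∇·(ρ b) = β Δρ` on `[0, T] × ℝ^d` in the weak sense, the traces at the initial
and terminal times being `ρ 0` and `ρ T`. By mollification, testing with `C²` functions of compact
support is the same as testing with smooth ones. -/
def SolvesFokkerPlanckWeakly {d : ℕ} (T β : ℝ) (ρ : ℝ → Space d → ℝ)
    (b : ℝ → Space d → Space d) : Prop :=
  ∀ φ : ℝ → Space d → ℝ, ContDiff ℝ 2 (fun z : ℝ × Space d => φ z.1 z.2) →
    HasCompactSupport (fun z : ℝ × Space d => φ z.1 z.2) →
    (∫ x, φ T x * ρ T x) - (∫ x, φ 0 x * ρ 0 x) =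
      ∫ z, backwardOp β b φ z.1 z.2 * ρ z.1 z.2 ∂(slab d T)

/-- `ρ` is a classical solution of `∂ₜρ + ∇·(ρ b) = β Δρ` on `(0, T) × ℝ^d`. -/
structure SolvesFokkerPlanckClassically {d : ℕ} (T β : ℝ) (ρ : ℝ → Space d → ℝ)
    (b : ℝ → Space d → Space d) : Prop where
  regular : ContDiffOn ℝ 2 (fun z : ℝ × Space d => ρ z.1 z.2) (Set.Ioo 0 T ×ˢ Set.univ)
  drift_regular : ContDiffOn ℝ 1 (fun z : ℝ × Space d => b z.1 z.2) (Set.Ioo 0 T ×ˢ Set.univ)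
  equation : ∀ t ∈ Set.Ioo 0 T, ∀ x,
    deriv (fun s => ρ s x) t + divergence (fun y => ρ t y • b t y) x
      = β * Laplacian.laplacian (ρ t) x

/-- `Φ` is a classical solution on `(0, T) × ℝ^d`, continuous on `[0, T] × ℝ^d`, of the backward
viscous Hamilton-Jacobi equation `∂ₜΦ + ½ ‖∇Φ‖² = -β ΔΦ` with terminal value `Φ T = -V`. -/
structure SolvesHamiltonJacobi {d : ℕ} (T β : ℝ) (V : Space d → ℝ)
    (Φ : ℝ → Space d → ℝ) : Prop where
  continuousOn : ContinuousOn (fun z : ℝ × Space d => Φ z.1 z.2) (Set.Icc 0 T ×ˢ Set.univ)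
  regular : ContDiffOn ℝ 2 (fun z : ℝ × Space d => Φ z.1 z.2) (Set.Ioo 0 T ×ˢ Set.univ)
  equation : ∀ t ∈ Set.Ioo 0 T, ∀ x,
    deriv (fun s => Φ s x) t + 1 / 2 * ‖gradient (Φ t) x‖ ^ 2
      = -β * Laplacian.laplacian (Φ t) x
  terminal : ∀ x, Φ T x = -V x

/-- A trial triple: a curve of densities `ρ` from `ρ₀` to `q` and a drift `v`, for which the cost
below is finite. The differential constraint is not yet imposed. -/
structure IsTrial {d : ℕ} (T : ℝ) (V ρ₀ : Space d → ℝ) (ρ : ℝ → Space d → ℝ)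
    (v : ℝ → Space d → Space d) (q : Space d → ℝ) : Prop where
  density : ∀ t ∈ Set.Icc 0 T, IsP2Density (ρ t)
  density_measurable : AEStronglyMeasurable (fun z : ℝ × Space d => ρ z.1 z.2) (slab d T)
  drift_measurable : AEStronglyMeasurable (fun z : ℝ × Space d => v z.1 z.2) (slab d T)
  initial : ∀ x, ρ 0 x = ρ₀ x
  terminal : ∀ x, ρ T x = q x
  finite_action :
    Integrable (fun z : ℝ × Space d => 1 / 2 * ‖v z.1 z.2‖ ^ 2 * ρ z.1 z.2) (slab d T)
  finite_potential : Integrable (fun x => V x * q x)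

/-- The triples over which the mean-field control problem minimizes:
`∂ₜρ + ∇·(ρ v) = β Δρ`, `ρ 0 = ρ₀`, `ρ T = q`. -/
structure IsAdmissible {d : ℕ} (T β : ℝ) (V ρ₀ : Space d → ℝ) (ρ : ℝ → Space d → ℝ)
    (v : ℝ → Space d → Space d) (q : Space d → ℝ) : Prop
    extends IsTrial T V ρ₀ ρ v q where
  fokkerPlanck : SolvesFokkerPlanckWeakly T β ρ v

/-- The cost `∫∫ ½ ‖v‖² ρ dx dt + ∫ V q dx`. -/
noncomputable def cost {d : ℕ} (T : ℝ) (V : Space d → ℝ) (ρ : ℝ → Space d → ℝ)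
    (v : ℝ → Space d → Space d) (q : Space d → ℝ) : ℝ :=
  (∫ z, 1 / 2 * ‖v z.1 z.2‖ ^ 2 * ρ z.1 z.2 ∂(slab d T)) + ∫ x, V x * q x

/-- `(ρ, v, q)` is an optimizer of the mean-field control problem. -/
def IsOptimizer {d : ℕ} (T β : ℝ) (V ρ₀ : Space d → ℝ) (ρ : ℝ → Space d → ℝ)
    (v : ℝ → Space d → Space d) (q : Space d → ℝ) : Prop :=
  IsAdmissible T β V ρ₀ ρ v q ∧
    ∀ ρ' v' q', IsAdmissible T β V ρ₀ ρ' v' q' → cost T V ρ v q ≤ cost T V ρ' v' q'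

/-- The regularized Wasserstein proximal of `ρ₀`, as the set of the terminal densities of the
optimizers of the mean-field control problem. -/
def regWProx {d : ℕ} (T β : ℝ) (V ρ₀ : Space d → ℝ) : Set (Space d → ℝ) :=
  {q | ∃ ρ v, IsOptimizer T β V ρ₀ ρ v q}

/-- The Lagrangian: the cost plus the pairing of `Φ` with `∂ₜρ + ∇·(ρ v) - β Δρ`, integrated by
parts so that all derivatives fall on `Φ`. -/
noncomputable def lagrangian {d : ℕ} (T β : ℝ) (V ρ₀ : Space d → ℝ) (ρ : ℝ → Space d → ℝ)
    (v : ℝ → Space d → Space d) (q : Space d → ℝ) (Φ : ℝ → Space d → ℝ) : ℝ :=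
  cost T V ρ v q + (∫ x, Φ T x * q x) - (∫ x, Φ 0 x * ρ₀ x)
    - ∫ z, backwardOp β v Φ z.1 z.2 * ρ z.1 z.2 ∂(slab d T)

/-- `Φ` can be paired with the constraint along `(ρ, v, q)`: the integrals in the Lagrangian
converge. -/
structure IsPairable {d : ℕ} (T β : ℝ) (ρ₀ : Space d → ℝ) (ρ : ℝ → Space d → ℝ)
    (v : ℝ → Space d → Space d) (q : Space d → ℝ) (Φ : ℝ → Space d → ℝ) : Prop where
  initial : Integrable (fun x => Φ 0 x * ρ₀ x)
  terminal : Integrable (fun x => Φ T x * q x)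
  interior :
    Integrable (fun z : ℝ × Space d => backwardOp β v Φ z.1 z.2 * ρ z.1 z.2) (slab d T)

/-- `Φ` is a Lagrange multiplier at `(ρ, v, q)`: the Lagrangian with multiplier `Φ` equals the cost
at `(ρ, v, q)` and is minimized there, the differential constraint being dropped. -/
structure IsLagrangeMultiplier {d : ℕ} (T β : ℝ) (V ρ₀ : Space d → ℝ) (ρ : ℝ → Space d → ℝ)
    (v : ℝ → Space d → Space d) (q : Space d → ℝ) (Φ : ℝ → Space d → ℝ) : Prop where
  pairable : IsPairable T β ρ₀ ρ v q Φ
  lagrangian_eq : lagrangian T β V ρ₀ ρ v q Φ = cost T V ρ v q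
  minimal : ∀ ρ' v' q', IsTrial T V ρ₀ ρ' v' q' → IsPairable T β ρ₀ ρ' v' q' Φ →
    lagrangian T β V ρ₀ ρ v q Φ ≤ lagrangian T β V ρ₀ ρ' v' q' Φ

end RegWProx

/-!
# The regularized Wasserstein proximal

Put `g = exp (-V / 2β)` and let `u` be the solution of the backward heat equation
`∂ₜu + β Δu = 0` with `u T = g` (`backwardFlow`). The Hopf–Cole transform `Φ = 2β log u`
(`hopfCole`) solves the Hamilton–Jacobi equation with terminal value `-V`. The optimal density is
that of the Doob transform of Brownian motion with `u`, namely `ρ t = u t * w t`, where `w` is the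
forward heat flow of `ρ₀ / u 0` (`bridgeDensity`): a product of solutions of the two heat equations,
it solves the Fokker–Planck equation with drift `∇Φ`. As `u 0` decays no faster than a Gaussian of
variance proportional to `T`, the quotient `ρ₀ / u 0` may grow, but `w` exists and is smooth before
the time `T`.

*Lower bound.* Testing the Fokker–Planck equation of an admissible triple `(ρ, v, q)` with `Φ`
and completing the square gives
`cost (ρ, v, q) = -∫ Φ 0 ρ₀ + ∫∫ ½ ‖v - ∇Φ‖² ρ`. Since `Φ` is not a legitimate test function (it is
unbounded, and its gradient may blow up at `T`), the horizon is moved to `T + δ`, the function `u`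
is lifted by `ε`, and Fatou's lemma leaves the inequality `≥` (`IsWeakFlow.verificationBound_log`,
`Perturbation.verificationBound`, `BridgeData.bridgeCost_le`). The weak equation is first
extended from compactly supported to bounded test functions (`IsWeakFlow.equation_of_bounded`).

*Attainment.* For `ρ = u w` the reverse inequality is an energy estimate. The identity
`(∂ₜ + β Δ) (u log u) = β ‖∇u‖² / u` along Brownian motion started at `z`, integrated against
`ρ₀ z / u 0 z`, bounds the action of `ρ` by `∫ Φ T ρ T - ∫ Φ 0 ρ₀` (`BridgeData.lintegral_energy_le`,
`BridgeData.lintegral_action_le`). In the same way the weak Fokker–Planck equation of `ρ` is a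
mixture of weak equations of Brownian motion (`BridgeData.solvesWeakly`). Second moments are
controlled by relative entropy.

*Uniqueness.* The gap in the lower bound vanishes for an optimizer, so that its drift is `∇Φ` where
its density is positive. As `∇Φ` is only locally bounded, uniqueness for the linear Fokker–Planck
equation is not directly available. Instead the lower bound is applied with `u` replaced by
`u + l η F`, where `F` is a backward heat flow from an intermediate time `S` and `η` depends on
time only and vanishes after `S`. The right-hand side is maximal at `l = 0`, and the vanishing of its first
variation (`BridgeData.stationarity`) determines `∫ (F t / u t) ρ t` for almost every `t < S`. With
`F S = ψ u S` and `S` decreasing to `t` this determines `∫ ψ ρ t`, hence `ρ`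
(`BridgeData.ae_density_eq`); the terminal density is then read off from the weak equation.

*Multiplier.* For arbitrary trial triples the same square completion is an identity for the
Lagrangian (`BridgeData.lagrangian_hopfCole`), which exhibits its minimum.
-/

namespace RegWProx

open Filter Set
open scoped Topology

variable {d : ℕ}

/-! ### Calculus of the operator `∂ₜ + β Δ` -/

/-- The backward heat operator `∂ₜ f + β Δ f`. -/
noncomputable def heatOp (β : ℝ) (f : ℝ → Space d → ℝ) (t : ℝ) (x : Space d) : ℝ :=
  deriv (fun s => f s x) t + β * Laplacian.laplacian (f t) x

theorem backwardOp_eq (β : ℝ) (b : ℝ → Space d → Space d) (f : ℝ → Space d → ℝ) (t : ℝ)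
    (x : Space d) :
    backwardOp β b f t x = heatOp β f t x + inner ℝ (b t x) (gradient (f t) x) := by
  simp only [backwardOp, heatOp]; ring

theorem laplacian_eq_sum_fderiv (f : Space d → ℝ) (x : Space d) :
    Laplacian.laplacian f x = ∑ i, fderiv ℝ (fderiv ℝ f) x (EuclideanSpace.single i 1)
      (EuclideanSpace.single i 1) := by
  rw [InnerProductSpace.laplacian_eq_iteratedFDeriv_orthonormalBasis f
    (EuclideanSpace.basisFun (Fin d) ℝ)]
  simp [iteratedFDeriv_two_apply]

theorem inner_eq_sum (v w : Space d) : inner ℝ v w = ∑ i, v i * w i := by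
  simp [PiLp.inner_apply, mul_comm]

theorem gradient_apply (f : Space d → ℝ) (x : Space d) (i : Fin d) :
    gradient f x i = fderiv ℝ f x (EuclideanSpace.single i 1) := by
  rw [← inner_gradient_left, EuclideanSpace.inner_single_right]
  simp

theorem gradient_mul {f g : Space d → ℝ} {x : Space d} (hf : DifferentiableAt ℝ f x)
    (hg : DifferentiableAt ℝ g x) :
    gradient (fun y => f y * g y) x = f x • gradient g x + g x • gradient f x := by
  ext i
  simp only [gradient_apply, PiLp.add_apply, PiLp.smul_apply]
  rw [fderiv_fun_mul hf hg]
  simp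

theorem gradient_comp {h : ℝ → ℝ} {f : Space d → ℝ} {x : Space d}
    (hh : DifferentiableAt ℝ h (f x)) (hf : DifferentiableAt ℝ f x) :
    gradient (fun y => h (f y)) x = deriv h (f x) • gradient f x := by
  ext i
  simp only [gradient_apply, PiLp.smul_apply]
  have : (fun y => h (f y)) = h ∘ f := rfl
  rw [this, fderiv_comp x hh hf]
  simp [mul_comm]

theorem laplacian_mul {f g : Space d → ℝ} {x : Space d} (hf : ContDiffAt ℝ 2 f x)
    (hg : ContDiffAt ℝ 2 g x) :
    Laplacian.laplacian (fun y => f y * g y) x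
      = f x * Laplacian.laplacian g x + g x * Laplacian.laplacian f x
        + 2 * inner ℝ (gradient f x) (gradient g x) := by
  have hf' : DifferentiableAt ℝ (fderiv ℝ f) x :=
    (hf.fderiv_right (m := 1) le_rfl).differentiableAt one_ne_zero
  have hg' : DifferentiableAt ℝ (fderiv ℝ g) x :=
    (hg.fderiv_right (m := 1) le_rfl).differentiableAt one_ne_zero
  have hfx := hf.differentiableAt two_ne_zero
  have hgx := hg.differentiableAt two_ne_zero
  have key : fderiv ℝ (fun y => f y * g y) =ᶠ[𝓝 x]
      fun y => f y • fderiv ℝ g y + g y • fderiv ℝ f y := by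
    filter_upwards [hf.eventually (by simp), hg.eventually (by simp)] with y h1 h2
    exact fderiv_fun_mul (h1.differentiableAt two_ne_zero) (h2.differentiableAt two_ne_zero)
  rw [laplacian_eq_sum_fderiv, laplacian_eq_sum_fderiv, laplacian_eq_sum_fderiv, key.fderiv_eq,
    inner_eq_sum, Finset.mul_sum, Finset.mul_sum, Finset.mul_sum, ← Finset.sum_add_distrib,
    ← Finset.sum_add_distrib]
  refine Finset.sum_congr rfl fun i _ => ?_
  rw [fderiv_fun_add (hfx.fun_smul hg') (hgx.fun_smul hf'), fderiv_fun_smul hfx hg',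
    fderiv_fun_smul hgx hf']
  simp [gradient_apply]
  ring

theorem laplacian_comp {h : ℝ → ℝ} {f : Space d → ℝ} {x : Space d} (hh : ContDiffAt ℝ 2 h (f x))
    (hf : ContDiffAt ℝ 2 f x) :
    Laplacian.laplacian (fun y => h (f y)) x
      = deriv h (f x) * Laplacian.laplacian f x
        + deriv (deriv h) (f x) * ‖gradient f x‖ ^ 2 := by
  have hf' : DifferentiableAt ℝ (fderiv ℝ f) x :=
    (hf.fderiv_right (m := 1) le_rfl).differentiableAt one_ne_zero
  have hh' : DifferentiableAt ℝ (deriv h) (f x) :=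
    by
    have := (hh.fderiv_right (m := 1) le_rfl).differentiableAt one_ne_zero
    exact (this.clm_apply (differentiableAt_const 1))
  have hfx := hf.differentiableAt two_ne_zero
  have key : fderiv ℝ (fun y => h (f y)) =ᶠ[𝓝 x] fun y => deriv h (f y) • fderiv ℝ f y := by
    filter_upwards [hf.eventually (by simp), hf.continuousAt.eventually (hh.eventually (by simp))]
      with y h1 h2
    ext v
    have : (fun y => h (f y)) = h ∘ f := rfl
    rw [this, fderiv_comp y (h2.differentiableAt two_ne_zero) (h1.differentiableAt two_ne_zero)]
    simp [mul_comm]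
  have hc : DifferentiableAt ℝ (fun y => deriv h (f y)) x := hh'.comp x hfx
  rw [laplacian_eq_sum_fderiv, laplacian_eq_sum_fderiv, key.fderiv_eq, ← real_inner_self_eq_norm_sq,
    inner_eq_sum, Finset.mul_sum, Finset.mul_sum, ← Finset.sum_add_distrib]
  refine Finset.sum_congr rfl fun i _ => ?_
  rw [fderiv_fun_smul hc hf']
  have : (fun y => deriv h (f y)) = deriv h ∘ f := rfl
  rw [this, fderiv_comp x hh' hfx]
  simp [gradient_apply]
  ring

section SpaceTime

variable {f g : ℝ → Space d → ℝ} {t : ℝ} {x : Space d}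

theorem contDiffAt_space (hf : ContDiffAt ℝ 2 (fun z : ℝ × Space d => f z.1 z.2) (t, x)) :
    ContDiffAt ℝ 2 (f t) x :=
  ContDiffAt.comp (f := fun y : Space d => (t, y)) x hf (by fun_prop)

theorem contDiffAt_time (hf : ContDiffAt ℝ 2 (fun z : ℝ × Space d => f z.1 z.2) (t, x)) :
    ContDiffAt ℝ 2 (fun s => f s x) t :=
  ContDiffAt.comp (f := fun s : ℝ => (s, x)) t hf (by fun_prop)

theorem heatOp_mul (β : ℝ) (hf : ContDiffAt ℝ 2 (fun z : ℝ × Space d => f z.1 z.2) (t, x))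
    (hg : ContDiffAt ℝ 2 (fun z : ℝ × Space d => g z.1 z.2) (t, x)) :
    heatOp β (fun s y => f s y * g s y) t x = f t x * heatOp β g t x + g t x * heatOp β f t x
      + 2 * β * inner ℝ (gradient (f t) x) (gradient (g t) x) := by
  have h1 := (contDiffAt_time hf).differentiableAt two_ne_zero
  have h2 := (contDiffAt_time hg).differentiableAt two_ne_zero
  simp only [heatOp]
  rw [laplacian_mul (contDiffAt_space hf) (contDiffAt_space hg), deriv_fun_mul h1 h2]
  ring

theorem heatOp_comp (β : ℝ) {h : ℝ → ℝ} (hh : ContDiffAt ℝ 2 h (f t x))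
    (hf : ContDiffAt ℝ 2 (fun z : ℝ × Space d => f z.1 z.2) (t, x)) :
    heatOp β (fun s y => h (f s y)) t x = deriv h (f t x) * heatOp β f t x
      + β * deriv (deriv h) (f t x) * ‖gradient (f t) x‖ ^ 2 := by
  have h1 := (contDiffAt_time hf).differentiableAt two_ne_zero
  have h2 : deriv (fun s => h (f s x)) t = deriv h (f t x) * deriv (fun s => f s x) t :=
    deriv_comp t (h₂ := h) (h := fun s => f s x) (hh.differentiableAt two_ne_zero) h1
  simp only [heatOp]
  rw [laplacian_comp hh (contDiffAt_space hf), h2]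
  ring

theorem heatOp_add (β : ℝ) (hf : ContDiffAt ℝ 2 (fun z : ℝ × Space d => f z.1 z.2) (t, x))
    (hg : ContDiffAt ℝ 2 (fun z : ℝ × Space d => g z.1 z.2) (t, x)) :
    heatOp β (fun s y => f s y + g s y) t x = heatOp β f t x + heatOp β g t x := by
  have h1 := (contDiffAt_time hf).differentiableAt two_ne_zero
  have h2 := (contDiffAt_time hg).differentiableAt two_ne_zero
  have h3 : Laplacian.laplacian (fun y => f t y + g t y) x
      = Laplacian.laplacian (f t) x + Laplacian.laplacian (g t) x :=
    (contDiffAt_space hf).laplacian_add (contDiffAt_space hg)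
  simp only [heatOp]
  rw [h3, deriv_fun_add h1 h2]
  ring

/-- A function of time alone is scaled through the heat operator by the product rule. -/
theorem heatOp_time_mul (β : ℝ) {η : ℝ → ℝ} (hη : ContDiffAt ℝ 2 η t)
    (hf : ContDiffAt ℝ 2 (fun z : ℝ × Space d => f z.1 z.2) (t, x)) :
    heatOp β (fun s y => η s * f s y) t x = η t * heatOp β f t x + deriv η t * f t x := by
  have h1 := (contDiffAt_time hf).differentiableAt two_ne_zero
  have h2 := hη.differentiableAt two_ne_zero
  have h3 : Laplacian.laplacian (fun y => η t * f t y) x = η t * Laplacian.laplacian (f t) x :=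
    InnerProductSpace.laplacian_smul (η t) (contDiffAt_space hf)
  simp only [heatOp]
  rw [h3, deriv_fun_mul h2 h1]
  ring

/-- **Hopf–Cole transformation**: for `N > 0`, the logarithm `Φ = 2β log N` satisfies
`∂ₜΦ + β ΔΦ = 2β (∂ₜN + β ΔN) / N - ½ ‖∇Φ‖²`. -/
theorem heatOp_log (β : ℝ) (hf : ContDiffAt ℝ 2 (fun z : ℝ × Space d => f z.1 z.2) (t, x))
    (hpos : 0 < f t x) :
    heatOp β (fun s y => 2 * β * Real.log (f s y)) t x
      = 2 * β * heatOp β f t x / f t x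
        - 1 / 2 * ‖gradient (fun y => 2 * β * Real.log (f t y)) x‖ ^ 2 := by
  have hlog : ContDiffAt ℝ 2 (fun r => 2 * β * Real.log r) (f t x) :=
    contDiffAt_const.mul (Real.contDiffAt_log.2 hpos.ne')
  have hd : deriv (fun r => 2 * β * Real.log r) = fun r => 2 * β * r⁻¹ := by
    funext r; simp
  have hdd : deriv (fun r : ℝ => 2 * β * r⁻¹) (f t x) = 2 * β * (-(f t x ^ 2)⁻¹) := by
    simp
  rw [heatOp_comp β hlog hf, hd, hdd, gradient_comp (hlog.differentiableAt two_ne_zero)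
    ((contDiffAt_space hf).differentiableAt two_ne_zero), hd, norm_smul, mul_pow, Real.norm_eq_abs,
    sq_abs]
  field_simp
  ring

end SpaceTime

/-! ### Laplace transforms -/

section Laplace

variable {Ω E E' : Type} [MeasurableSpace Ω] [NormedAddCommGroup E] [NormedSpace ℝ E]
  [NormedAddCommGroup E'] [NormedSpace ℝ E']

/-- The integrand `F` of the Laplace transform `θ ↦ ∫ exp (ℓ ω θ) • F ω` is dominated near `θ`,
with some exponential room to spare. -/
def LaplaceDominated (μ : Measure Ω) (ℓ : Ω → E →L[ℝ] ℝ) (F : Ω → E') (θ : E) : Prop :=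
  ∃ r > 0, Integrable (fun ω => Real.exp (ℓ ω θ + r * ‖ℓ ω‖) * ‖F ω‖) μ

theorem LaplaceDominated.smulRight {μ : Measure Ω} {ℓ : Ω → E →L[ℝ] ℝ} {F : Ω → E'} {θ : E}
    (h : LaplaceDominated μ ℓ F θ) (hℓ : AEStronglyMeasurable ℓ μ) (hF : AEStronglyMeasurable F μ) :
    LaplaceDominated μ ℓ (fun ω => (ℓ ω).smulRight (F ω)) θ := by
  obtain ⟨r, hr, hi⟩ := h
  refine ⟨r / 2, by positivity, ?_⟩
  refine (hi.const_mul (2 / r)).mono' ?_ ?_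
  · have h1 : AEStronglyMeasurable (fun ω => ℓ ω θ) μ := hℓ.apply_continuousLinearMap θ
    have h2 : AEStronglyMeasurable (fun ω => (ℓ ω).smulRight (F ω)) μ :=
      (ContinuousLinearMap.smulRightL ℝ E E').aestronglyMeasurable_comp₂ hℓ hF
    exact (Real.continuous_exp.comp_aestronglyMeasurable
      (h1.add (hℓ.norm.const_mul _))).mul h2.norm
  · refine Eventually.of_forall fun ω => ?_
    rw [ContinuousLinearMap.norm_smulRight_apply, norm_mul, Real.norm_eq_abs, Real.abs_exp,
      norm_mul, norm_norm, norm_norm]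
    have h1 : ‖ℓ ω‖ ≤ 2 / r * Real.exp (r / 2 * ‖ℓ ω‖) := by
      have := Real.add_one_le_exp (r / 2 * ‖ℓ ω‖)
      rw [div_mul_eq_mul_div, le_div_iff₀ hr]
      nlinarith
    have h2 : Real.exp (ℓ ω θ + r * ‖ℓ ω‖)
        = Real.exp (ℓ ω θ + r / 2 * ‖ℓ ω‖) * Real.exp (r / 2 * ‖ℓ ω‖) := by
      rw [← Real.exp_add]; ring_nf
    rw [h2]
    calc Real.exp (ℓ ω θ + r / 2 * ‖ℓ ω‖) * (‖ℓ ω‖ * ‖F ω‖)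
        ≤ Real.exp (ℓ ω θ + r / 2 * ‖ℓ ω‖) * ((2 / r * Real.exp (r / 2 * ‖ℓ ω‖)) * ‖F ω‖) := by
          gcongr
      _ = _ := by ring

theorem LaplaceDominated.integrable {μ : Measure Ω} {ℓ : Ω → E →L[ℝ] ℝ} {F : Ω → E'} {θ : E}
    (h : LaplaceDominated μ ℓ F θ) (hℓ : AEStronglyMeasurable ℓ μ) (hF : AEStronglyMeasurable F μ) :
    Integrable (fun ω => Real.exp (ℓ ω θ) • F ω) μ := by
  obtain ⟨r, hr, hi⟩ := h
  refine hi.mono' ?_ ?_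
  · exact (Real.continuous_exp.comp_aestronglyMeasurable (hℓ.apply_continuousLinearMap θ)).smul hF
  · refine Eventually.of_forall fun ω => ?_
    rw [norm_smul, Real.norm_eq_abs, Real.abs_exp]
    gcongr
    have := norm_nonneg (ℓ ω)
    nlinarith

theorem hasFDerivAt_laplace {μ : Measure Ω} {ℓ : Ω → E →L[ℝ] ℝ} {F : Ω → E'} {θ : E}
    (h : LaplaceDominated μ ℓ F θ) (hℓ : AEStronglyMeasurable ℓ μ) (hF : AEStronglyMeasurable F μ) :
    HasFDerivAt (fun η => ∫ ω, Real.exp (ℓ ω η) • F ω ∂μ)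
      (∫ ω, Real.exp (ℓ ω θ) • (ℓ ω).smulRight (F ω) ∂μ) θ := by
  have hsm := h.smulRight hℓ hF
  have hmeas : ∀ η, AEStronglyMeasurable (fun ω => Real.exp (ℓ ω η) • F ω) μ := fun η =>
    (Real.continuous_exp.comp_aestronglyMeasurable (hℓ.apply_continuousLinearMap η)).smul hF
  obtain ⟨r, hr, hi⟩ := hsm
  refine hasFDerivAt_integral_of_dominated_of_fderiv_le (Metric.ball_mem_nhds θ hr)
    (F' := fun η ω => Real.exp (ℓ ω η) • (ℓ ω).smulRight (F ω))
    (Eventually.of_forall hmeas) (h.integrable hℓ hF) ?_ ?_ hi ?_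
  · have h2 : AEStronglyMeasurable (fun ω => (ℓ ω).smulRight (F ω)) μ :=
      (ContinuousLinearMap.smulRightL ℝ E E').aestronglyMeasurable_comp₂ hℓ hF
    exact (Real.continuous_exp.comp_aestronglyMeasurable (hℓ.apply_continuousLinearMap θ)).smul h2
  · -- on the ball of radius `r` about `θ`, `ℓ ω η ≤ ℓ ω θ + r ‖ℓ ω‖`
    refine Eventually.of_forall fun ω η hη => ?_
    rw [norm_smul, Real.norm_eq_abs, Real.abs_exp]
    gcongr
    have h1 : ℓ ω η = ℓ ω θ + ℓ ω (η - θ) := by simp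
    have h2 : ℓ ω (η - θ) ≤ ‖ℓ ω‖ * ‖η - θ‖ := (le_abs_self _).trans ((ℓ ω).le_opNorm _)
    have h3 : ‖η - θ‖ ≤ r := (mem_ball_iff_norm.1 hη).le
    have h4 : ‖ℓ ω‖ * ‖η - θ‖ ≤ ‖ℓ ω‖ * r := by gcongr
    linarith
  · refine Eventually.of_forall fun ω η _ => ?_
    have h1 : HasFDerivAt (fun η => Real.exp (ℓ ω η)) (Real.exp (ℓ ω η) • ℓ ω) η :=
      (ℓ ω).hasFDerivAt.exp
    have h2 := h1.smul_const (F ω)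
    convert h2 using 1
    ext v
    simp [mul_smul]

/-- Laplace transforms are smooth on open sets where they are dominated: each derivative is again
a Laplace transform. -/
theorem contDiffOn_laplace {μ : Measure Ω} {ℓ : Ω → E →L[ℝ] ℝ} (hℓ : AEStronglyMeasurable ℓ μ)
    {U : Set E} (hU : IsOpen U) (n : ℕ) {E' : Type} [NormedAddCommGroup E'] [NormedSpace ℝ E']
    {F : Ω → E'} (hF : AEStronglyMeasurable F μ) (h : ∀ θ ∈ U, LaplaceDominated μ ℓ F θ) :
    ContDiffOn ℝ n (fun θ => ∫ ω, Real.exp (ℓ ω θ) • F ω ∂μ) U := by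
  induction n generalizing E' with
  | zero =>
    rw [Nat.cast_zero, contDiffOn_zero]
    exact fun θ hθ => (hasFDerivAt_laplace (h θ hθ) hℓ hF).continuousAt.continuousWithinAt
  | succ n ih =>
    rw [Nat.cast_add, Nat.cast_one, contDiffOn_succ_iff_fderiv_of_isOpen hU]
    refine ⟨fun θ hθ =>
      (hasFDerivAt_laplace (h θ hθ) hℓ hF).differentiableAt.differentiableWithinAt, by simp, ?_⟩
    have h2 : AEStronglyMeasurable (fun ω => (ℓ ω).smulRight (F ω)) μ :=
      (ContinuousLinearMap.smulRightL ℝ E E').aestronglyMeasurable_comp₂ hℓ hF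
    exact (ih h2 fun θ hθ => (h θ hθ).smulRight hℓ hF).congr fun θ hθ =>
      (hasFDerivAt_laplace (h θ hθ) hℓ hF).fderiv

end Laplace

/-! ### The heat kernel -/

/-- The heat kernel `(4πs)^{-d/2} exp(-‖x‖² / 4s)` of `∂ₛ = Δ`. -/
noncomputable def heatKernel (s : ℝ) (x : Space d) : ℝ :=
  (4 * Real.pi * s) ^ (-(d / 2 : ℝ)) * Real.exp (-‖x‖ ^ 2 / (4 * s))

theorem heatKernel_pos {s : ℝ} (hs : 0 < s) (x : Space d) : 0 < heatKernel s x := by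
  unfold heatKernel; positivity

theorem heatKernel_nonneg {s : ℝ} (hs : 0 ≤ s) (x : Space d) : 0 ≤ heatKernel s x := by
  unfold heatKernel; positivity

theorem heatKernel_neg (s : ℝ) (x : Space d) : heatKernel s (-x) = heatKernel s x := by
  simp [heatKernel]

theorem heatKernel_sub_comm (s : ℝ) (x y : Space d) :
    heatKernel s (x - y) = heatKernel s (y - x) := by
  rw [← heatKernel_neg, neg_sub]

theorem continuous_heatKernel (s : ℝ) : Continuous (heatKernel s : Space d → ℝ) := by
  unfold heatKernel; fun_prop

theorem measurable_heatKernel : Measurable (fun z : ℝ × Space d => heatKernel z.1 z.2) := by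
  unfold heatKernel; fun_prop

theorem contDiffOn_heatKernel {n : WithTop ℕ∞} :
    ContDiffOn ℝ n (fun z : ℝ × Space d => heatKernel z.1 z.2) (Ioi 0 ×ˢ univ) := by
  intro z hz
  have hz1 : 0 < z.1 := hz.1
  refine ContDiffAt.contDiffWithinAt ?_
  unfold heatKernel
  refine ContDiffAt.mul ?_ ?_
  · exact ContDiffAt.rpow_const_of_ne (by fun_prop) (by positivity)
  · refine ContDiffAt.exp (ContDiffAt.div ?_ (by fun_prop) (by positivity))
    exact (contDiffAt_snd.norm_sq ℝ).neg

theorem integral_exp_neg_mul_norm_sq {b : ℝ} (hb : 0 < b) :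
    ∫ x : Space d, Real.exp (-b * ‖x‖ ^ 2) = (Real.pi / b) ^ (d / 2 : ℝ) := by
  simpa using GaussianFourier.integral_rexp_neg_mul_sq_norm (V := Space d) hb

theorem integrable_exp_neg_mul_norm_sq {b : ℝ} (hb : 0 < b) :
    Integrable (fun x : Space d => Real.exp (-b * ‖x‖ ^ 2)) := by
  by_contra h
  have := integral_exp_neg_mul_norm_sq (d := d) hb
  rw [integral_undef h] at this
  have : 0 < (Real.pi / b) ^ (d / 2 : ℝ) := by positivity
  linarith

theorem heatKernel_eq_mul (s : ℝ) (x : Space d) :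
    heatKernel s x = (4 * Real.pi * s) ^ (-(d / 2 : ℝ)) * Real.exp (-(1 / (4 * s)) * ‖x‖ ^ 2) := by
  unfold heatKernel
  congr 2
  ring

theorem integrable_heatKernel {s : ℝ} (hs : 0 < s) :
    Integrable (heatKernel s : Space d → ℝ) := by
  have h : (heatKernel s : Space d → ℝ) = fun x => (4 * Real.pi * s) ^ (-(d / 2 : ℝ)) *
    Real.exp (-(1 / (4 * s)) * ‖x‖ ^ 2) := funext (heatKernel_eq_mul s)
  rw [h]
  exact (integrable_exp_neg_mul_norm_sq (by positivity)).const_mul _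

theorem integral_heatKernel {s : ℝ} (hs : 0 < s) : ∫ x : Space d, heatKernel s x = 1 := by
  simp only [heatKernel_eq_mul]
  rw [integral_const_mul, integral_exp_neg_mul_norm_sq (by positivity),
    Real.rpow_neg (by positivity)]
  have : Real.pi / (1 / (4 * s)) = 4 * Real.pi * s := by field_simp
  rw [this]
  exact inv_mul_cancel₀ (by positivity)

theorem integrable_heatKernel_sub {s : ℝ} (hs : 0 < s) (z : Space d) :
    Integrable (fun x => heatKernel s (x - z)) :=
  (integrable_heatKernel hs).comp_sub_right z

theorem integral_heatKernel_sub {s : ℝ} (hs : 0 < s) (z : Space d) :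
    ∫ x, heatKernel s (x - z) = 1 := by
  rw [integral_sub_right_eq_self (heatKernel s) z, integral_heatKernel hs]

theorem integrable_heatKernel_sub' {s : ℝ} (hs : 0 < s) (x : Space d) :
    Integrable (fun z => heatKernel s (x - z)) := by
  simpa only [heatKernel_sub_comm s x] using integrable_heatKernel_sub hs x

theorem integral_heatKernel_sub' {s : ℝ} (hs : 0 < s) (x : Space d) :
    ∫ z, heatKernel s (x - z) = 1 := by
  simpa only [heatKernel_sub_comm s x] using integral_heatKernel_sub hs x

/-- Exchanging half of the Gaussian decay: multiplication by `exp (‖x‖² / 8s)` gives a multiple of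
the kernel at time `2s`. -/
theorem exp_mul_heatKernel {s : ℝ} (hs : 0 < s) (x : Space d) :
    Real.exp (‖x‖ ^ 2 / (8 * s)) * heatKernel s x = 2 ^ (d / 2 : ℝ) * heatKernel (2 * s) x := by
  unfold heatKernel
  have h1 : (4 * Real.pi * (2 * s)) ^ (-(d / 2 : ℝ))
      = 2 ^ (-(d / 2 : ℝ)) * (4 * Real.pi * s) ^ (-(d / 2 : ℝ)) := by
    rw [← Real.mul_rpow (by positivity) (by positivity)]; ring_nf
  have h2 : Real.exp (-‖x‖ ^ 2 / (4 * (2 * s)))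
      = Real.exp (‖x‖ ^ 2 / (8 * s)) * Real.exp (-‖x‖ ^ 2 / (4 * s)) := by
    rw [← Real.exp_add]; congr 1; field_simp; ring
  have h3 : (2 : ℝ) ^ (d / 2 : ℝ) * 2 ^ (-(d / 2 : ℝ)) = 1 := by
    rw [← Real.rpow_add two_pos]; simp
  rw [h1, h2]
  linear_combination (-(4 * Real.pi * s) ^ (-(d / 2 : ℝ)) *
    (Real.exp (‖x‖ ^ 2 / (8 * s)) * Real.exp (-‖x‖ ^ 2 / (4 * s)))) * h3

/-- Completing the square in a product of two heat kernels. -/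
theorem heatKernel_mul_heatKernel {s t : ℝ} (hs : 0 < s) (ht : 0 < t) (x y z : Space d) :
    heatKernel s (x - z) * heatKernel t (y - x) = heatKernel (s + t) (y - z) *
      heatKernel (s * t / (s + t)) (x - (s + t)⁻¹ • (t • z + s • y)) := by
  unfold heatKernel
  have hst : 0 < s + t := by positivity
  have h1 : (4 * Real.pi * s) ^ (-(d / 2 : ℝ)) * (4 * Real.pi * t) ^ (-(d / 2 : ℝ))
      = (4 * Real.pi * (s + t)) ^ (-(d / 2 : ℝ)) *
        (4 * Real.pi * (s * t / (s + t))) ^ (-(d / 2 : ℝ)) := by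
    rw [← Real.mul_rpow (by positivity) (by positivity),
      ← Real.mul_rpow (by positivity) (by positivity)]
    congr 1; field_simp
  have h2 : Real.exp (-‖x - z‖ ^ 2 / (4 * s)) * Real.exp (-‖y - x‖ ^ 2 / (4 * t))
      = Real.exp (-‖y - z‖ ^ 2 / (4 * (s + t))) *
        Real.exp (-‖x - (s + t)⁻¹ • (t • z + s • y)‖ ^ 2 / (4 * (s * t / (s + t)))) := by
    rw [← Real.exp_add, ← Real.exp_add]
    congr 1
    have e1 : x - (s + t)⁻¹ • (t • z + s • y)
        = (s + t)⁻¹ • (t • (x - z) - s • (y - x)) := by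
      have : x = (s + t)⁻¹ • ((s + t) • x) := by rw [smul_smul, inv_mul_cancel₀ hst.ne', one_smul]
      nth_rewrite 1 [this]
      rw [← smul_sub]
      congr 1
      module
    have e2 : y - z = (x - z) + (y - x) := by abel
    rw [e1, e2, norm_smul, mul_pow, norm_sub_sq_real (t • (x - z)), norm_add_sq_real, norm_smul,
      norm_smul, real_inner_smul_left, real_inner_smul_right, norm_inv, inv_pow, Real.norm_eq_abs,
      sq_abs,
      mul_pow, mul_pow, Real.norm_eq_abs, Real.norm_eq_abs, sq_abs, sq_abs]
    field_simp
    ring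
  linear_combination (Real.exp (-‖x - z‖ ^ 2 / (4 * s)) * Real.exp (-‖y - x‖ ^ 2 / (4 * t))) * h1 +
    ((4 * Real.pi * (s + t)) ^ (-(d / 2 : ℝ)) *
        (4 * Real.pi * (s * t / (s + t))) ^ (-(d / 2 : ℝ))) * h2

/-- The Chapman–Kolmogorov equation. -/
theorem integral_heatKernel_mul_heatKernel {s t : ℝ} (hs : 0 < s) (ht : 0 < t) (y z : Space d) :
    ∫ x, heatKernel s (x - z) * heatKernel t (y - x) = heatKernel (s + t) (y - z) := by
  simp only [heatKernel_mul_heatKernel hs ht]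
  rw [integral_const_mul, integral_heatKernel_sub (by positivity), mul_one]

/-! ### The heat flow -/

/-- The heat flow `(e^{sΔ} f)(x)`, written as a Gaussian average so that it makes sense, and is
equal to `f x`, at `s = 0`. -/
noncomputable def heatFlow (f : Space d → ℝ) (s : ℝ) (x : Space d) : ℝ :=
  ∫ ξ, f (x + √s • ξ) * heatKernel 1 ξ

theorem heatFlow_zero (f : Space d → ℝ) (x : Space d) : heatFlow f 0 x = f x := by
  simp [heatFlow, integral_const_mul, integral_heatKernel]

theorem heatKernel_one_smul {s : ℝ} (hs : 0 < s) (y : Space d) :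
    heatKernel s (√s • y) = (√s ^ d)⁻¹ * heatKernel 1 y := by
  unfold heatKernel
  have h : √s ^ d = s ^ (d / 2 : ℝ) := by
    rw [Real.sqrt_eq_rpow, ← Real.rpow_natCast, ← Real.rpow_mul hs.le]
    congr 1; ring
  rw [h, norm_smul, mul_pow, Real.norm_eq_abs, sq_abs, Real.sq_sqrt hs.le, ← Real.rpow_neg hs.le,
    Real.mul_rpow (by positivity) hs.le, mul_one]
  have : -(s * ‖y‖ ^ 2) / (4 * s) = -‖y‖ ^ 2 / (4 * 1) := by field_simp
  rw [this]
  ring_nf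

theorem heatFlow_eq (f : Space d → ℝ) {s : ℝ} (hs : 0 < s) (x : Space d) :
    heatFlow f s x = ∫ z, heatKernel s (x - z) * f z := by
  have h1 : ∀ ξ : Space d, f (x + √s • ξ) * heatKernel 1 ξ
      = √s ^ d * ((fun y => f (x + y) * heatKernel s y) (√s • ξ)) := by
    intro ξ
    simp only [heatKernel_one_smul hs]
    have : √s ^ d ≠ 0 := by positivity
    field_simp
  simp only [heatFlow, h1]
  rw [integral_const_mul, Measure.integral_comp_smul volume (fun y => f (x + y) * heatKernel s y)]
  have h2 : ∫ y, f (x + y) * heatKernel s y = ∫ z, heatKernel s (x - z) * f z := by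
    rw [← integral_add_left_eq_self (fun z => heatKernel s (x - z) * f z) x]
    refine integral_congr_ae (Eventually.of_forall fun y => ?_)
    simp only [sub_add_cancel_left, heatKernel_neg]
    ring
  rw [h2, finrank_euclideanSpace_fin, smul_eq_mul, abs_of_nonneg (by positivity), ← mul_assoc,
    mul_inv_cancel₀ (by positivity), one_mul]

theorem integrable_heatFlow_integrand {f : Space d → ℝ} (hf : Continuous f) {M : ℝ}
    (hM : ∀ x, |f x| ≤ M) (s : ℝ) (x : Space d) :
    Integrable (fun ξ => f (x + √s • ξ) * heatKernel 1 ξ) :=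
  (integrable_heatKernel one_pos).bdd_mul (c := M) (by fun_prop)
    (Eventually.of_forall fun _ => hM _)

theorem abs_heatFlow_le {f : Space d → ℝ} {M : ℝ} (hM : ∀ x, |f x| ≤ M) (s : ℝ) (x : Space d) :
    |heatFlow f s x| ≤ M := by
  have h := norm_integral_le_of_norm_le (μ := volume)
    (f := fun ξ : Space d => f (x + √s • ξ) * heatKernel 1 ξ)
    (g := fun ξ => M * heatKernel 1 ξ) ((integrable_heatKernel one_pos).const_mul M)
    (Eventually.of_forall fun _ => by
      rw [norm_mul, Real.norm_eq_abs, Real.norm_of_nonneg (heatKernel_nonneg zero_le_one _)]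
      exact mul_le_mul_of_nonneg_right (hM _) (heatKernel_nonneg zero_le_one _))
  rwa [integral_const_mul, integral_heatKernel one_pos, mul_one] at h

theorem heatFlow_mono {f g : Space d → ℝ} (hf : Continuous f) (hg : Continuous g) {M : ℝ}
    (hfM : ∀ x, |f x| ≤ M) (hgM : ∀ x, |g x| ≤ M) (hfg : ∀ x, f x ≤ g x) (s : ℝ) (x : Space d) :
    heatFlow f s x ≤ heatFlow g s x :=
  integral_mono (integrable_heatFlow_integrand hf hfM s x)
    (integrable_heatFlow_integrand hg hgM s x) fun _ =>
    mul_le_mul_of_nonneg_right (hfg _) (heatKernel_nonneg zero_le_one _)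

theorem heatFlow_neg (f : Space d → ℝ) (s : ℝ) (x : Space d) :
    heatFlow (fun y => -f y) s x = -heatFlow f s x := by
  simp only [heatFlow, neg_mul]
  exact integral_neg _

theorem heatFlow_pos {f : Space d → ℝ} (hf : Continuous f) {M : ℝ}
    (hM : ∀ x, |f x| ≤ M) (hpos : ∀ x, 0 < f x) (s : ℝ) (x : Space d) : 0 < heatFlow f s x := by
  refine (integral_pos_iff_support_of_nonneg (fun ξ => ?_)
    (integrable_heatFlow_integrand hf hM s x)).2 ?_
  · exact mul_nonneg (hpos _).le (heatKernel_nonneg zero_le_one _)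
  · have : Function.support (fun ξ : Space d => f (x + √s • ξ) * heatKernel 1 ξ) = univ := by
      ext ξ
      simp [(hpos _).ne', (heatKernel_pos one_pos ξ).ne']
    rw [this, Measure.measure_univ_pos]
    exact NeZero.ne _

/-- The heat flow of a family of functions, jointly continuous and uniformly bounded, is jointly
continuous up to time `0`. -/
theorem tendsto_heatFlow {ι : Type*} {l : Filter ι} [l.IsCountablyGenerated]
    {f : ι → Space d → ℝ} {M : ℝ}
    (hf : ∀ i, Continuous (f i)) (hM : ∀ i x, |f i x| ≤ M) {s : ι → ℝ} {x : ι → Space d} {s₀ : ℝ}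
    {x₀ : Space d} {f₀ : Space d → ℝ} (hs : Tendsto s l (𝓝 s₀)) (hx : Tendsto x l (𝓝 x₀))
    (hlim : ∀ (y : ι → Space d) (y₀ : Space d), Tendsto y l (𝓝 y₀) →
      Tendsto (fun i => f i (y i)) l (𝓝 (f₀ y₀))) :
    Tendsto (fun i => heatFlow (f i) (s i) (x i)) l (𝓝 (heatFlow f₀ s₀ x₀)) := by
  refine tendsto_integral_filter_of_dominated_convergence (fun ξ => M * heatKernel 1 ξ)
    (Eventually.of_forall fun i => ?_)
    (Eventually.of_forall fun i => Eventually.of_forall fun ξ => ?_)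
    ((integrable_heatKernel one_pos).const_mul M) (Eventually.of_forall fun ξ => ?_)
  · exact (integrable_heatFlow_integrand (hf i) (hM i) _ _).aestronglyMeasurable
  · rw [norm_mul, Real.norm_eq_abs, Real.norm_of_nonneg (heatKernel_nonneg zero_le_one _)]
    exact mul_le_mul_of_nonneg_right (hM i _) (heatKernel_nonneg zero_le_one _)
  · refine (hlim _ _ ?_).mul_const _
    exact hx.add (((Real.continuous_sqrt.tendsto _).comp hs).smul_const ξ)

theorem continuous_heatFlow {f : Space d → ℝ} (hf : Continuous f) {M : ℝ} (hM : ∀ x, |f x| ≤ M) :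
    Continuous (fun z : ℝ × Space d => heatFlow f z.1 z.2) := by
  rw [continuous_iff_continuousAt]
  intro z
  exact tendsto_heatFlow (fun _ => hf) (fun _ => hM) continuous_fst.continuousAt
    continuous_snd.continuousAt fun y y₀ hy => (hf.tendsto y₀).comp hy

theorem continuous_heatFlow_space {f : Space d → ℝ} (hf : Continuous f) {M : ℝ}
    (hM : ∀ x, |f x| ≤ M) (s : ℝ) : Continuous (heatFlow f s) :=
  (continuous_heatFlow hf hM).comp (f := fun x : Space d => (s, x)) (by fun_prop)

/-- The semigroup property of the heat flow. -/
theorem heatFlow_heatFlow {f : Space d → ℝ} (hf : Continuous f) {M : ℝ} (hM : ∀ x, |f x| ≤ M)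
    {s t : ℝ} (hs : 0 < s) (ht : 0 ≤ t) (x : Space d) :
    heatFlow (heatFlow f t) s x = heatFlow f (s + t) x := by
  rcases ht.eq_or_lt with rfl | ht
  · rw [add_zero]; congr 1; funext y; exact heatFlow_zero f y
  rw [heatFlow_eq _ hs, heatFlow_eq _ (by positivity)]
  have h1 : ∀ y, heatKernel s (x - y) * heatFlow f t y
      = ∫ z, heatKernel s (y - x) * heatKernel t (z - y) * f z := by
    intro y
    rw [heatFlow_eq _ ht, ← integral_const_mul]
    refine integral_congr_ae (Eventually.of_forall fun z => ?_)
    simp only [heatKernel_sub_comm s x y, heatKernel_sub_comm t y z, mul_assoc]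
  simp only [h1]
  rw [integral_integral_swap]
  · refine integral_congr_ae (Eventually.of_forall fun z => ?_)
    simp only
    rw [integral_mul_const, integral_heatKernel_mul_heatKernel hs ht, heatKernel_sub_comm]
  · have hm : AEStronglyMeasurable (fun z : Space d × Space d =>
        heatKernel s (z.1 - x) * heatKernel t (z.2 - z.1) * f z.2) (volume.prod volume) := by
      have c1 := continuous_heatKernel (d := d) s
      have c2 := continuous_heatKernel (d := d) t
      exact Continuous.aestronglyMeasurable (by fun_prop)
    have hb : Integrable (fun z : Space d × Space d =>
        heatKernel s (z.1 - x) * heatKernel t (z.2 - z.1)) (volume.prod volume) := by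
      rw [integrable_prod_iff]
      · refine ⟨Eventually.of_forall fun y =>
          (integrable_heatKernel_sub ht y).const_mul (heatKernel s (y - x)), ?_⟩
        simp only [norm_mul, integral_const_mul, Real.norm_of_nonneg (heatKernel_nonneg hs.le _),
          Real.norm_of_nonneg (heatKernel_nonneg ht.le _), integral_heatKernel_sub ht, mul_one]
        exact integrable_heatKernel_sub hs x
      · have c1 := continuous_heatKernel (d := d) s
        have c2 := continuous_heatKernel (d := d) t
        exact Continuous.aestronglyMeasurable (by fun_prop)
    refine hb.mul_bdd (c := M) ?_ (Eventually.of_forall fun _ => hM _)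
    exact Continuous.aestronglyMeasurable (by fun_prop)

/-! ### Smoothness of the heat flow -/

/-- `f` is integrable against every Gaussian `exp (-a ‖z‖²)` with `a > a₀`, so that its heat flow
exists for the times `0 < s < 1 / 4a₀`. -/
structure HeatGrowth (a₀ : ℝ) (f : Space d → ℝ) : Prop where
  aestronglyMeasurable : AEStronglyMeasurable f
  integrable : ∀ a > a₀, Integrable (fun z => Real.exp (-a * ‖z‖ ^ 2) * f z)

theorem HeatGrowth.mul_coord {a₀ : ℝ} {f : Space d → ℝ} (h : HeatGrowth a₀ f) (i : Fin d) :
    HeatGrowth a₀ (fun z => z i * f z) := by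
  refine ⟨?_, fun a ha => ?_⟩
  · exact (Continuous.aestronglyMeasurable (by fun_prop)).mul h.aestronglyMeasurable
  · set c := (a - a₀) / 2 with hc
    have hcpos : 0 < c := by rw [hc]; linarith
    have hi := h.integrable (a - c) (by rw [hc]; linarith)
    have hb : ∀ z : Space d, ‖Real.exp (-c * ‖z‖ ^ 2) * z i‖ ≤ 1 + 1 / c := by
      intro z
      rw [norm_mul, Real.norm_eq_abs, Real.abs_exp]
      have h1 : ‖z i‖ ≤ ‖z‖ := PiLp.norm_apply_le z i
      have h2 : ‖z‖ ≤ 1 + ‖z‖ ^ 2 := by nlinarith [norm_nonneg z, sq_nonneg (‖z‖ - 1)]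
      have h3 := Real.add_one_le_exp (c * ‖z‖ ^ 2)
      have h4 : 1 + ‖z‖ ^ 2 ≤ (1 + 1 / c) * Real.exp (c * ‖z‖ ^ 2) := by
        have h5 : (1 + 1 / c) * (c * ‖z‖ ^ 2 + 1) = c * ‖z‖ ^ 2 + 1 + ‖z‖ ^ 2 + 1 / c := by
          field_simp; ring
        have h6 : 0 ≤ c * ‖z‖ ^ 2 := by positivity
        have h7 : 0 < 1 / c := by positivity
        have h8 := mul_le_mul_of_nonneg_left h3 (show 0 ≤ 1 + 1 / c by positivity)
        linarith
      rw [neg_mul, Real.exp_neg, inv_mul_le_iff₀ (Real.exp_pos _), mul_comm (Real.exp _)]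
      linarith
    have := hi.bdd_mul (Continuous.aestronglyMeasurable (by fun_prop)) (Eventually.of_forall hb)
    refine this.congr (Eventually.of_forall fun z => ?_)
    simp only
    have : Real.exp (-a * ‖z‖ ^ 2)
        = Real.exp (-c * ‖z‖ ^ 2) * Real.exp (-(a - c) * ‖z‖ ^ 2) := by
      rw [← Real.exp_add]; ring_nf
    rw [this]; ring

/-- A bounded continuous function has no Gaussian growth. -/
theorem HeatGrowth.of_bounded {f : Space d → ℝ} (hf : Continuous f) {M : ℝ}
    (hM : ∀ x, |f x| ≤ M) : HeatGrowth 0 f :=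
  ⟨hf.aestronglyMeasurable, fun _ ha => (integrable_exp_neg_mul_norm_sq ha).mul_bdd
    hf.aestronglyMeasurable (Eventually.of_forall hM)⟩

/-- The exponents `θ ↦ θ₁ + θ₂ ‖z‖² + ⟪z, θ₃⟫` of Gaussians in the variable `z`. -/
noncomputable def gaussExponent (z : Space d) : (ℝ × ℝ × Space d) →L[ℝ] ℝ :=
  ContinuousLinearMap.fst ℝ ℝ (ℝ × Space d) +
    ‖z‖ ^ 2 • (ContinuousLinearMap.fst ℝ ℝ (Space d)).comp
      (ContinuousLinearMap.snd ℝ ℝ (ℝ × Space d)) +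
    (innerSL ℝ z).comp ((ContinuousLinearMap.snd ℝ ℝ (Space d)).comp
      (ContinuousLinearMap.snd ℝ ℝ (ℝ × Space d)))

theorem gaussExponent_apply (z : Space d) (θ : ℝ × ℝ × Space d) :
    gaussExponent z θ = θ.1 + θ.2.1 * ‖z‖ ^ 2 + inner ℝ z θ.2.2 := by
  simp [gaussExponent, mul_comm]

theorem continuous_gaussExponent : Continuous (gaussExponent : Space d → _) := by
  unfold gaussExponent
  fun_prop

theorem norm_gaussExponent_le (z : Space d) : ‖gaussExponent z‖ ≤ 2 + 2 * ‖z‖ ^ 2 := by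
  refine ContinuousLinearMap.opNorm_le_bound _ (by positivity) fun θ => ?_
  rw [gaussExponent_apply]
  have h1 : ‖θ.1‖ ≤ ‖θ‖ := norm_fst_le θ
  have h0 : ‖θ.2‖ ≤ ‖θ‖ := norm_snd_le θ
  have h2 : ‖θ.2.1‖ ≤ ‖θ‖ := (norm_fst_le θ.2).trans h0
  have h3 : ‖θ.2.2‖ ≤ ‖θ‖ := (norm_snd_le θ.2).trans h0
  have h4 : ‖inner ℝ z θ.2.2‖ ≤ ‖z‖ * ‖θ.2.2‖ := norm_inner_le_norm _ _
  have h5 : ‖θ.2.1 * ‖z‖ ^ 2‖ = ‖θ.2.1‖ * ‖z‖ ^ 2 := by simp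
  have h6 : ‖z‖ ≤ 1 + ‖z‖ ^ 2 := by nlinarith [norm_nonneg z, sq_nonneg (‖z‖ - 1)]
  calc ‖θ.1 + θ.2.1 * ‖z‖ ^ 2 + inner ℝ z θ.2.2‖
      ≤ ‖θ.1‖ + ‖θ.2.1 * ‖z‖ ^ 2‖ + ‖inner ℝ z θ.2.2‖ := norm_add₃_le
    _ ≤ ‖θ‖ + ‖θ‖ * ‖z‖ ^ 2 + (1 + ‖z‖ ^ 2) * ‖θ‖ := by
        rw [h5]
        refine add_le_add (add_le_add h1 ?_) (h4.trans ?_) <;> gcongr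
    _ = _ := by ring

theorem HeatGrowth.laplaceDominated {a₀ : ℝ} {f : Space d → ℝ} (h : HeatGrowth a₀ f)
    {θ : ℝ × ℝ × Space d} (hθ : θ.2.1 < -a₀) :
    LaplaceDominated volume gaussExponent f θ := by
  -- a quarter of the distance of the quadratic coefficient from the critical value `-a₀`: half of
  -- that distance is spent on the linear term and on the variation of `θ`
  set κ := (-a₀ - θ.2.1) / 4 with hκ
  have hκpos : 0 < κ := by rw [hκ]; linarith
  have hi := (h.integrable (a₀ + 2 * κ) (by linarith)).norm.const_mul
    (Real.exp (θ.1 + κ + ‖θ.2.2‖ ^ 2 / (4 * κ)))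
  refine ⟨κ / 2, by positivity, hi.mono' ?_ (Eventually.of_forall fun z => ?_)⟩
  · have := continuous_gaussExponent (d := d)
    exact (Continuous.aestronglyMeasurable (by fun_prop)).mul h.aestronglyMeasurable.norm
  · rw [norm_mul, norm_norm, Real.norm_eq_abs, Real.abs_exp, norm_mul,
      Real.norm_eq_abs (Real.exp _), Real.abs_exp, ← mul_assoc, ← Real.exp_add]
    refine mul_le_mul_of_nonneg_right (Real.exp_le_exp.2 ?_) (norm_nonneg _)
    have h1 := norm_gaussExponent_le z
    have h2 : inner ℝ z θ.2.2 ≤ κ * ‖z‖ ^ 2 + ‖θ.2.2‖ ^ 2 / (4 * κ) := by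
      have e1 : ‖z‖ * ‖θ.2.2‖ ≤ κ * ‖z‖ ^ 2 + ‖θ.2.2‖ ^ 2 / (4 * κ) := by
        have : κ * ‖z‖ ^ 2 + ‖θ.2.2‖ ^ 2 / (4 * κ) - ‖z‖ * ‖θ.2.2‖
            = (2 * κ * ‖z‖ - ‖θ.2.2‖) ^ 2 / (4 * κ) := by field_simp; ring
        have : 0 ≤ (2 * κ * ‖z‖ - ‖θ.2.2‖) ^ 2 / (4 * κ) := by positivity
        linarith
      exact (real_inner_le_norm z θ.2.2).trans e1
    have h3 : κ / 2 * ‖gaussExponent z‖ ≤ κ / 2 * (2 + 2 * ‖z‖ ^ 2) := by gcongr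
    have h4 : θ.2.1 = -a₀ - 4 * κ := by rw [hκ]; ring
    rw [gaussExponent_apply, h4]
    nlinarith

/-- The exponent which yields the heat kernel. -/
noncomputable def heatExponent (s : ℝ) (x : Space d) : ℝ × ℝ × Space d :=
  (-‖x‖ ^ 2 / (4 * s) - d / 2 * Real.log (4 * Real.pi * s), -1 / (4 * s), (1 / (2 * s)) • x)

theorem exp_gaussExponent_heatExponent {s : ℝ} (hs : 0 < s) (x z : Space d) :
    Real.exp (gaussExponent z (heatExponent s x)) = heatKernel s (x - z) := by
  rw [gaussExponent_apply, heatExponent, heatKernel, Real.rpow_def_of_pos (by positivity),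
    ← Real.exp_add, norm_sub_sq_real, real_inner_smul_right, real_inner_comm]
  congr 1
  simp only
  field_simp
  ring

theorem heatExponent_mem {a₀ s : ℝ} (hs : 0 < s) (hsa : 4 * a₀ * s < 1) (x : Space d) :
    (heatExponent s x).2.1 < -a₀ := by
  simp only [heatExponent]
  rw [div_lt_iff₀ (by positivity)]
  linarith

theorem heatFlow_eq_laplace (f : Space d → ℝ) {s : ℝ} (hs : 0 < s) (x : Space d) :
    heatFlow f s x = ∫ z, Real.exp (gaussExponent z (heatExponent s x)) • f z := by
  simp only [heatFlow_eq f hs, exp_gaussExponent_heatExponent hs, smul_eq_mul]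

theorem HeatGrowth.integrable_kernel {a₀ : ℝ} {f : Space d → ℝ} (h : HeatGrowth a₀ f) {s : ℝ}
    (hs : 0 < s) (hsa : 4 * a₀ * s < 1) (x : Space d) :
    Integrable (fun z => heatKernel s (x - z) * f z) := by
  have := (h.laplaceDominated (heatExponent_mem hs hsa x)).integrable
    continuous_gaussExponent.aestronglyMeasurable h.aestronglyMeasurable
  simpa only [exp_gaussExponent_heatExponent hs, smul_eq_mul] using this

theorem isOpen_heatDomain (a₀ : ℝ) :
    IsOpen ({s | 0 < s ∧ 4 * a₀ * s < 1} ×ˢ univ : Set (ℝ × Space d)) := by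
  have h1 : IsOpen {s : ℝ | 0 < s} := isOpen_lt (by fun_prop) (by fun_prop)
  have h2 : IsOpen {s : ℝ | 4 * a₀ * s < 1} := isOpen_lt (by fun_prop) (by fun_prop)
  exact (h1.inter h2).prod isOpen_univ

theorem HeatGrowth.contDiffOn_heatFlow {a₀ : ℝ} {f : Space d → ℝ} (h : HeatGrowth a₀ f) (n : ℕ) :
    ContDiffOn ℝ n (fun z : ℝ × Space d => heatFlow f z.1 z.2)
      ({s | 0 < s ∧ 4 * a₀ * s < 1} ×ˢ univ) := by
  have hU : IsOpen {θ : ℝ × ℝ × Space d | θ.2.1 < -a₀} :=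
    isOpen_lt (by fun_prop) (by fun_prop)
  have h1 := contDiffOn_laplace (μ := volume) (ℓ := gaussExponent (d := d))
    continuous_gaussExponent.aestronglyMeasurable hU n h.aestronglyMeasurable
    fun θ hθ => h.laplaceDominated hθ
  have h2 : ContDiffOn ℝ n (fun z : ℝ × Space d => heatExponent z.1 z.2)
      ({s | 0 < s ∧ 4 * a₀ * s < 1} ×ˢ univ) := by
    intro z hz
    have hz1 : 0 < z.1 := hz.1.1
    have c1 : ContDiffAt ℝ n (fun z : ℝ × Space d => 4 * z.1) z := by fun_prop
    have c2 : ContDiffAt ℝ n (fun z : ℝ × Space d => 2 * z.1) z := by fun_prop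
    refine ContDiffAt.contDiffWithinAt ?_
    unfold heatExponent
    refine ContDiffAt.prodMk ?_ (ContDiffAt.prodMk ?_ ?_)
    · refine ContDiffAt.sub ?_ ?_
      · exact (contDiffAt_snd.norm_sq ℝ).neg.div c1 (by positivity)
      · exact contDiffAt_const.mul (ContDiffAt.log (by fun_prop) (by positivity))
    · exact contDiffAt_const.div c1 (by positivity)
    · exact (contDiffAt_const.div c2 (by positivity)).smul contDiffAt_snd
  refine (h1.comp h2 fun z hz => heatExponent_mem hz.1.1 hz.1.2 z.2).congr fun z hz => ?_
  exact heatFlow_eq_laplace f hz.1.1 z.2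

section Derivatives

variable {a₀ : ℝ} {f : Space d → ℝ} {s : ℝ}

theorem HeatGrowth.laplace_deriv_apply (h : HeatGrowth a₀ f) (hs : 0 < s) (hsa : 4 * a₀ * s < 1)
    (x : Space d) (v : ℝ × ℝ × Space d) :
    (∫ z, Real.exp (gaussExponent z (heatExponent s x)) • (gaussExponent z).smulRight (f z)) v
      = ∫ z, heatKernel s (x - z) * (gaussExponent z v * f z) := by
  have hm := continuous_gaussExponent (d := d) |>.aestronglyMeasurable (μ := volume)
  rw [ContinuousLinearMap.integral_apply]
  · simp [exp_gaussExponent_heatExponent hs]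
  · exact ((h.laplaceDominated (heatExponent_mem hs hsa x)).smulRight hm
      h.aestronglyMeasurable).integrable hm
      ((ContinuousLinearMap.smulRightL ℝ _ _).aestronglyMeasurable_comp₂ hm h.aestronglyMeasurable)

theorem HeatGrowth.hasDerivAt_heatFlow (h : HeatGrowth a₀ f) (hs : 0 < s) (hsa : 4 * a₀ * s < 1)
    (x : Space d) :
    HasDerivAt (fun r => heatFlow f r x)
      (∫ z, heatKernel s (x - z) * ((‖x - z‖ ^ 2 / (4 * s ^ 2) - d / (2 * s)) * f z)) s := by
  have hm := continuous_gaussExponent (d := d) |>.aestronglyMeasurable (μ := volume)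
  have h1 := hasFDerivAt_laplace (h.laplaceDominated (heatExponent_mem hs hsa x)) hm
    h.aestronglyMeasurable
  have h2 : HasDerivAt (fun r => heatExponent r x)
      (‖x‖ ^ 2 / (4 * s ^ 2) - d / (2 * s), 1 / (4 * s ^ 2), (-1 / (2 * s ^ 2)) • x) s := by
    have e4 : HasDerivAt (fun r : ℝ => 4 * r) 4 s := by
      simpa using (hasDerivAt_id s).const_mul 4
    have e2 : HasDerivAt (fun r : ℝ => 2 * r) 2 s := by
      simpa using (hasDerivAt_id s).const_mul 2
    have ep : HasDerivAt (fun r : ℝ => 4 * Real.pi * r) (4 * Real.pi) s := by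
      simpa using (hasDerivAt_id s).const_mul (4 * Real.pi)
    have i1 : HasDerivAt (fun r : ℝ => -‖x‖ ^ 2 / (4 * r)
        - d / 2 * Real.log (4 * Real.pi * r)) (‖x‖ ^ 2 / (4 * s ^ 2) - d / (2 * s)) s := by
      refine (((hasDerivAt_const s (-‖x‖ ^ 2)).fun_div e4 (by positivity)).fun_sub
        ((ep.log (by positivity)).const_mul (d / 2 : ℝ))).congr_deriv ?_
      field_simp
      ring
    have i2 : HasDerivAt (fun r : ℝ => -1 / (4 * r)) (1 / (4 * s ^ 2)) s := by
      refine ((hasDerivAt_const s (-1 : ℝ)).fun_div e4 (by positivity)).congr_deriv ?_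
      field_simp
      ring
    have i3 : HasDerivAt (fun r : ℝ => (1 / (2 * r)) • x) ((-1 / (2 * s ^ 2)) • x) s := by
      refine HasDerivAt.smul_const ?_ x
      refine ((hasDerivAt_const s (1 : ℝ)).fun_div e2 (by positivity)).congr_deriv ?_
      field_simp
      ring
    exact i1.prodMk (i2.prodMk i3)
  have h3 := h1.comp_hasDerivAt s h2
  rw [h.laplace_deriv_apply hs hsa] at h3
  have h4 : (fun r => heatFlow f r x) =ᶠ[𝓝 s]
      (fun η => ∫ z, Real.exp (gaussExponent z η) • f z) ∘ (fun r => heatExponent r x) := by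
    filter_upwards [lt_mem_nhds hs] with r hr
    exact heatFlow_eq_laplace f hr x
  refine (h3.congr_of_eventuallyEq h4).congr_deriv ?_
  refine integral_congr_ae (Eventually.of_forall fun z => ?_)
  simp only [gaussExponent_apply, real_inner_smul_right, norm_sub_sq_real, real_inner_comm]
  field_simp
  ring

theorem HeatGrowth.differentiableAt_heatFlow (h : HeatGrowth a₀ f) (hs : 0 < s)
    (hsa : 4 * a₀ * s < 1) (x : Space d) : DifferentiableAt ℝ (heatFlow f s) x := by
  have h1 := ((h.contDiffOn_heatFlow 1).contDiffAt ((isOpen_heatDomain a₀).mem_nhds (x := (s, x))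
    ⟨⟨hs, hsa⟩, mem_univ _⟩)).differentiableAt (by simp)
  exact DifferentiableAt.comp (f := fun y : Space d => (s, y)) x h1 (by fun_prop)

theorem HeatGrowth.fderiv_heatFlow (h : HeatGrowth a₀ f) (hs : 0 < s) (hsa : 4 * a₀ * s < 1)
    (x v : Space d) :
    fderiv ℝ (heatFlow f s) x v
      = ∫ z, heatKernel s (x - z) * (inner ℝ (z - x) v / (2 * s) * f z) := by
  have hm := continuous_gaussExponent (d := d) |>.aestronglyMeasurable (μ := volume)
  have h0 : heatExponent s (x + (0 : ℝ) • v) = heatExponent s x := by simp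
  have h1 := hasFDerivAt_laplace (h.laplaceDominated (heatExponent_mem hs hsa x)) hm
    h.aestronglyMeasurable
  rw [← h0] at h1
  have h2 : HasDerivAt (fun r : ℝ => heatExponent s (x + r • v))
      (-inner ℝ x v / (2 * s), 0, (1 / (2 * s)) • v) 0 := by
    have e0 : HasDerivAt (fun r : ℝ => x + r • v) v 0 := by
      simpa using ((hasDerivAt_id (0 : ℝ)).smul_const v).const_add x
    have i1 : HasDerivAt (fun r : ℝ => -‖x + r • v‖ ^ 2 / (4 * s)
        - d / 2 * Real.log (4 * Real.pi * s)) (-inner ℝ x v / (2 * s)) 0 := by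
      refine HasDerivAt.sub_const _ ?_
      refine (e0.norm_sq.fun_neg.div_const (4 * s)).congr_deriv ?_
      simp only [zero_smul, add_zero]
      field_simp
      ring
    exact i1.prodMk ((hasDerivAt_const _ _).prodMk (e0.const_smul (1 / (2 * s))))
  have h3 := h1.comp_hasDerivAt 0 h2
  rw [h0, h.laplace_deriv_apply hs hsa] at h3
  have h4 : (fun η => ∫ z, Real.exp (gaussExponent z η) • f z) ∘
      (fun r : ℝ => heatExponent s (x + r • v)) = fun r : ℝ => heatFlow f s (x + r • v) := by
    funext r
    exact (heatFlow_eq_laplace f hs _).symm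
  rw [h4] at h3
  have h5 : HasDerivAt (fun r : ℝ => heatFlow f s (x + r • v)) (fderiv ℝ (heatFlow f s) x v) 0 :=
    (h.differentiableAt_heatFlow hs hsa x).hasFDerivAt.hasLineDerivAt v
  rw [h5.unique h3]
  refine integral_congr_ae (Eventually.of_forall fun z => ?_)
  simp only [gaussExponent_apply, real_inner_smul_right, inner_sub_left]
  field_simp
  ring

theorem HeatGrowth.fderiv_heatFlow_single (h : HeatGrowth a₀ f) (hs : 0 < s)
    (hsa : 4 * a₀ * s < 1) (x : Space d) (i : Fin d) :
    fderiv ℝ (heatFlow f s) x (EuclideanSpace.single i 1)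
      = (1 / (2 * s)) * (heatFlow (fun z => z i * f z) s x - x i * heatFlow f s x) := by
  rw [h.fderiv_heatFlow hs hsa, heatFlow_eq _ hs, heatFlow_eq _ hs, ← integral_const_mul,
    ← integral_sub ((h.mul_coord i).integrable_kernel hs hsa x)
      ((h.integrable_kernel hs hsa x).const_mul _), ← integral_const_mul]
  refine integral_congr_ae (Eventually.of_forall fun z => ?_)
  simp only [EuclideanSpace.inner_single_right, PiLp.sub_apply]
  simp
  ring

/-- The heat flow solves the heat equation `∂ₛ H = Δ H`. -/
theorem HeatGrowth.deriv_heatFlow_eq_laplacian (h : HeatGrowth a₀ f) (hs : 0 < s)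
    (hsa : 4 * a₀ * s < 1) (x : Space d) :
    deriv (fun r => heatFlow f r x) s = Laplacian.laplacian (heatFlow f s) x := by
  have h2 : ContDiffAt ℝ 2 (heatFlow f s) x :=
    contDiffAt_space ((h.contDiffOn_heatFlow 2).contDiffAt
      ((isOpen_heatDomain a₀).mem_nhds (x := (s, x))
      ⟨⟨hs, hsa⟩, mem_univ _⟩))
  have hd : DifferentiableAt ℝ (fderiv ℝ (heatFlow f s)) x :=
    (h2.fderiv_right (m := 1) le_rfl).differentiableAt one_ne_zero
  have hi : ∀ i : Fin d, fderiv ℝ (fderiv ℝ (heatFlow f s)) x (EuclideanSpace.single i 1)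
      (EuclideanSpace.single i 1) = ∫ z, heatKernel s (x - z) *
        (((z i - x i) ^ 2 / (4 * s ^ 2) - 1 / (2 * s)) * f z) := by
    intro i
    have e1 : fderiv ℝ (fderiv ℝ (heatFlow f s)) x (EuclideanSpace.single i 1)
        (EuclideanSpace.single i 1) =
        fderiv ℝ (fun y => fderiv ℝ (heatFlow f s) y (EuclideanSpace.single i 1)) x
          (EuclideanSpace.single i 1) := by
      rw [fderiv_clm_apply hd (differentiableAt_const _)]
      simp
    have hdi := (h.mul_coord i).differentiableAt_heatFlow hs hsa x
    have hdf := h.differentiableAt_heatFlow hs hsa x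
    have hx : DifferentiableAt ℝ (fun y : Space d => y i) x := by fun_prop
    have hxd : fderiv ℝ (fun y : Space d => y i) x (EuclideanSpace.single i 1) = 1 := by
      have : HasFDerivAt (fun y : Space d => y i) (EuclideanSpace.proj (𝕜 := ℝ) i) x :=
        (EuclideanSpace.proj (𝕜 := ℝ) i : Space d →L[ℝ] ℝ).hasFDerivAt
      rw [this.fderiv]
      simp
    simp only [e1, h.fderiv_heatFlow_single hs hsa]
    rw [fderiv_const_mul (hdi.fun_sub (hx.fun_mul hdf)), fderiv_fun_sub hdi (hx.fun_mul hdf),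
      fderiv_fun_mul hx hdf]
    simp only [FunLike.coe_smul, Pi.smul_apply, FunLike.coe_sub, Pi.sub_apply,
      FunLike.coe_add, Pi.add_apply, smul_eq_mul, hxd,
      (h.mul_coord i).fderiv_heatFlow_single hs hsa, h.fderiv_heatFlow_single hs hsa]
    have k1 := ((h.mul_coord i).mul_coord i).integrable_kernel hs hsa x
    have k2 := (h.mul_coord i).integrable_kernel hs hsa x
    have k3 := h.integrable_kernel hs hsa x
    have : ∫ z, heatKernel s (x - z) * (((z i - x i) ^ 2 / (4 * s ^ 2) - 1 / (2 * s)) * f z)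
        = ∫ z, ((1 / (4 * s ^ 2)) * (heatKernel s (x - z) * (z i * (z i * f z)))
          - (x i / (2 * s ^ 2)) * (heatKernel s (x - z) * (z i * f z))
          + (x i ^ 2 / (4 * s ^ 2) - 1 / (2 * s)) * (heatKernel s (x - z) * f z)) := by
      refine integral_congr_ae (Eventually.of_forall fun z => ?_)
      simp only
      field_simp
      ring
    have k12 : Integrable (fun z => (1 / (4 * s ^ 2)) * (heatKernel s (x - z) * (z i * (z i * f z)))
        - (x i / (2 * s ^ 2)) * (heatKernel s (x - z) * (z i * f z))) :=
      (k1.const_mul _).sub (k2.const_mul _)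
    rw [this, integral_add k12 (k3.const_mul _),
      integral_sub (k1.const_mul _) (k2.const_mul _), integral_const_mul, integral_const_mul,
      integral_const_mul, ← heatFlow_eq _ hs, ← heatFlow_eq _ hs, ← heatFlow_eq _ hs]
    field_simp
    ring
  rw [(h.hasDerivAt_heatFlow hs hsa x).deriv, laplacian_eq_sum_fderiv]
  simp only [hi]
  rw [← integral_finsetSum]
  · refine integral_congr_ae (Eventually.of_forall fun z => ?_)
    simp only
    rw [← Finset.mul_sum, ← Finset.sum_mul, Finset.sum_sub_distrib, ← Finset.sum_div,
      EuclideanSpace.norm_sq_eq]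
    simp only [PiLp.sub_apply, Real.norm_eq_abs, sq_abs, Finset.sum_const, Finset.card_univ,
      Fintype.card_fin, nsmul_eq_mul]
    have : ∀ i, (x i - z i) ^ 2 = (z i - x i) ^ 2 := fun i => by ring
    simp only [this]
    ring_nf
  · intro i _
    have k1 := ((h.mul_coord i).mul_coord i).integrable_kernel hs hsa x
    have k2 := (h.mul_coord i).integrable_kernel hs hsa x
    have k3 := h.integrable_kernel hs hsa x
    refine (((k1.const_mul (1 / (4 * s ^ 2))).sub (k2.const_mul (x i / (2 * s ^ 2)))).add
      (k3.const_mul (x i ^ 2 / (4 * s ^ 2) - 1 / (2 * s)))).congr (Eventually.of_forall fun z => ?_)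
    simp only [Pi.add_apply, Pi.sub_apply]
    field_simp
    ring

end Derivatives

/-- The gradient of the heat flow of a bounded function is of order `s^{-1/2}`. -/
theorem norm_gradient_heatFlow_le {f : Space d → ℝ} (hf : Continuous f) {M : ℝ}
    (hM : ∀ x, |f x| ≤ M) {s : ℝ} (hs : 0 < s) (x : Space d) :
    ‖gradient (heatFlow f s) x‖ ≤ 2 ^ (d / 2 : ℝ) * M / √s := by
  have hM0 : 0 ≤ M := (abs_nonneg _).trans (hM 0)
  have hg := HeatGrowth.of_bounded hf hM
  have h1 : ‖gradient (heatFlow f s) x‖ = ‖fderiv ℝ (heatFlow f s) x‖ := by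
    rw [← toDual_gradient, LinearIsometryEquiv.norm_map]
  rw [h1]
  refine ContinuousLinearMap.opNorm_le_bound _ (by positivity) fun v => ?_
  rw [hg.fderiv_heatFlow hs (by simp)]
  have h2 := norm_integral_le_of_norm_le (μ := volume)
    (f := fun z => heatKernel s (x - z) * (inner ℝ (z - x) v / (2 * s) * f z))
    (g := fun z => (2 ^ (d / 2 : ℝ) * M / √s * ‖v‖) * heatKernel (2 * s) (x - z))
    ((integrable_heatKernel_sub' (by positivity) x).const_mul _) ?_
  · rwa [integral_const_mul, integral_heatKernel_sub' (by positivity), mul_one] at h2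
  · refine Eventually.of_forall fun z => ?_
    rw [norm_mul, norm_mul, Real.norm_of_nonneg (heatKernel_nonneg hs.le _)]
    have e1 : ‖inner ℝ (z - x) v / (2 * s)‖ ≤ ‖x - z‖ * ‖v‖ / (2 * s) := by
      rw [norm_div, Real.norm_of_nonneg (show 0 ≤ 2 * s by positivity), norm_sub_rev x z]
      gcongr
      exact norm_inner_le_norm _ _
    -- the factor `‖x - z‖ / 2s` is absorbed by half of the Gaussian decay, at the cost `s^{-1/2}`
    have e2 : ‖x - z‖ / (2 * s) ≤ 1 / √s * Real.exp (‖x - z‖ ^ 2 / (8 * s)) := by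
      have hr : 0 < √s := Real.sqrt_pos.2 hs
      have hsq : √s ^ 2 = s := Real.sq_sqrt hs.le
      set r := ‖x - z‖ / √s with hrdef
      have e3 : r / 2 ≤ Real.exp (r ^ 2 / 8) := by
        have := Real.add_one_le_exp (r ^ 2 / 8)
        nlinarith [sq_nonneg (r - 2)]
      have e4 : ‖x - z‖ / (2 * s) = 1 / √s * (r / 2) := by
        rw [hrdef]
        nth_rewrite 1 [← hsq]
        field_simp
      have e5 : ‖x - z‖ ^ 2 / (8 * s) = r ^ 2 / 8 := by
        rw [hrdef, div_pow, hsq]; field_simp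
      rw [e4, e5]
      gcongr
    have e6 := exp_mul_heatKernel hs (x - z)
    have hfz : ‖f z‖ ≤ M := hM z
    have hk := heatKernel_nonneg hs.le (x - z)
    calc heatKernel s (x - z) * (‖inner ℝ (z - x) v / (2 * s)‖ * ‖f z‖)
        ≤ heatKernel s (x - z) * ((1 / √s * Real.exp (‖x - z‖ ^ 2 / (8 * s)) * ‖v‖) * M) := by
          gcongr
          refine e1.trans ?_
          calc ‖x - z‖ * ‖v‖ / (2 * s) = ‖x - z‖ / (2 * s) * ‖v‖ := by ring
            _ ≤ _ := by gcongr
      _ = 1 / √s * ‖v‖ * M * (Real.exp (‖x - z‖ ^ 2 / (8 * s)) * heatKernel s (x - z)) := by ring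
      _ = _ := by rw [e6]; ring

/-! ### Weak flows of measures -/

theorem norm_gradient_eq (f : Space d → ℝ) (x : Space d) : ‖gradient f x‖ = ‖fderiv ℝ f x‖ := by
  rw [← toDual_gradient, LinearIsometryEquiv.norm_map]

theorem gradient_comp_smul (c : Space d → ℝ) (a : ℝ) (x : Space d) :
    gradient (fun y => c (a • y)) x = a • gradient c (a • x) := by
  ext i
  rw [gradient_apply, fderiv_comp_smul (f := c) a, PiLp.smul_apply, gradient_apply]
  rfl

theorem laplacian_comp_smul {c : Space d → ℝ} (hc : ContDiff ℝ 2 c) (a : ℝ) (x : Space d) :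
    Laplacian.laplacian (fun y => c (a • y)) x = a ^ 2 * Laplacian.laplacian c (a • x) := by
  have hd : Differentiable ℝ (fderiv ℝ c) :=
    (hc.fderiv_right (m := 1) le_rfl).differentiable one_ne_zero
  have hf1 : fderiv ℝ (fun y : Space d => c (a • y)) = fun y => a • fderiv ℝ c (a • y) := by
    funext y
    exact fderiv_comp_smul (f := c) a (x := y)
  have hf2 : fderiv ℝ (fun y : Space d => a • fderiv ℝ c (a • y)) x
      = a • a • fderiv ℝ (fderiv ℝ c) (a • x) := by
    have h3 : DifferentiableAt ℝ (fun y : Space d => fderiv ℝ c (a • y)) x :=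
      (hd.comp (differentiable_id.const_smul a)) x
    rw [fderiv_fun_const_smul h3, fderiv_comp_smul (f := fderiv ℝ c) a (x := x)]
  rw [laplacian_eq_sum_fderiv, hf1, hf2, laplacian_eq_sum_fderiv, Finset.mul_sum]
  refine Finset.sum_congr rfl fun i _ => ?_
  simp only [FunLike.coe_smul, Pi.smul_apply, smul_eq_mul]
  ring

theorem continuous_laplacian {c : Space d → ℝ} (hc : ContDiff ℝ 2 c) :
    Continuous (Laplacian.laplacian c) := by
  have h1 : ContDiff ℝ 1 (fderiv ℝ c) := hc.fderiv_right le_rfl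
  have h2 : Continuous (fderiv ℝ (fderiv ℝ c)) := h1.continuous_fderiv one_ne_zero
  have h3 : Laplacian.laplacian c = fun x => ∑ i, fderiv ℝ (fderiv ℝ c) x
      (EuclideanSpace.single i 1) (EuclideanSpace.single i 1) := funext (laplacian_eq_sum_fderiv c)
  rw [h3]
  exact continuous_finsetSum _ fun i _ =>
    (h2.clm_apply continuous_const).clm_apply continuous_const

theorem laplacian_eq_zero_of_notMem_tsupport {c : Space d → ℝ} {x : Space d}
    (hx : x ∉ tsupport c) : Laplacian.laplacian c x = 0 := by
  have h0 : c =ᶠ[𝓝 x] fun _ => 0 := notMem_tsupport_iff_eventuallyEq.1 hx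
  rw [(InnerProductSpace.laplacian_congr_nhds h0).self_of_nhds]
  simp

/-- Smooth cutoffs `χ (x / (n + 1))`, with derivatives tending uniformly to `0`. -/
theorem exists_cutoff (d : ℕ) : ∃ (χ : ℕ → Space d → ℝ) (K : ℝ), 0 ≤ K ∧
    ∀ n, ContDiff ℝ 2 (χ n) ∧ HasCompactSupport (χ n) ∧ (∀ x, |χ n x| ≤ 1) ∧
      (∀ x, ‖gradient (χ n) x‖ ≤ K / (n + 1)) ∧ (∀ x, |Laplacian.laplacian (χ n) x| ≤ K / (n + 1)) ∧
      ∀ x, ‖x‖ ≤ n + 1 → χ n x = 1 := by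
  obtain ⟨c, hc2, hcs, hc1, hc0⟩ : ∃ c : Space d → ℝ, ContDiff ℝ 2 c ∧ HasCompactSupport c ∧
      (∀ x, |c x| ≤ 1) ∧ ∀ x, ‖x‖ ≤ 1 → c x = 1 := by
    let c : ContDiffBump (0 : Space d) := ⟨1, 2, one_pos, one_lt_two⟩
    refine ⟨c, c.contDiff, c.hasCompactSupport, fun x => ?_, fun x hx => ?_⟩
    · rw [abs_of_nonneg c.nonneg]
      exact c.le_one
    · exact c.one_of_mem_closedBall (mem_closedBall_zero_iff.2 hx)
  obtain ⟨K1, hK1⟩ := (hcs.fderiv (𝕜 := ℝ)).exists_bound_of_continuous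
    (hc2.continuous_fderiv two_ne_zero)
  obtain ⟨K2, hK2⟩ := (HasCompactSupport.intro' hcs.isCompact (isClosed_tsupport c)
    fun x hx => laplacian_eq_zero_of_notMem_tsupport hx).exists_bound_of_continuous
    (continuous_laplacian hc2)
  have hK1' : 0 ≤ K1 := (norm_nonneg _).trans (hK1 0)
  have hK2' : 0 ≤ K2 := (norm_nonneg _).trans (hK2 0)
  refine ⟨fun n x => c (((n : ℝ) + 1)⁻¹ • x), K1 + K2, by positivity, fun n => ?_⟩
  have hapos : 0 < ((n : ℝ) + 1)⁻¹ := by positivity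
  have ha1 : ((n : ℝ) + 1)⁻¹ ≤ 1 := inv_le_one_of_one_le₀ (by simp)
  refine ⟨hc2.comp (contDiff_const_smul _), hcs.comp_smul hapos.ne', fun x => hc1 _, ?_, ?_, ?_⟩
  · intro x
    rw [gradient_comp_smul, norm_smul, Real.norm_of_nonneg hapos.le, norm_gradient_eq,
      div_eq_inv_mul]
    gcongr
    linarith [hK1 (((n : ℝ) + 1)⁻¹ • x)]
  · intro x
    rw [laplacian_comp_smul hc2, abs_mul, abs_of_nonneg (by positivity), div_eq_inv_mul]
    have h1 : |Laplacian.laplacian c (((n : ℝ) + 1)⁻¹ • x)| ≤ K1 + K2 := by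
      have := hK2 (((n : ℝ) + 1)⁻¹ • x)
      rw [Real.norm_eq_abs] at this
      linarith
    have h2 : (((n : ℝ) + 1)⁻¹) ^ 2 ≤ ((n : ℝ) + 1)⁻¹ := by nlinarith
    gcongr
  · intro x hx
    refine hc0 _ ?_
    rw [norm_smul, Real.norm_of_nonneg hapos.le, inv_mul_le_iff₀ (by positivity), mul_one]
    exact hx

/-- A measure `m` on space-time, carried by the times in `(0, T)`, which solves the Fokker–Planck
equation with drift `b` weakly, with traces `ν₀` and `ν₁` at the times `0` and `T`. -/
structure IsWeakFlow (T β : ℝ) (m : Measure (ℝ × Space d)) (b : ℝ → Space d → Space d)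
    (ν₀ ν₁ : Measure (Space d)) : Prop where
  time_mem : ∀ᵐ z ∂m, z.1 ∈ Ioo 0 T
  drift : Integrable (fun z : ℝ × Space d => b z.1 z.2) m
  equation : ∀ φ : ℝ → Space d → ℝ, ContDiff ℝ 2 (fun z : ℝ × Space d => φ z.1 z.2) →
    HasCompactSupport (fun z : ℝ × Space d => φ z.1 z.2) →
    (∫ x, φ T x ∂ν₁) - ∫ x, φ 0 x ∂ν₀ = ∫ z, backwardOp β b φ z.1 z.2 ∂m

section Slices

variable {φ : ℝ → Space d → ℝ}

theorem fderiv_space {t : ℝ} {x : Space d}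
    (hφ : DifferentiableAt ℝ (fun z : ℝ × Space d => φ z.1 z.2) (t, x)) :
    fderiv ℝ (φ t) x = (fderiv ℝ (fun z : ℝ × Space d => φ z.1 z.2) (t, x)).comp
      (ContinuousLinearMap.inr ℝ ℝ (Space d)) := by
  have h2 : HasFDerivAt (fun y : Space d => (t, y)) (ContinuousLinearMap.inr ℝ ℝ (Space d)) x :=
    hasFDerivAt_prodMk_right t x
  exact (HasFDerivAt.comp x hφ.hasFDerivAt h2).fderiv

theorem deriv_time {t : ℝ} {x : Space d}
    (hφ : DifferentiableAt ℝ (fun z : ℝ × Space d => φ z.1 z.2) (t, x)) :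
    deriv (fun s => φ s x) t = fderiv ℝ (fun z : ℝ × Space d => φ z.1 z.2) (t, x) (1, 0) := by
  have h2 : HasDerivAt (fun s : ℝ => (s, x)) ((1 : ℝ), (0 : Space d)) t :=
    (hasDerivAt_id t).prodMk (hasDerivAt_const t x)
  exact (HasFDerivAt.comp_hasDerivAt (f := fun s : ℝ => (s, x)) t hφ.hasFDerivAt h2).deriv

/-- On an open set where `φ` is `C^{n+1}` jointly, its spatial gradient is jointly `C^n`. -/
theorem contDiffOn_gradient {U : Set (ℝ × Space d)} (hU : IsOpen U) {n : ℕ}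
    (hφ : ContDiffOn ℝ (n + 1) (fun z : ℝ × Space d => φ z.1 z.2) U) :
    ContDiffOn ℝ n (fun z : ℝ × Space d => gradient (φ z.1) z.2) U := by
  have h1 := hφ.fderiv_of_isOpen hU (m := n) le_rfl
  have h2 : ContDiffOn ℝ n (fun z : ℝ × Space d => (InnerProductSpace.toDual ℝ (Space d)).symm
      ((fderiv ℝ (fun z : ℝ × Space d => φ z.1 z.2) z).comp
        (ContinuousLinearMap.inr ℝ ℝ (Space d)))) U :=
    ((InnerProductSpace.toDual ℝ (Space d)).symm.contDiff).comp_contDiffOn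
      (h1.clm_comp contDiffOn_const)
  refine h2.congr fun z hz => ?_
  simp only [gradient]
  congr 1
  have hd : DifferentiableAt ℝ (fun z : ℝ × Space d => φ z.1 z.2) (z.1, z.2) :=
    ((hφ.contDiffAt (hU.mem_nhds hz)).differentiableAt (by simp))
  exact fderiv_space hd

theorem continuousOn_heatOp {U : Set (ℝ × Space d)} (hU : IsOpen U) (β : ℝ)
    (hφ : ContDiffOn ℝ 2 (fun z : ℝ × Space d => φ z.1 z.2) U) :
    ContinuousOn (fun z : ℝ × Space d => heatOp β φ z.1 z.2) U := by
  have h1 : ContDiffOn ℝ 1 (fderiv ℝ (fun z : ℝ × Space d => φ z.1 z.2)) U :=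
    hφ.fderiv_of_isOpen hU (m := 1) le_rfl
  have h2 : ContinuousOn (fderiv ℝ (fderiv ℝ (fun z : ℝ × Space d => φ z.1 z.2))) U :=
    (h1.fderiv_of_isOpen hU (m := 0) le_rfl).continuousOn
  have hdiff : ∀ z ∈ U, ∀ᶠ y in 𝓝 z, DifferentiableAt ℝ (fun z : ℝ × Space d => φ z.1 z.2) y :=
    fun z hz => by
      filter_upwards [hU.mem_nhds hz] with y hy
      exact (hφ.contDiffAt (hU.mem_nhds hy)).differentiableAt two_ne_zero
  have h3 : ContinuousOn (fun z : ℝ × Space d =>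
      fderiv ℝ (fun z : ℝ × Space d => φ z.1 z.2) z (1, 0) + β * ∑ i,
        fderiv ℝ (fderiv ℝ (fun z : ℝ × Space d => φ z.1 z.2)) z (0, EuclideanSpace.single i 1)
          (0, EuclideanSpace.single i 1)) U := by
    refine ContinuousOn.add (h1.continuousOn.clm_apply continuousOn_const)
      (continuousOn_const.mul (continuousOn_finsetSum _ fun i _ => ?_))
    exact (h2.clm_apply continuousOn_const).clm_apply continuousOn_const
  refine h3.congr fun z hz => ?_
  have hdz := (hdiff z hz).self_of_nhds
  simp only [heatOp]
  rw [deriv_time (t := z.1) (x := z.2) hdz, laplacian_eq_sum_fderiv]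
  congr 2
  refine Finset.sum_congr rfl fun i _ => ?_
  have hev : fderiv ℝ (φ z.1) =ᶠ[𝓝 z.2] fun y =>
      (fderiv ℝ (fun z : ℝ × Space d => φ z.1 z.2) (z.1, y)).comp
        (ContinuousLinearMap.inr ℝ ℝ (Space d)) := by
    have hc : Tendsto (fun y : Space d => (z.1, y)) (𝓝 z.2) (𝓝 z) :=
      (by fun_prop : Continuous fun y : Space d => (z.1, y)).tendsto z.2
    filter_upwards [hc.eventually (hdiff z hz)] with y hy
    exact fderiv_space hy
  have hd2 : HasFDerivAt (fderiv ℝ (fun z : ℝ × Space d => φ z.1 z.2))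
      (fderiv ℝ (fderiv ℝ (fun z : ℝ × Space d => φ z.1 z.2)) z) (z.1, z.2) :=
    ((h1.contDiffAt (hU.mem_nhds hz)).differentiableAt one_ne_zero).hasFDerivAt
  have h5 := (HasFDerivAt.comp z.2 hd2 (hasFDerivAt_prodMk_right (𝕜 := ℝ) z.1 z.2)).clm_comp
    (hasFDerivAt_const (ContinuousLinearMap.inr ℝ ℝ (Space d)) z.2)
  rw [hev.fderiv_eq]
  have h6 := h5.fderiv
  simp only [Function.comp_def] at h6
  rw [h6]
  simp

theorem aestronglyMeasurable_backwardOp {m : Measure (ℝ × Space d)} {β : ℝ}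
    {b : ℝ → Space d → Space d}
    (hb : AEStronglyMeasurable (fun z : ℝ × Space d => b z.1 z.2) m)
    (hφ : ContDiff ℝ 2 (fun z : ℝ × Space d => φ z.1 z.2)) :
    AEStronglyMeasurable (fun z : ℝ × Space d => backwardOp β b φ z.1 z.2) m := by
  simp only [backwardOp_eq]
  have h1 : Continuous (fun z : ℝ × Space d => heatOp β φ z.1 z.2) :=
    continuousOn_univ.1 (continuousOn_heatOp isOpen_univ β hφ.contDiffOn)
  have h2 : Continuous (fun z : ℝ × Space d => gradient (φ z.1) z.2) :=
    continuousOn_univ.1 (contDiffOn_gradient (n := 1) isOpen_univ hφ.contDiffOn).continuousOn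
  exact h1.aestronglyMeasurable.add (hb.inner h2.aestronglyMeasurable)

end Slices

/-- The weak equation extends to test functions of class `C²` near `[0, T] × ℝ^d` which are bounded
together with their gradient and their image under `∂ₜ + β Δ`. -/
theorem IsWeakFlow.equation_of_bounded {T β : ℝ} {m : Measure (ℝ × Space d)}
    {b : ℝ → Space d → Space d} {ν₀ ν₁ : Measure (Space d)} [IsFiniteMeasure m]
    [IsFiniteMeasure ν₀] [IsFiniteMeasure ν₁] (h : IsWeakFlow T β m b ν₀ ν₁) (hT : 0 < T)
    {f : ℝ → Space d → ℝ} {δ C : ℝ} (hδ : 0 < δ)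
    (hf : ∀ t ∈ Ioo (-δ) (T + δ), ∀ x, ContDiffAt ℝ 2 (fun z : ℝ × Space d => f z.1 z.2) (t, x))
    (hC : ∀ t ∈ Icc 0 T, ∀ x, |f t x| ≤ C)
    (hgrad : ∀ t ∈ Ioo 0 T, ∀ x, ‖gradient (f t) x‖ ≤ C)
    (hheat : ∀ t ∈ Ioo 0 T, ∀ x, |heatOp β f t x| ≤ C) :
    (∫ x, f T x ∂ν₁) - ∫ x, f 0 x ∂ν₀ = ∫ z, backwardOp β b f z.1 z.2 ∂m := by
  obtain ⟨χ, K, hK, hχ⟩ := exists_cutoff d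
  -- cutoffs: `χ` in space, equal to `1` on growing balls; `η` in time, equal to `1` near `[0, T]`
  let η : ContDiffBump (T / 2) := ⟨T / 2 + δ / 3, T / 2 + 2 * δ / 3, by positivity, by linarith⟩
  have hη2 : ContDiff ℝ 2 η := η.contDiff
  have hη1 : ∀ t ∈ Icc 0 T, η =ᶠ[𝓝 t] fun _ => 1 := by
    intro t ht
    have : t ∈ Metric.ball (T / 2) (T / 2 + δ / 3) := by
      rw [Metric.mem_ball, Real.dist_eq, abs_lt]
      constructor <;> linarith [ht.1, ht.2]
    filter_upwards [Metric.isOpen_ball.mem_nhds this] with s hs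
    exact η.one_of_mem_closedBall (Metric.ball_subset_closedBall hs)
  have hη1' : ∀ t ∈ Icc 0 T, η t = 1 := fun t ht => (hη1 t ht).self_of_nhds
  have hηd : ∀ t ∈ Icc 0 T, deriv η t = 0 := fun t ht => by
    rw [(hη1 t ht).deriv_eq, deriv_const]
  set φ : ℕ → ℝ → Space d → ℝ := fun n t x => η t * (χ n x * f t x) with hφ
  have hχt : ∀ n t x, ContDiffAt ℝ 2 (fun z : ℝ × Space d => χ n z.2) (t, x) := fun n t x =>
    ((hχ n).1.comp contDiff_snd).contDiffAt
  have hφC : ∀ n, ContDiff ℝ 2 (fun z : ℝ × Space d => φ n z.1 z.2) := by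
    intro n
    rw [contDiff_iff_contDiffAt]
    rintro ⟨t, x⟩
    by_cases ht : t ∈ Ioo (-δ) (T + δ)
    · exact ContDiffAt.mul (hη2.comp contDiff_fst).contDiffAt ((hχt n t x).mul (hf t ht x))
    · have ht' : t ∉ tsupport η := by
        rw [η.tsupport_eq, Metric.mem_closedBall, Real.dist_eq, abs_le]
        rintro ⟨h1, h2⟩
        simp only [η] at h1 h2
        exact ht ⟨by linarith, by linarith⟩
      have h0 : η =ᶠ[𝓝 t] 0 := notMem_tsupport_iff_eventuallyEq.1 ht'
      have h1 : (fun z : ℝ × Space d => φ n z.1 z.2) =ᶠ[𝓝 (t, x)] fun _ => 0 := by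
        filter_upwards [(continuous_fst.tendsto (t, x)).eventually h0] with z hz
        simp only [hφ]
        rw [hz]; simp
      exact contDiffAt_const.congr_of_eventuallyEq h1
  have hφc : ∀ n, HasCompactSupport (fun z : ℝ × Space d => φ n z.1 z.2) := by
    intro n
    refine HasCompactSupport.of_support_subset_isCompact
      (η.hasCompactSupport.isCompact.prod (hχ n).2.1.isCompact) fun z hz => ?_
    simp only [hφ, Function.mem_support, mul_ne_zero_iff] at hz
    exact ⟨subset_tsupport _ hz.1, subset_tsupport _ hz.2.1⟩
  have hC0 : 0 ≤ C := (abs_nonneg _).trans (hC 0 ⟨le_rfl, hT.le⟩ 0)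
  have hop : ∀ n, ∀ t ∈ Ioo 0 T, ∀ x, backwardOp β b (φ n) t x
      = χ n x * backwardOp β b f t x + f t x * (β * Laplacian.laplacian (χ n) x
        + inner ℝ (b t x) (gradient (χ n) x))
        + 2 * β * inner ℝ (gradient (χ n) x) (gradient (f t) x) := by
    intro n t ht x
    have ht' : t ∈ Icc 0 T := ⟨ht.1.le, ht.2.le⟩
    have hft := hf t ⟨by linarith [ht.1], by linarith [ht.2]⟩ x
    have e1 : heatOp β (φ n) t x = heatOp β (fun s y => χ n y * f s y) t x := by
      rw [hφ, heatOp_time_mul β hη2.contDiffAt ((hχt n t x).mul hft), hη1' t ht', hηd t ht']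
      ring
    have e2 : heatOp β (fun _ : ℝ => χ n) t x = β * Laplacian.laplacian (χ n) x := by
      simp [heatOp]
    have e3 : gradient (φ n t) x = χ n x • gradient (f t) x + f t x • gradient (χ n) x := by
      have : φ n t = fun y => χ n y * f t y := by
        funext y; simp only [hφ, hη1' t ht', one_mul]
      rw [this, gradient_mul ((hχ n).1.differentiable two_ne_zero x)
        ((contDiffAt_space hft).differentiableAt two_ne_zero)]
    rw [backwardOp_eq, e1, heatOp_mul (f := fun _ => χ n) β (hχt n t x) hft, e2, e3, backwardOp_eq,
      inner_add_right, real_inner_smul_right, real_inner_smul_right]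
    ring
  have hpt : ∀ x : Space d, ∀ᶠ n : ℕ in atTop, ‖x‖ ≤ n + 1 := fun x => by
    filter_upwards [eventually_ge_atTop ⌈‖x‖⌉₊] with n hn
    have := Nat.ceil_le.1 hn
    linarith
  have hlim1 : ∀ (ν : Measure (Space d)) [IsFiniteMeasure ν], ∀ t ∈ Icc 0 T,
      Tendsto (fun n => ∫ x, φ n t x ∂ν) atTop (𝓝 (∫ x, f t x ∂ν)) := by
    intro ν _ t ht
    refine tendsto_integral_of_dominated_convergence (fun _ => C) (fun n => ?_)
      (integrable_const C) (fun n => Eventually.of_forall fun x => ?_)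
      (Eventually.of_forall fun x => ?_)
    · exact ((hφC n).continuous.comp
        (by fun_prop : Continuous fun x : Space d => (t, x))).aestronglyMeasurable
    · simp only [hφ, hη1' t ht, one_mul, norm_mul, Real.norm_eq_abs]
      calc |χ n x| * |f t x| ≤ 1 * C := mul_le_mul ((hχ n).2.2.1 x) (hC t ht x) (abs_nonneg _)
            zero_le_one
        _ = C := one_mul C
    · refine tendsto_const_nhds.congr' ?_
      filter_upwards [hpt x] with n hn
      simp only [hφ, hη1' t ht, (hχ n).2.2.2.2.2 x hn, one_mul]
  -- the derivatives of the spatial cutoffs vanish in the limit; the terms with `b` are dominated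
  -- because the drift is integrable
  have hlim2 : Tendsto (fun n => ∫ z, backwardOp β b (φ n) z.1 z.2 ∂m) atTop
      (𝓝 (∫ z, backwardOp β b f z.1 z.2 ∂m)) := by
    refine tendsto_integral_of_dominated_convergence
      (fun z => (C + C * (|β| * K) + 2 * |β| * K * C) + (C + C * K) * ‖b z.1 z.2‖) (fun n => ?_)
      ((integrable_const _).add (h.drift.norm.const_mul _)) (fun n => ?_) ?_
    · exact aestronglyMeasurable_backwardOp h.drift.aestronglyMeasurable (hφC n)
    · filter_upwards [h.time_mem] with z hz
      have hKn : K / ((n : ℝ) + 1) ≤ K := div_le_self hK (by simp)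
      have b1 := (hχ n).2.2.1 z.2
      have b2 := ((hχ n).2.2.2.1 z.2).trans hKn
      have b3 := ((hχ n).2.2.2.2.1 z.2).trans hKn
      have b4 := hC z.1 ⟨hz.1.le, hz.2.le⟩ z.2
      have b5 := hgrad z.1 hz z.2
      have b6 := hheat z.1 hz z.2
      have c1 : |inner ℝ (b z.1 z.2) (gradient (f z.1) z.2)| ≤ ‖b z.1 z.2‖ * C :=
        (abs_real_inner_le_norm _ _).trans (by gcongr)
      have c2 : |inner ℝ (b z.1 z.2) (gradient (χ n) z.2)| ≤ ‖b z.1 z.2‖ * K :=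
        (abs_real_inner_le_norm _ _).trans (by gcongr)
      have c3 : |inner ℝ (gradient (χ n) z.2) (gradient (f z.1) z.2)| ≤ K * C :=
        (abs_real_inner_le_norm _ _).trans (by gcongr)
      have c4 : |backwardOp β b f z.1 z.2| ≤ C + ‖b z.1 z.2‖ * C := by
        rw [backwardOp_eq]
        exact (abs_add_le _ _).trans (add_le_add b6 c1)
      have c5 : |β * Laplacian.laplacian (χ n) z.2 + inner ℝ (b z.1 z.2) (gradient (χ n) z.2)|
          ≤ |β| * K + ‖b z.1 z.2‖ * K := by
        refine (abs_add_le _ _).trans (add_le_add ?_ c2)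
        rw [abs_mul]
        gcongr
      rw [hop n z.1 hz z.2, Real.norm_eq_abs]
      refine (abs_add_three _ _ _).trans ?_
      rw [abs_mul, abs_mul (f z.1 z.2), abs_mul (2 * β), abs_mul 2 β, abs_two]
      calc _ ≤ 1 * (C + ‖b z.1 z.2‖ * C) + C * (|β| * K + ‖b z.1 z.2‖ * K) + 2 * |β| * (K * C) := by
            gcongr
        _ = _ := by ring
    · filter_upwards [h.time_mem] with z hz
      have hz0 : Tendsto (fun n : ℕ => K / ((n : ℝ) + 1)) atTop (𝓝 0) :=
        tendsto_const_div_atTop_nhds_zero_nat K |>.comp (tendsto_add_atTop_nat 1) |>.congr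
          fun n => by simp
      have l1 : Tendsto (fun n => χ n z.2) atTop (𝓝 1) := by
        refine tendsto_const_nhds.congr' ?_
        filter_upwards [hpt z.2] with n hn
        exact ((hχ n).2.2.2.2.2 z.2 hn).symm
      have l2 : Tendsto (fun n => gradient (χ n) z.2) atTop (𝓝 0) :=
        squeeze_zero_norm (fun n => (hχ n).2.2.2.1 z.2) hz0
      have l3 : Tendsto (fun n => Laplacian.laplacian (χ n) z.2) atTop (𝓝 0) :=
        squeeze_zero_norm (fun n => (hχ n).2.2.2.2.1 z.2) hz0
      simp only [hop _ z.1 hz z.2]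
      have := ((l1.mul_const (backwardOp β b f z.1 z.2)).add (((l3.const_mul β).add
        (tendsto_const_nhds.inner l2 (x := b z.1 z.2))).const_mul (f z.1 z.2))).add
        ((l2.inner (tendsto_const_nhds (x := gradient (f z.1) z.2)) (𝕜 := ℝ)).const_mul (2 * β))
      simpa using this
  refine tendsto_nhds_unique ((hlim1 ν₁ T ⟨hT.le, le_rfl⟩).sub (hlim1 ν₀ 0 ⟨le_rfl, hT.le⟩)) ?_
  refine hlim2.congr fun n => ?_
  exact (h.equation (φ n) (hφC n) (hφc n)).symm

/-! ### Measures with a density -/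

section Density

variable {α : Type*} [MeasurableSpace α] {μ : Measure α} {ρ : α → ℝ}

/-- The measure with density `ρ` with respect to `μ`; the negative part of `ρ` is discarded. -/
noncomputable def densityMeasure (μ : Measure α) (ρ : α → ℝ) : Measure α :=
  μ.withDensity fun x => ENNReal.ofReal (ρ x)

theorem integral_densityMeasure (hρ : AEStronglyMeasurable ρ μ) (h0 : ∀ᵐ x ∂μ, 0 ≤ ρ x)
    (F : α → ℝ) : ∫ x, F x ∂densityMeasure μ ρ = ∫ x, F x * ρ x ∂μ := by
  rw [densityMeasure, integral_withDensity_eq_integral_toReal_smul₀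
    hρ.aemeasurable.ennreal_ofReal (by simp)]
  refine integral_congr_ae ?_
  filter_upwards [h0] with x hx
  rw [ENNReal.toReal_ofReal hx, smul_eq_mul, mul_comm]

theorem integrable_densityMeasure_iff {E : Type*} [NormedAddCommGroup E] [NormedSpace ℝ E]
    (hρ : AEStronglyMeasurable ρ μ) (h0 : ∀ᵐ x ∂μ, 0 ≤ ρ x) {F : α → E} :
    Integrable F (densityMeasure μ ρ) ↔ Integrable (fun x => ρ x • F x) μ := by
  rw [densityMeasure, integrable_withDensity_iff_integrable_smul₀'
    hρ.aemeasurable.ennreal_ofReal (by simp)]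
  refine integrable_congr ?_
  filter_upwards [h0] with x hx
  rw [ENNReal.toReal_ofReal hx]

theorem ae_densityMeasure_iff (hρ : AEStronglyMeasurable ρ μ) {p : α → Prop} :
    (∀ᵐ x ∂densityMeasure μ ρ, p x) ↔ ∀ᵐ x ∂μ, 0 < ρ x → p x := by
  rw [densityMeasure, ae_withDensity_iff' hρ.aemeasurable.ennreal_ofReal]
  simp

theorem lintegral_densityMeasure (hρ : AEStronglyMeasurable ρ μ) (F : α → ENNReal) :
    ∫⁻ x, F x ∂densityMeasure μ ρ = ∫⁻ x, ENNReal.ofReal (ρ x) * F x ∂μ := by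
  rw [densityMeasure, lintegral_withDensity_eq_lintegral_mul_non_measurable₀ _
    hρ.aemeasurable.ennreal_ofReal (by simp)]
  rfl

theorem isFiniteMeasure_densityMeasure (hρ : Integrable ρ μ) :
    IsFiniteMeasure (densityMeasure μ ρ) :=
  isFiniteMeasure_withDensity_ofReal hρ.2

end Density

theorem ae_slab_time_mem (d : ℕ) (T : ℝ) : ∀ᵐ z ∂slab d T, z.1 ∈ Ioo 0 T :=
  Measure.quasiMeasurePreserving_fst.ae (ae_restrict_mem measurableSet_Ioo)

/-! ### Brownian motion -/

/-- The heat flow commutes with spatial derivatives of compactly supported functions. -/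
theorem fderiv_heatFlow_comm {ψ : Space d → ℝ} (hψ : ContDiff ℝ 1 ψ) (hc : HasCompactSupport ψ)
    (s : ℝ) (x v : Space d) :
    DifferentiableAt ℝ (heatFlow ψ s) x ∧
      fderiv ℝ (heatFlow ψ s) x v = heatFlow (fun y => fderiv ℝ ψ y v) s x := by
  have hd : Continuous (fderiv ℝ ψ) := hψ.continuous_fderiv one_ne_zero
  obtain ⟨K, hK⟩ := (hc.fderiv (𝕜 := ℝ)).exists_bound_of_continuous hd
  obtain ⟨M, hM⟩ := hc.exists_bound_of_continuous hψ.continuous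
  have hG := continuous_heatKernel (d := d) 1
  have hcont : ∀ x, Continuous fun ξ : Space d => heatKernel 1 ξ • fderiv ℝ ψ (x + √s • ξ) := by
    intro x
    fun_prop
  have hbound : ∀ x ξ : Space d, ‖heatKernel 1 ξ • fderiv ℝ ψ (x + √s • ξ)‖
      ≤ K * heatKernel 1 ξ := by
    intro x ξ
    rw [norm_smul, Real.norm_of_nonneg (heatKernel_nonneg zero_le_one _), mul_comm]
    exact mul_le_mul_of_nonneg_right (hK _) (heatKernel_nonneg zero_le_one _)
  have hbi : Integrable (fun ξ : Space d => K * heatKernel 1 ξ) :=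
    (integrable_heatKernel one_pos).const_mul K
  have h1 : HasFDerivAt (heatFlow ψ s) (∫ ξ, heatKernel 1 ξ • fderiv ℝ ψ (x + √s • ξ)) x := by
    refine hasFDerivAt_integral_of_dominated_of_fderiv_le (s := univ) univ_mem
      (F' := fun x ξ => heatKernel 1 ξ • fderiv ℝ ψ (x + √s • ξ))
      (Eventually.of_forall fun x =>
        (integrable_heatFlow_integrand hψ.continuous hM s x).aestronglyMeasurable)
      (integrable_heatFlow_integrand hψ.continuous hM s x) (hcont x).aestronglyMeasurable
      (Eventually.of_forall fun ξ y _ => hbound y ξ) hbi (Eventually.of_forall fun ξ y _ => ?_)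
    have h2 : HasFDerivAt ψ (fderiv ℝ ψ (y + √s • ξ)) (y + √s • ξ) :=
      (hψ.differentiable one_ne_zero _).hasFDerivAt
    have h3 : HasFDerivAt (fun y => ψ (y + √s • ξ)) (fderiv ℝ ψ (y + √s • ξ)) y :=
      HasFDerivAt.comp y h2 ((hasFDerivAt_id y).add_const (√s • ξ))
    exact h3.mul_const (heatKernel 1 ξ)
  refine ⟨h1.differentiableAt, ?_⟩
  rw [h1.fderiv, ContinuousLinearMap.integral_apply]
  · simp [heatFlow, mul_comm]
  · exact hbi.mono' (hcont x).aestronglyMeasurable (Eventually.of_forall (hbound x))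

theorem laplacian_heatFlow_comm {ψ : Space d → ℝ} (hψ : ContDiff ℝ 2 ψ) (hc : HasCompactSupport ψ)
    (s : ℝ) (x : Space d) :
    DifferentiableAt ℝ (fderiv ℝ (heatFlow ψ s)) x →
    Laplacian.laplacian (heatFlow ψ s) x = heatFlow (Laplacian.laplacian ψ) s x := by
  intro hd
  have hψ1 : ContDiff ℝ 1 ψ := hψ.of_le one_le_two
  have hdψ : ContDiff ℝ 1 (fderiv ℝ ψ) := hψ.fderiv_right le_rfl
  have hd2 : Continuous (fderiv ℝ (fderiv ℝ ψ)) := hdψ.continuous_fderiv one_ne_zero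
  have hi : ∀ i : Fin d, fderiv ℝ (fderiv ℝ (heatFlow ψ s)) x (EuclideanSpace.single i 1)
      (EuclideanSpace.single i 1) = heatFlow (fun y => fderiv ℝ (fderiv ℝ ψ) y
        (EuclideanSpace.single i 1) (EuclideanSpace.single i 1)) s x := by
    intro i
    have e1 : fderiv ℝ (fderiv ℝ (heatFlow ψ s)) x (EuclideanSpace.single i 1)
        (EuclideanSpace.single i 1) =
        fderiv ℝ (fun y => fderiv ℝ (heatFlow ψ s) y (EuclideanSpace.single i 1)) x
          (EuclideanSpace.single i 1) := by
      rw [fderiv_clm_apply hd (differentiableAt_const _)]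
      simp
    have e2 : (fun y => fderiv ℝ (heatFlow ψ s) y (EuclideanSpace.single i 1))
        = heatFlow (fun y => fderiv ℝ ψ y (EuclideanSpace.single i 1)) s :=
      funext fun y => (fderiv_heatFlow_comm hψ1 hc s y _).2
    have e3 : ContDiff ℝ 1 fun y => fderiv ℝ ψ y (EuclideanSpace.single i 1) :=
      hdψ.clm_apply contDiff_const
    have e4 : HasCompactSupport fun y => fderiv ℝ ψ y (EuclideanSpace.single i 1) :=
      hc.fderiv_apply (𝕜 := ℝ) _
    rw [e1, e2, (fderiv_heatFlow_comm e3 e4 s x _).2]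
    congr 1
    funext y
    rw [fderiv_clm_apply (hdψ.differentiable one_ne_zero y) (differentiableAt_const _)]
    simp
  rw [laplacian_eq_sum_fderiv]
  simp only [hi]
  have hL : Laplacian.laplacian ψ = fun y => ∑ i, fderiv ℝ (fderiv ℝ ψ) y
      (EuclideanSpace.single i 1) (EuclideanSpace.single i 1) := funext (laplacian_eq_sum_fderiv ψ)
  rw [hL]
  simp only [heatFlow, Finset.sum_mul]
  rw [integral_finsetSum]
  intro i _
  have hcs : HasCompactSupport fun y => fderiv ℝ (fderiv ℝ ψ) y
      (EuclideanSpace.single i 1) (EuclideanSpace.single i 1) :=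
    ((hc.fderiv (𝕜 := ℝ)).fderiv_apply (𝕜 := ℝ) (EuclideanSpace.single i 1)).comp_left
      (g := fun L : Space d →L[ℝ] ℝ => L (EuclideanSpace.single i 1)) (by simp)
  have hcc : Continuous fun y => fderiv ℝ (fderiv ℝ ψ) y
      (EuclideanSpace.single i 1) (EuclideanSpace.single i 1) :=
    (hd2.clm_apply continuous_const).clm_apply continuous_const
  obtain ⟨M, hM⟩ := hcs.exists_bound_of_continuous hcc
  exact integrable_heatFlow_integrand hcc hM s x

theorem hasDerivAt_heatKernel {s : ℝ} (hs : 0 < s) (x : Space d) :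
    HasDerivAt (fun r => heatKernel r x)
      (heatKernel s x * (‖x‖ ^ 2 / (4 * s ^ 2) - d / (2 * s))) s := by
  have e4 : HasDerivAt (fun r : ℝ => 4 * r) 4 s := by
    simpa using (hasDerivAt_id s).const_mul 4
  have ep : HasDerivAt (fun r : ℝ => 4 * Real.pi * r) (4 * Real.pi) s := by
    simpa using (hasDerivAt_id s).const_mul (4 * Real.pi)
  have h1 := ep.rpow_const (p := -(d / 2 : ℝ)) (Or.inl (by positivity))
  have h2 := ((hasDerivAt_const s (-‖x‖ ^ 2)).fun_div e4 (by positivity)).exp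
  refine (h1.fun_mul h2).congr_deriv ?_
  unfold heatKernel
  rw [Real.rpow_sub_one (by positivity)]
  field_simp
  ring

/-- The law of Brownian motion with generator `β Δ`, started at `z`, in space-time. -/
noncomputable def brownianMeasure (T β : ℝ) (z : Space d) : Measure (ℝ × Space d) :=
  densityMeasure (slab d T) fun p => heatKernel (β * p.1) (p.2 - z)

theorem measurable_heatKernel_slab (β : ℝ) (z : Space d) :
    Measurable fun p : ℝ × Space d => heatKernel (β * p.1) (p.2 - z) :=
  measurable_heatKernel.comp (by fun_prop : Measurable fun p : ℝ × Space d => (β * p.1, p.2 - z))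

theorem integrable_heatKernel_slab {T β : ℝ} (hβ : 0 < β) (z : Space d) :
    Integrable (fun p : ℝ × Space d => heatKernel (β * p.1) (p.2 - z)) (slab d T) := by
  rw [slab, integrable_prod_iff (measurable_heatKernel_slab β z).aestronglyMeasurable]
  constructor
  · filter_upwards [ae_restrict_mem measurableSet_Ioo] with t ht
    exact integrable_heatKernel_sub (mul_pos hβ ht.1) z
  · refine (integrable_const (1 : ℝ)).congr ?_
    filter_upwards [ae_restrict_mem measurableSet_Ioo] with t ht
    simp only [Real.norm_of_nonneg (heatKernel_nonneg (mul_pos hβ ht.1).le _)]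
    exact (integral_heatKernel_sub (mul_pos hβ ht.1) z).symm

theorem ae_heatKernel_slab_nonneg {T β : ℝ} (hβ : 0 < β) (z : Space d) :
    ∀ᵐ p ∂slab d T, 0 ≤ heatKernel (β * p.1) (p.2 - z) := by
  filter_upwards [ae_slab_time_mem d T] with p hp
  exact heatKernel_nonneg (mul_pos hβ hp.1).le _

theorem isFiniteMeasure_brownianMeasure {T β : ℝ} (hβ : 0 < β) (z : Space d) :
    IsFiniteMeasure (brownianMeasure T β z) :=
  isFiniteMeasure_densityMeasure (integrable_heatKernel_slab hβ z)

section TestFunction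

variable {φ : ℝ → Space d → ℝ}

theorem hasCompactSupport_slice (hc : HasCompactSupport (fun z : ℝ × Space d => φ z.1 z.2))
    (t : ℝ) : HasCompactSupport (φ t) := by
  refine HasCompactSupport.of_support_subset_isCompact (hc.isCompact.image continuous_snd)
    fun x hx => ⟨(t, x), subset_tsupport _ hx, rfl⟩

theorem continuous_heatOp (hφ : ContDiff ℝ 2 (fun z : ℝ × Space d => φ z.1 z.2)) (β : ℝ) :
    Continuous (fun z : ℝ × Space d => heatOp β φ z.1 z.2) :=
  continuousOn_univ.1 (continuousOn_heatOp isOpen_univ β hφ.contDiffOn)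

theorem exists_bound_heatOp (hφ : ContDiff ℝ 2 (fun z : ℝ × Space d => φ z.1 z.2))
    (hc : HasCompactSupport (fun z : ℝ × Space d => φ z.1 z.2)) (β : ℝ) :
    ∃ C, ∀ t x, |heatOp β φ t x| ≤ C := by
  have h0 : HasCompactSupport (fun z : ℝ × Space d => heatOp β φ z.1 z.2) := by
    refine HasCompactSupport.intro' hc.isCompact (isClosed_tsupport _) fun z hz => ?_
    have h1 : (fun z : ℝ × Space d => φ z.1 z.2) =ᶠ[𝓝 z] fun _ => 0 :=
      notMem_tsupport_iff_eventuallyEq.1 hz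
    have h2 : (fun s => φ s z.2) =ᶠ[𝓝 z.1] fun _ => 0 :=
      ((by fun_prop : Continuous fun s : ℝ => (s, z.2)).tendsto z.1).eventually h1
    have h3 : φ z.1 =ᶠ[𝓝 z.2] fun _ => 0 :=
      ((by fun_prop : Continuous fun y : Space d => (z.1, y)).tendsto z.2).eventually h1
    rw [heatOp, h2.deriv_eq, (InnerProductSpace.laplacian_congr_nhds h3).self_of_nhds]
    simp
  obtain ⟨C, hC⟩ := h0.exists_bound_of_continuous (continuous_heatOp hφ β)
  exact ⟨C, fun t x => hC (t, x)⟩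

/-- **Dynkin's formula** in differential form. -/
theorem hasDerivAt_heatFlow_test {β : ℝ} (hβ : 0 < β)
    (hφ : ContDiff ℝ 2 (fun z : ℝ × Space d => φ z.1 z.2))
    (hc : HasCompactSupport (fun z : ℝ × Space d => φ z.1 z.2)) {t : ℝ} (ht : 0 < t)
    (z : Space d) :
    HasDerivAt (fun r => heatFlow (φ r) (β * r) z) (heatFlow (heatOp β φ t) (β * t) z) t := by
  set k' : ℝ → Space d → ℝ := fun r x =>
    heatKernel (β * r) (z - x) * (‖z - x‖ ^ 2 / (4 * (β * r) ^ 2) - d / (2 * (β * r))) * β * φ r x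
      + heatKernel (β * r) (z - x) * deriv (fun s => φ s x) r with hk'
  have hφd : Continuous fun p : ℝ × Space d => deriv (fun s => φ s p.2) p.1 := by
    have h1 : Continuous fun p : ℝ × Space d =>
        fderiv ℝ (fun z : ℝ × Space d => φ z.1 z.2) p (1, 0) :=
      (hφ.continuous_fderiv two_ne_zero).clm_apply continuous_const
    refine h1.congr fun p => ?_
    exact (deriv_time (hφ.differentiable two_ne_zero _)).symm
  have hk'c : ContinuousOn (fun p : ℝ × Space d => k' p.1 p.2) (Ioi 0 ×ˢ univ) := by
    have hG : ContinuousOn (fun p : ℝ × Space d => heatKernel (β * p.1) (z - p.2))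
        (Ioi 0 ×ˢ univ) :=
      (contDiffOn_heatKernel (n := 0)).continuousOn.comp
        (f := fun p : ℝ × Space d => (β * p.1, z - p.2)) (by fun_prop)
        fun p hp => ⟨mul_pos hβ hp.1, mem_univ _⟩
    have hφc : ContinuousOn (fun p : ℝ × Space d => φ p.1 p.2) (Ioi 0 ×ˢ univ) :=
      hφ.continuous.continuousOn
    refine ContinuousOn.add (ContinuousOn.mul (ContinuousOn.mul (hG.mul ?_) continuousOn_const) hφc)
      (hG.mul hφd.continuousOn)
    refine ContinuousOn.sub ?_ ?_
    · refine ContinuousOn.div (by fun_prop) (by fun_prop) fun p hp => ?_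
      have : 0 < p.1 := hp.1
      positivity
    · refine ContinuousOn.div (by fun_prop) (by fun_prop) fun p hp => ?_
      have : 0 < p.1 := hp.1
      positivity
  set K : Set (Space d) := Prod.snd '' tsupport (fun z : ℝ × Space d => φ z.1 z.2) with hK
  have hKc : IsCompact K := hc.isCompact.image continuous_snd
  have hφ0 : ∀ x ∉ K, ∀ r, φ r x = 0 := fun x hx r => by
    by_contra h
    exact hx ⟨(r, x), subset_tsupport _ h, rfl⟩
  have hk0 : ∀ x ∉ K, ∀ r, k' r x = 0 := fun x hx r => by
    simp [hk', hφ0 x hx]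
  -- `K` contains the supports of all `φ r`, so that one bound on `k'` near `t` dominates
  obtain ⟨C, hC⟩ := (isCompact_Icc.prod hKc : IsCompact (Icc (t / 2) (2 * t) ×ˢ K))
    |>.exists_bound_of_continuousOn (hk'c.mono fun p hp =>
      ⟨(half_pos ht).trans_le hp.1.1, mem_univ _⟩)
  have hslice := fun r => hasCompactSupport_slice hc r
  have hφr : ∀ r, ContDiff ℝ 2 (φ r) := fun r => contDiff_iff_contDiffAt.2 fun x =>
    contDiffAt_space (hφ.contDiffAt)
  have hcontF : ∀ r, Continuous fun x => heatKernel (β * r) (z - x) * φ r x := fun r =>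
    ((continuous_heatKernel _).comp (by fun_prop)).mul (hφr r).continuous
  have hnhds : Icc (t / 2) (2 * t) ∈ 𝓝 t := Icc_mem_nhds (by linarith) (by linarith)
  have hder : ∀ r > 0, ∀ x,
      HasDerivAt (fun r => heatKernel (β * r) (z - x) * φ r x) (k' r x) r := by
    intro r hr x
    have h1 : HasDerivAt (fun r : ℝ => β * r) β r := by
      simpa using (hasDerivAt_id r).const_mul β
    have h2 := (hasDerivAt_heatKernel (mul_pos hβ hr) (z - x)).comp r h1
    have h3 := ((contDiffAt_time (f := φ) (t := r) (x := x) hφ.contDiffAt).differentiableAt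
      two_ne_zero).hasDerivAt
    exact h2.mul h3
  have key := hasDerivAt_integral_of_dominated_loc_of_deriv_le (μ := volume) hnhds
    (F := fun r x => heatKernel (β * r) (z - x) * φ r x) (F' := k')
    (bound := K.indicator fun _ => C)
    (Eventually.of_forall fun r => (hcontF r).aestronglyMeasurable)
    ((hcontF t).integrable_of_hasCompactSupport (hslice t).mul_left)
    (by
      have : Continuous (k' t) := by
        rw [← continuousOn_univ]
        exact hk'c.comp (f := fun x : Space d => (t, x)) (by fun_prop) fun x _ => ⟨ht, mem_univ _⟩
      exact this.aestronglyMeasurable)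
    (Eventually.of_forall fun x r hr => by
      by_cases hx : x ∈ K
      · rw [indicator_of_mem hx]
        exact hC (r, x) ⟨hr, hx⟩
      · rw [hk0 x hx, indicator_of_notMem hx, norm_zero])
    ((integrable_indicator_iff hKc.isClosed.measurableSet).2
      (integrableOn_const hKc.measure_lt_top.ne))
    (Eventually.of_forall fun x r hr => hder r ((half_pos ht).trans_le hr.1) x)
  obtain ⟨hint, hkey⟩ := key
  have h4 : (fun r => heatFlow (φ r) (β * r) z) =ᶠ[𝓝 t]
      fun r => ∫ x, heatKernel (β * r) (z - x) * φ r x := by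
    filter_upwards [lt_mem_nhds ht] with r hr
    exact heatFlow_eq _ (mul_pos hβ hr) z
  refine (hkey.congr_of_eventuallyEq h4).congr_deriv ?_
  obtain ⟨M, hM⟩ := (hslice t).exists_bound_of_continuous (hφr t).continuous
  have hg := HeatGrowth.of_bounded (hφr t).continuous hM
  have hbt := mul_pos hβ ht
  have h5 : ∫ x, heatKernel (β * t) (z - x) *
      ((‖z - x‖ ^ 2 / (4 * (β * t) ^ 2) - d / (2 * (β * t))) * φ t x)
      = heatFlow (Laplacian.laplacian (φ t)) (β * t) z := by
    rw [← (hg.hasDerivAt_heatFlow hbt (by simp) z).deriv,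
      hg.deriv_heatFlow_eq_laplacian hbt (by simp),
      laplacian_heatFlow_comm (hφr t) (hslice t)]
    have := (hg.contDiffOn_heatFlow 2).contDiffAt ((isOpen_heatDomain 0).mem_nhds (x := (β * t, z))
      ⟨⟨hbt, by simp⟩, mem_univ _⟩)
    exact ((contDiffAt_space this).fderiv_right (m := 1) le_rfl).differentiableAt one_ne_zero
  have hdc : Continuous fun x => deriv (fun s => φ s x) t :=
    hφd.comp (by fun_prop : Continuous fun x : Space d => (t, x))
  have hds : HasCompactSupport fun x => deriv (fun s => φ s x) t := by
    refine HasCompactSupport.intro' hKc hKc.isClosed fun x hx => ?_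
    have : (fun s => φ s x) = fun _ => 0 := funext (hφ0 x hx)
    simp [this]
  have hLc := continuous_laplacian (hφr t)
  have hLs : HasCompactSupport (Laplacian.laplacian (φ t)) :=
    HasCompactSupport.intro' (hslice t).isCompact (isClosed_tsupport _)
      fun x hx => laplacian_eq_zero_of_notMem_tsupport hx
  have hGc : Continuous fun x => heatKernel (β * t) (z - x) :=
    (continuous_heatKernel (β * t)).comp (by fun_prop)
  have i1 : Integrable fun x => heatKernel (β * t) (z - x) * deriv (fun s => φ s x) t :=
    (hGc.mul hdc).integrable_of_hasCompactSupport hds.mul_left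
  have i2 : Integrable fun x => heatKernel (β * t) (z - x) * Laplacian.laplacian (φ t) x :=
    (hGc.mul hLc).integrable_of_hasCompactSupport hLs.mul_left
  have i3 : Integrable fun x => heatKernel (β * t) (z - x) *
      ((‖z - x‖ ^ 2 / (4 * (β * t) ^ 2) - d / (2 * (β * t))) * φ t x) := by
    have hφt := (hφr t).continuous
    exact Continuous.integrable_of_hasCompactSupport (by fun_prop) ((hslice t).mul_left.mul_left)
  have e1 : ∫ x, k' t x = β * (∫ x, heatKernel (β * t) (z - x) *
      ((‖z - x‖ ^ 2 / (4 * (β * t) ^ 2) - d / (2 * (β * t))) * φ t x))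
      + ∫ x, heatKernel (β * t) (z - x) * deriv (fun s => φ s x) t := by
    rw [← integral_const_mul, ← integral_add (i3.const_mul β) i1]
    refine integral_congr_ae (Eventually.of_forall fun x => ?_)
    simp only [hk']
    ring
  rw [e1, h5, heatFlow_eq _ hbt, heatFlow_eq _ hbt, ← integral_const_mul,
    ← integral_add (i2.const_mul β) i1]
  refine integral_congr_ae (Eventually.of_forall fun x => ?_)
  simp only [heatOp]
  ring

end TestFunction

/-- Brownian motion started at `z` is a weak flow without drift. -/
theorem isWeakFlow_brownianMeasure {T β : ℝ} (hT : 0 < T) (hβ : 0 < β) (z : Space d) :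
    IsWeakFlow T β (brownianMeasure T β z) (fun _ _ => 0) (Measure.dirac z)
      (densityMeasure volume fun x => heatKernel (β * T) (x - z)) := by
  have hmeas := (measurable_heatKernel_slab (d := d) β z).aestronglyMeasurable (μ := slab d T)
  refine ⟨?_, by simp, fun φ hφ hc => ?_⟩
  · rw [brownianMeasure, ae_densityMeasure_iff hmeas]
    filter_upwards [ae_slab_time_mem d T] with p hp _ using hp
  have hbT := mul_pos hβ hT
  have hφr : ∀ r, Continuous (φ r) := fun r =>
    hφ.continuous.comp (by fun_prop : Continuous fun x : Space d => (r, x))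
  obtain ⟨M, hM⟩ := hc.exists_bound_of_continuous hφ.continuous
  obtain ⟨C, hC⟩ := exists_bound_heatOp hφ hc β
  have hHc := continuous_heatOp hφ β
  have hHr : ∀ r, Continuous (heatOp β φ r) := fun r =>
    hHc.comp (by fun_prop : Continuous fun x : Space d => (r, x))
  have hflow : ∀ {f : ℝ → Space d → ℝ} {M : ℝ},
      Continuous (fun z : ℝ × Space d => f z.1 z.2) → (∀ t x, |f t x| ≤ M) →
      Continuous fun r => heatFlow (f r) (β * r) z := by
    intro f M hf hM
    rw [continuous_iff_continuousAt]
    intro t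
    refine tendsto_heatFlow (f := f) (fun r => hf.comp
      (by fun_prop : Continuous fun x : Space d => (r, x))) (fun r => hM r)
      ((by fun_prop : Continuous fun r : ℝ => β * r).tendsto t) tendsto_const_nhds
      fun y y₀ hy => ?_
    exact (hf.tendsto (t, y₀)).comp (tendsto_id.prodMk_nhds hy)
  have hF : ∀ (f : Space d → ℝ) (t : ℝ), 0 < t →
      ∫ x, f x * heatKernel (β * t) (x - z) = heatFlow f (β * t) z := by
    intro f t ht
    rw [heatFlow_eq _ (mul_pos hβ ht)]
    refine integral_congr_ae (Eventually.of_forall fun x => ?_)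
    simp only [heatKernel_sub_comm (β * t) x z, mul_comm]
  -- Dynkin's formula holds for positive times only, but the heat flow is continuous up to time `0`
  have hftc := intervalIntegral.integral_eq_sub_of_hasDerivAt_of_le hT.le
    (hflow hφ.continuous fun t x => hM (t, x)).continuousOn
    (fun t ht => hasDerivAt_heatFlow_test hβ hφ hc ht.1 z)
    ((hflow hHc hC).intervalIntegrable 0 T)
  simp only [mul_zero, heatFlow_zero] at hftc
  have hGT : Continuous fun x : Space d => heatKernel (β * T) (x - z) :=
    (continuous_heatKernel (β * T)).comp (by fun_prop)
  rw [integral_densityMeasure hGT.aestronglyMeasurable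
    (Eventually.of_forall fun x => heatKernel_nonneg hbT.le _), integral_dirac, hF _ T hT, ← hftc,
    brownianMeasure, integral_densityMeasure hmeas (ae_heatKernel_slab_nonneg hβ z)]
  simp only [backwardOp_eq, inner_zero_left, add_zero]
  have hint : Integrable (fun p : ℝ × Space d =>
      heatOp β φ p.1 p.2 * heatKernel (β * p.1) (p.2 - z)) (slab d T) :=
    (integrable_heatKernel_slab hβ z).bdd_mul hHc.aestronglyMeasurable
      (Eventually.of_forall fun p => hC p.1 p.2)
  rw [slab] at hint ⊢
  rw [integral_prod _ hint, intervalIntegral.integral_of_le hT.le, integral_Ioc_eq_integral_Ioo]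
  refine setIntegral_congr_fun measurableSet_Ioo fun t ht => ?_
  exact (hF _ t ht.1).symm

/-! ### The backward heat flow -/

/-- The solution of the backward heat equation `∂ₜu + β Δu = 0` with value `g` at the time `S`. -/
noncomputable def backwardFlow (g : Space d → ℝ) (β S t : ℝ) (x : Space d) : ℝ :=
  heatFlow g (β * (S - t)) x

theorem backwardFlow_self (g : Space d → ℝ) (β S : ℝ) (x : Space d) :
    backwardFlow g β S S x = g x := by
  simp [backwardFlow, heatFlow_zero]

section BackwardFlow

variable {g : Space d → ℝ} {M β : ℝ}

theorem continuous_backwardFlow (hg : Continuous g) (hM : ∀ x, |g x| ≤ M) (β : ℝ) :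
    Continuous fun z : ℝ × ℝ × Space d => backwardFlow g β z.1 z.2.1 z.2.2 :=
  (continuous_heatFlow hg hM).comp
    (by fun_prop : Continuous fun z : ℝ × ℝ × Space d => (β * (z.1 - z.2.1), z.2.2))

theorem continuous_backwardFlow_space (hg : Continuous g) (hM : ∀ x, |g x| ≤ M) (β S t : ℝ) :
    Continuous (backwardFlow g β S t) :=
  continuous_heatFlow_space hg hM _

theorem abs_backwardFlow_le (hM : ∀ x, |g x| ≤ M) (β S t : ℝ) (x : Space d) :
    |backwardFlow g β S t x| ≤ M :=
  abs_heatFlow_le hM _ _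

theorem contDiffAt_backwardFlow (hg : Continuous g) (hM : ∀ x, |g x| ≤ M) (hβ : 0 < β) {S t : ℝ}
    (ht : t < S) (x : Space d) (n : ℕ) :
    ContDiffAt ℝ n (fun z : ℝ × Space d => backwardFlow g β S z.1 z.2) (t, x) := by
  have h1 := ((HeatGrowth.of_bounded hg hM).contDiffOn_heatFlow n).contDiffAt
    ((isOpen_heatDomain 0).mem_nhds (x := (β * (S - t), x))
      ⟨⟨mul_pos hβ (sub_pos.2 ht), by simp⟩, mem_univ _⟩)
  exact ContDiffAt.comp (f := fun z : ℝ × Space d => (β * (S - z.1), z.2)) (t, x) h1 (by fun_prop)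

theorem heatOp_backwardFlow (hg : Continuous g) (hM : ∀ x, |g x| ≤ M) (hβ : 0 < β) {S t : ℝ}
    (ht : t < S) (x : Space d) : heatOp β (backwardFlow g β S) t x = 0 := by
  have hG := HeatGrowth.of_bounded hg hM
  have hs : 0 < β * (S - t) := mul_pos hβ (sub_pos.2 ht)
  have h1 : HasDerivAt (fun r : ℝ => β * (S - r)) (-β) t := by
    simpa using ((hasDerivAt_id t).const_sub S).const_mul β
  have h2 := (hG.hasDerivAt_heatFlow hs (by simp) x)
  have h3 := h2.comp t h1
  have h4 : deriv (fun r => backwardFlow g β S r x) t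
      = deriv (fun r => heatFlow g r x) (β * (S - t)) * (-β) := by
    rw [h2.deriv]
    exact h3.deriv
  have h5 : backwardFlow g β S t = heatFlow g (β * (S - t)) := rfl
  rw [heatOp, h4, h5, hG.deriv_heatFlow_eq_laplacian hs (by simp)]
  ring

theorem norm_gradient_backwardFlow_le (hg : Continuous g) (hM : ∀ x, |g x| ≤ M) (hβ : 0 < β)
    {S t : ℝ} (ht : t < S) (x : Space d) :
    ‖gradient (backwardFlow g β S t) x‖ ≤ 2 ^ (d / 2 : ℝ) * M / √(β * (S - t)) :=
  norm_gradient_heatFlow_le hg hM (mul_pos hβ (sub_pos.2 ht)) x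

theorem continuousAt_gradient_heatFlow (hg : Continuous g) (hM : ∀ x, |g x| ≤ M) {s : ℝ}
    (hs : 0 < s) (x : Space d) :
    ContinuousAt (fun z : ℝ × Space d => gradient (heatFlow g z.1) z.2) (s, x) := by
  have h0 : ContDiffOn ℝ ((1 : ℕ) + 1) (fun z : ℝ × Space d => heatFlow g z.1 z.2)
      ({s | 0 < s ∧ 4 * 0 * s < 1} ×ˢ univ) := by
    have := (HeatGrowth.of_bounded hg hM).contDiffOn_heatFlow 2
    exact this
  exact (contDiffOn_gradient (isOpen_heatDomain 0) h0).continuousOn.continuousAt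
    ((isOpen_heatDomain 0).mem_nhds ⟨⟨hs, by simp⟩, mem_univ _⟩)

theorem tendsto_gradient_backwardFlow (hg : Continuous g) (hM : ∀ x, |g x| ≤ M) (hβ : 0 < β)
    {S t : ℝ} (ht : t < S) (x : Space d) {ι : Type*} {l : Filter ι} {δ : ι → ℝ}
    (hδ : Tendsto δ l (𝓝 0)) :
    Tendsto (fun k => gradient (backwardFlow g β (S + δ k) t) x) l
      (𝓝 (gradient (backwardFlow g β S t) x)) := by
  have h2 := (continuousAt_gradient_heatFlow hg hM (mul_pos hβ (sub_pos.2 ht)) x).tendsto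
  have h3 : Tendsto (fun k => (β * (S + δ k - t), x)) l (𝓝 (β * (S - t), x)) := by
    refine Tendsto.prodMk_nhds ?_ tendsto_const_nhds
    simpa using ((hδ.const_add S).sub_const t).const_mul β
  have h4 := h2.comp h3
  simp only [Function.comp_def] at h4
  exact h4

theorem tendsto_backwardFlow (hg : Continuous g) (hM : ∀ x, |g x| ≤ M) (β S t : ℝ) (x : Space d)
    {ι : Type*} {l : Filter ι} {δ : ι → ℝ} (hδ : Tendsto δ l (𝓝 0)) :
    Tendsto (fun k => backwardFlow g β (S + δ k) t x) l (𝓝 (backwardFlow g β S t x)) := by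
  have h1 := (continuous_backwardFlow hg hM β).tendsto (S, t, x)
  have h2 : Tendsto (fun k => (S + δ k, t, x)) l (𝓝 (S, t, x)) := by
    refine Tendsto.prodMk_nhds ?_ tendsto_const_nhds
    simpa using hδ.const_add S
  exact h1.comp h2

theorem backwardFlow_pos (hg : Continuous g) (hM : ∀ x, |g x| ≤ M) (hpos : ∀ x, 0 < g x)
    (β S t : ℝ) (x : Space d) : 0 < backwardFlow g β S t x :=
  heatFlow_pos hg hM hpos _ _

/-- The flow property of the backward heat flow. -/
theorem backwardFlow_backwardFlow (hg : Continuous g) (hM : ∀ x, |g x| ≤ M) (hβ : 0 < β)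
    {T S t δ : ℝ} (hST : S ≤ T) (ht : t < S + δ) (x : Space d) :
    backwardFlow (backwardFlow g β T S) β (S + δ) t x = backwardFlow g β (T + δ) t x := by
  have h := heatFlow_heatFlow hg hM (mul_pos hβ (sub_pos.2 ht))
    (mul_nonneg hβ.le (sub_nonneg.2 hST))
    x
  have e : β * (S + δ - t) + β * (T - S) = β * (T + δ - t) := by ring
  rw [e] at h
  exact h

end BackwardFlow

/-! ### The verification bound -/

/-- Weak duality for the control problem: the action of the weak flow `(m, b)` exceeds the
increment of `Φ` along the flow, corrected by the source `k = ∂ₜΦ + ½‖∇Φ‖² + β ΔΦ`, by at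
least the distance of `b` from the feedback `∇Φ`. -/
structure VerificationBound (T : ℝ) (m : Measure (ℝ × Space d)) (b : ℝ → Space d → Space d)
    (ν₀ ν₁ : Measure (Space d)) (Φ k : ℝ → Space d → ℝ) : Prop where
  nonneg : 0 ≤ (∫ z, 1 / 2 * ‖b z.1 z.2‖ ^ 2 ∂m)
    - ((∫ x, Φ T x ∂ν₁) - (∫ x, Φ 0 x ∂ν₀) - ∫ z, k z.1 z.2 ∂m)
  gap : ∫⁻ z, ENNReal.ofReal (1 / 2 * ‖b z.1 z.2 - gradient (Φ z.1) z.2‖ ^ 2) ∂m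
    ≤ ENNReal.ofReal ((∫ z, 1 / 2 * ‖b z.1 z.2‖ ^ 2 ∂m)
      - ((∫ x, Φ T x ∂ν₁) - (∫ x, Φ 0 x ∂ν₀) - ∫ z, k z.1 z.2 ∂m))

theorem aestronglyMeasurable_of_continuousOn_time {E : Type*} [NormedAddCommGroup E]
    [SecondCountableTopology E] {T : ℝ}
    {m : Measure (ℝ × Space d)} (hm : ∀ᵐ z ∂m, z.1 ∈ Ioo 0 T) {F : ℝ × Space d → E}
    (hF : ContinuousOn F (Ioo 0 T ×ˢ univ)) : AEStronglyMeasurable F m := by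
  have h1 : m.restrict (Ioo 0 T ×ˢ univ) = m :=
    Measure.restrict_eq_self_of_ae_mem (by filter_upwards [hm] with z hz using ⟨hz, mem_univ _⟩)
  rw [← h1]
  borelize E
  exact hF.aestronglyMeasurable (measurableSet_Ioo.prod MeasurableSet.univ)

/-- The verification bound holds, with equality, for the Hopf–Cole transform `2β log N` of a
function `N` with bounded derivatives which is bounded away from `0`. -/
theorem IsWeakFlow.verificationBound_log {T β : ℝ} {m : Measure (ℝ × Space d)}
    {b : ℝ → Space d → Space d} {ν₀ ν₁ : Measure (Space d)} [IsFiniteMeasure m]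
    [IsFiniteMeasure ν₀] [IsFiniteMeasure ν₁] (h : IsWeakFlow T β m b ν₀ ν₁) (hT : 0 < T)
    (hβ : 0 < β) (hb : Integrable (fun z : ℝ × Space d => ‖b z.1 z.2‖ ^ 2) m)
    {N k : ℝ → Space d → ℝ} {δ ε C : ℝ} (hδ : 0 < δ) (hε : 0 < ε)
    (hN : ∀ t ∈ Ioo (-δ) (T + δ), ∀ x, ContDiffAt ℝ 2 (fun z : ℝ × Space d => N z.1 z.2) (t, x))
    (hpos : ∀ t ∈ Ioo (-δ) (T + δ), ∀ x, 0 < N t x)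
    (hlow : ∀ t ∈ Icc 0 T, ∀ x, ε ≤ N t x) (hC : ∀ t ∈ Icc 0 T, ∀ x, N t x ≤ C)
    (hgrad : ∀ t ∈ Ioo 0 T, ∀ x, ‖gradient (N t) x‖ ≤ C)
    (hheat : ∀ t ∈ Ioo 0 T, ∀ x, heatOp β N t x = k t x)
    (hk : ∀ t ∈ Ioo 0 T, ∀ x, |k t x| ≤ C) :
    VerificationBound T m b ν₀ ν₁ (fun t x => 2 * β * Real.log (N t x))
      (fun t x => 2 * β * k t x / N t x) := by
  set Φ : ℝ → Space d → ℝ := fun t x => 2 * β * Real.log (N t x) with hΦ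
  have hNc : ContDiffOn ℝ 2 (fun z : ℝ × Space d => N z.1 z.2) (Ioo 0 T ×ˢ univ) :=
    fun z hz => (hN z.1 ⟨by linarith [hz.1.1], by linarith [hz.1.2]⟩ z.2).contDiffWithinAt
  have hNpos : ∀ t ∈ Icc 0 T, ∀ x, 0 < N t x := fun t ht x => hε.trans_le (hlow t ht x)
  have hC0 : 0 < C := (hNpos 0 ⟨le_rfl, hT.le⟩ 0).trans_le (hC 0 ⟨le_rfl, hT.le⟩ 0)
  have hIoo : ∀ t ∈ Ioo 0 T, t ∈ Icc 0 T := fun t ht => ⟨ht.1.le, ht.2.le⟩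
  have hIoo' : ∀ t ∈ Ioo 0 T, t ∈ Ioo (-δ) (T + δ) := fun t ht =>
    ⟨by linarith [ht.1], by linarith [ht.2]⟩
  have hU : IsOpen (Ioo 0 T ×ˢ univ : Set (ℝ × Space d)) := isOpen_Ioo.prod isOpen_univ
  have hΦc : ContDiffOn ℝ 2 (fun z : ℝ × Space d => Φ z.1 z.2) (Ioo 0 T ×ˢ univ) := fun z hz =>
    contDiffWithinAt_const.mul ((hNc z hz).log (hNpos z.1 (hIoo _ hz.1) z.2).ne')
  have hgΦ : ∀ t ∈ Ioo 0 T, ∀ x, gradient (Φ t) x = (2 * β / N t x) • gradient (N t) x := by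
    intro t ht x
    have hp := hNpos t (hIoo t ht) x
    have h1 : DifferentiableAt ℝ (fun r => 2 * β * Real.log r) (N t x) :=
      (Real.differentiableAt_log hp.ne').const_mul _
    rw [hΦ, gradient_comp (h := fun r => 2 * β * Real.log r) (f := N t) h1
      ((contDiffAt_space (hN t (hIoo' t ht) x)).differentiableAt two_ne_zero)]
    simp [div_eq_mul_inv]
  have hgb : ∀ t ∈ Ioo 0 T, ∀ x, ‖gradient (Φ t) x‖ ≤ 2 * β / ε * C := by
    intro t ht x
    have hp := hNpos t (hIoo t ht) x
    rw [hgΦ t ht x, norm_smul, Real.norm_of_nonneg (by positivity)]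
    have := hlow t (hIoo t ht) x
    have := hgrad t ht x
    gcongr
  have hhΦ : ∀ t ∈ Ioo 0 T, ∀ x, heatOp β Φ t x
      = 2 * β * k t x / N t x - 1 / 2 * ‖gradient (Φ t) x‖ ^ 2 := by
    intro t ht x
    rw [hΦ, heatOp_log β (hN t (hIoo' t ht) x) (hNpos t (hIoo t ht) x), hheat t ht x]
  have hkb : ∀ t ∈ Ioo 0 T, ∀ x, |2 * β * k t x / N t x| ≤ 2 * β * C / ε := by
    intro t ht x
    have hp := hNpos t (hIoo t ht) x
    have h1 := hlow t (hIoo t ht) x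
    have h2 := hk t ht x
    rw [abs_div, abs_of_pos hp, abs_mul, abs_of_pos (show 0 < 2 * β by positivity)]
    gcongr
  have hΦb : ∀ t ∈ Icc 0 T, ∀ x, |Φ t x| ≤ 2 * β * (|Real.log ε| + |Real.log C|) := by
    intro t ht x
    have h1 := Real.log_le_log hε (hlow t ht x)
    have h2 := Real.log_le_log (hNpos t ht x) (hC t ht x)
    rw [hΦ, abs_mul, abs_of_pos (show 0 < 2 * β by positivity)]
    gcongr
    rw [abs_le]
    constructor
    · linarith [neg_abs_le (Real.log ε), abs_nonneg (Real.log C)]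
    · linarith [le_abs_self (Real.log C), abs_nonneg (Real.log ε)]
  set D : ℝ := 2 * β * (|Real.log ε| + |Real.log C|) + 2 * β / ε * C
    + (2 * β * C / ε + 1 / 2 * (2 * β / ε * C) ^ 2) with hD
  have hD1 : 0 ≤ 2 * β * (|Real.log ε| + |Real.log C|) := by positivity
  have hD2 : 0 ≤ 2 * β / ε * C := by positivity
  have hD3 : 0 ≤ 2 * β * C / ε := by positivity
  have hD4 : 0 ≤ 1 / 2 * (2 * β / ε * C) ^ 2 := by positivity
  -- `N` is bounded below by `ε`, so that `Φ`, `∇Φ` and `(∂ₜ + β Δ) Φ` are bounded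
  have hweak := h.equation_of_bounded hT hδ (f := Φ) (C := D)
    (fun t ht x => contDiffAt_const.mul ((hN t ht x).log (hpos t ht x).ne'))
    (fun t ht x => (hΦb t ht x).trans (by rw [hD]; linarith))
    (fun t ht x => (hgb t ht x).trans (by rw [hD]; linarith))
    (fun t ht x => by
      rw [hhΦ t ht x]
      refine (abs_sub _ _).trans ?_
      have h1 := hkb t ht x
      have h2 : |1 / 2 * ‖gradient (Φ t) x‖ ^ 2| ≤ 1 / 2 * (2 * β / ε * C) ^ 2 := by
        rw [abs_of_nonneg (by positivity)]
        have := hgb t ht x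
        gcongr
      rw [hD]
      linarith)
  have hgm : AEStronglyMeasurable (fun z : ℝ × Space d => gradient (Φ z.1) z.2) m :=
    aestronglyMeasurable_of_continuousOn_time h.time_mem
      (contDiffOn_gradient (n := 1) hU hΦc).continuousOn
  have hkm : AEStronglyMeasurable (fun z : ℝ × Space d => 2 * β * k z.1 z.2 / N z.1 z.2) m := by
    refine aestronglyMeasurable_of_continuousOn_time h.time_mem ?_
    have h1 : ContinuousOn (fun z : ℝ × Space d => 2 * β * heatOp β N z.1 z.2 / N z.1 z.2)
        (Ioo 0 T ×ˢ univ) :=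
      (continuousOn_const.mul (continuousOn_heatOp hU β hNc)).div hNc.continuousOn
        fun z hz => (hNpos z.1 (hIoo _ hz.1) z.2).ne'
    refine h1.congr fun z hz => ?_
    simp only [hheat z.1 hz.1 z.2]
  have hki : Integrable (fun z : ℝ × Space d => 2 * β * k z.1 z.2 / N z.1 z.2) m := by
    refine (integrable_const (2 * β * C / ε)).mono' hkm ?_
    filter_upwards [h.time_mem] with z hz using hkb z.1 hz z.2
  have hbi : Integrable (fun z : ℝ × Space d => 1 / 2 * ‖b z.1 z.2‖ ^ 2) m := hb.const_mul _
  have hdi : Integrable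
      (fun z : ℝ × Space d => 1 / 2 * ‖b z.1 z.2 - gradient (Φ z.1) z.2‖ ^ 2) m := by
    refine (((hb.const_mul 2).add (integrable_const (2 * (2 * β / ε * C) ^ 2))).const_mul
      (1 / 2)).mono' ?_ ?_
    · exact ((h.drift.aestronglyMeasurable.sub hgm).norm.pow 2).const_mul _
    · filter_upwards [h.time_mem] with z hz
      rw [Real.norm_of_nonneg (by positivity)]
      have h1 := hgb z.1 hz z.2
      have h2 := norm_sub_le (b z.1 z.2) (gradient (Φ z.1) z.2)
      have h3 : ‖gradient (Φ z.1) z.2‖ ^ 2 ≤ (2 * β / ε * C) ^ 2 := by gcongr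
      have h4 : ‖b z.1 z.2 - gradient (Φ z.1) z.2‖ ^ 2
          ≤ (‖b z.1 z.2‖ + ‖gradient (Φ z.1) z.2‖) ^ 2 := by gcongr
      simp only [Pi.add_apply]
      nlinarith [sq_nonneg (‖b z.1 z.2‖ - ‖gradient (Φ z.1) z.2‖)]
  -- completing the square in `b` with the Hamilton–Jacobi equation
  have hop : ∀ᵐ z ∂m, backwardOp β b Φ z.1 z.2 = 2 * β * k z.1 z.2 / N z.1 z.2
      + (1 / 2 * ‖b z.1 z.2‖ ^ 2 - 1 / 2 * ‖b z.1 z.2 - gradient (Φ z.1) z.2‖ ^ 2) := by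
    filter_upwards [h.time_mem] with z hz
    rw [backwardOp_eq, hhΦ z.1 hz z.2, norm_sub_sq_real]
    ring
  have hsub : Integrable (fun z : ℝ × Space d => 1 / 2 * ‖b z.1 z.2‖ ^ 2
      - 1 / 2 * ‖b z.1 z.2 - gradient (Φ z.1) z.2‖ ^ 2) m := hbi.sub hdi
  rw [integral_congr_ae hop, integral_add hki hsub, integral_sub hbi hdi] at hweak
  have hgap : (∫ z, 1 / 2 * ‖b z.1 z.2‖ ^ 2 ∂m) - ((∫ x, Φ T x ∂ν₁) - (∫ x, Φ 0 x ∂ν₀)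
      - ∫ z, 2 * β * k z.1 z.2 / N z.1 z.2 ∂m)
      = ∫ z, 1 / 2 * ‖b z.1 z.2 - gradient (Φ z.1) z.2‖ ^ 2 ∂m := by
    linarith
  refine ⟨?_, ?_⟩
  · rw [hgap]
    exact integral_nonneg fun z => by positivity
  · rw [hgap, ofReal_integral_eq_lintegral_ofReal hdi (Eventually.of_forall fun z => by positivity)]

/-- The verification bound passes to limits, the gap term by Fatou's lemma. -/
theorem VerificationBound.of_tendsto {T : ℝ} {m : Measure (ℝ × Space d)}
    {b : ℝ → Space d → Space d} {ν₀ ν₁ : Measure (Space d)} {Φ k : ℝ → Space d → ℝ}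
    {Φs ks : ℕ → ℝ → Space d → ℝ} (h : ∀ n, VerificationBound T m b ν₀ ν₁ (Φs n) (ks n))
    (hT : Tendsto (fun n => ∫ x, Φs n T x ∂ν₁) atTop (𝓝 (∫ x, Φ T x ∂ν₁)))
    (h0 : Tendsto (fun n => ∫ x, Φs n 0 x ∂ν₀) atTop (𝓝 (∫ x, Φ 0 x ∂ν₀)))
    (hk : Tendsto (fun n => ∫ z, ks n z.1 z.2 ∂m) atTop (𝓝 (∫ z, k z.1 z.2 ∂m)))
    (hmeas : ∀ n, AEStronglyMeasurable
      (fun z : ℝ × Space d => b z.1 z.2 - gradient (Φs n z.1) z.2) m)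
    (hgrad : ∀ᵐ z ∂m, Tendsto (fun n => gradient (Φs n z.1) z.2) atTop
      (𝓝 (gradient (Φ z.1) z.2))) :
    VerificationBound T m b ν₀ ν₁ Φ k := by
  have hlim := ((hT.sub h0).sub hk).const_sub (∫ z, 1 / 2 * ‖b z.1 z.2‖ ^ 2 ∂m)
  refine ⟨ge_of_tendsto' hlim fun n => (h n).nonneg, ?_⟩
  have hfatou : ∫⁻ z, ENNReal.ofReal (1 / 2 * ‖b z.1 z.2 - gradient (Φ z.1) z.2‖ ^ 2) ∂m
      ≤ liminf (fun n => ∫⁻ z, ENNReal.ofReal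
        (1 / 2 * ‖b z.1 z.2 - gradient (Φs n z.1) z.2‖ ^ 2) ∂m) atTop := by
    refine le_trans (lintegral_mono_ae ?_) (lintegral_liminf_le' fun n => ?_)
    · filter_upwards [hgrad] with z hz
      refine le_of_eq (Tendsto.liminf_eq ?_).symm
      refine (ENNReal.continuous_ofReal.tendsto _).comp ?_
      exact ((hz.const_sub _).norm.pow 2).const_mul _
    · exact (((hmeas n).norm.pow 2).const_mul _).aemeasurable.ennreal_ofReal
  refine hfatou.trans ((liminf_le_liminf (Eventually.of_forall fun n => (h n).gap)).trans ?_)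
  exact (Tendsto.liminf_eq ((ENNReal.continuous_ofReal.tendsto _).comp hlim)).le

/-- The data of a perturbation of the backward flow `u` of `g` with horizon `T`: on `[0, S]` the
flow `u` is perturbed by `η` times the backward flow of `f`, where `|f| ≤ u S` and `|η| ≤ 1/2`, so
that the perturbed function stays above `u / 2`. -/
structure Perturbation (β T M : ℝ) (g f : Space d → ℝ) (S : ℝ) (η : ℝ → ℝ) (C' : ℝ) : Prop where
  cont_g : Continuous g
  bound_g : ∀ x, |g x| ≤ M
  pos_g : ∀ x, 0 < g x
  cont_f : Continuous f
  f_le : ∀ x, |f x| ≤ backwardFlow g β T S x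
  lt : S < T
  smooth : ContDiff ℝ 2 η
  le_half : ∀ t, |η t| ≤ 1 / 2
  eq_zero : ∀ t ≥ S, η t = 0
  deriv_le : ∀ t, |deriv η t| ≤ C'

/-- The perturbed backward flow, with its horizons moved by `δ` and lifted by `ε`. -/
noncomputable def perturbedFlow (g f : Space d → ℝ) (β T S : ℝ) (η : ℝ → ℝ) (δ ε t : ℝ)
    (x : Space d) : ℝ :=
  backwardFlow g β (T + δ) t x + ε + η t * backwardFlow f β (S + δ) t x

namespace Perturbation

variable {β T M S C' δ ε : ℝ} {g f : Space d → ℝ} {η : ℝ → ℝ}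

theorem bound_f (P : Perturbation β T M g f S η C') (x : Space d) : |f x| ≤ M :=
  (P.f_le x).trans ((le_abs_self _).trans (abs_backwardFlow_le P.bound_g β T S x))

theorem abs_flow_le (P : Perturbation β T M g f S η C') (hβ : 0 < β) {t : ℝ} (ht : t < S + δ)
    (x : Space d) : |backwardFlow f β (S + δ) t x| ≤ backwardFlow g β (T + δ) t x := by
  have hc := continuous_backwardFlow_space P.cont_g P.bound_g β T S
  have hb : ∀ x, |backwardFlow g β T S x| ≤ M := abs_backwardFlow_le P.bound_g β T S
  -- shifting both horizons by `δ` keeps the distance between `S` and `T`, so that the comparison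
  -- `|f| ≤ u S` can be propagated
  rw [← backwardFlow_backwardFlow P.cont_g P.bound_g hβ P.lt.le ht, abs_le]
  constructor
  · rw [neg_le, backwardFlow, ← heatFlow_neg]
    exact heatFlow_mono (M := M) P.cont_f.neg hc
      (fun x => by rw [Pi.neg_apply, abs_neg]; exact P.bound_f x) hb
      (fun x => (neg_le_abs _).trans (P.f_le x)) _ _
  · exact heatFlow_mono P.cont_f hc P.bound_f hb (fun x => (le_abs_self _).trans (P.f_le x)) _ _

theorem deriv_eq_zero (P : Perturbation β T M g f S η C') {t : ℝ} (ht : S ≤ t) :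
    deriv η t = 0 := by
  have h : ∀ t > S, deriv η t = 0 := fun t ht => by
    have : η =ᶠ[𝓝 t] fun _ => 0 := by
      filter_upwards [lt_mem_nhds ht] with s hs using P.eq_zero s hs.le
    rw [this.deriv_eq, deriv_const]
  rcases ht.eq_or_lt with rfl | ht
  · have hc : Continuous (deriv η) := P.smooth.continuous_deriv one_le_two
    refine tendsto_nhds_unique ((hc.tendsto S).mono_left (nhdsWithin_le_nhds (s := Ioi S))) ?_
    refine tendsto_const_nhds.congr' ?_
    filter_upwards [self_mem_nhdsWithin] with s hs using (h s hs).symm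
  · exact h t ht

theorem abs_mul_flow_le (P : Perturbation β T M g f S η C') (hβ : 0 < β) (hδ : 0 ≤ δ) (t : ℝ)
    (x : Space d) :
    |η t * backwardFlow f β (S + δ) t x| ≤ 1 / 2 * backwardFlow g β (T + δ) t x := by
  have hp := backwardFlow_pos P.cont_g P.bound_g P.pos_g β (T + δ) t x
  rcases lt_or_ge t S with ht | ht
  · rw [abs_mul]
    have := P.abs_flow_le hβ (by linarith : t < S + δ) x
    have := P.le_half t
    gcongr
  · rw [P.eq_zero t ht, zero_mul, abs_zero]
    positivity

theorem le_perturbedFlow (P : Perturbation β T M g f S η C') (hβ : 0 < β) (hδ : 0 ≤ δ) (ε t : ℝ)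
    (x : Space d) :
    1 / 2 * backwardFlow g β (T + δ) t x + ε ≤ perturbedFlow g f β T S η δ ε t x := by
  have := neg_le_of_abs_le (P.abs_mul_flow_le hβ hδ t x)
  simp only [perturbedFlow]
  linarith

theorem perturbedFlow_le (P : Perturbation β T M g f S η C') (hβ : 0 < β) (hδ : 0 ≤ δ) (ε t : ℝ)
    (x : Space d) : perturbedFlow g f β T S η δ ε t x ≤ 2 * M + ε := by
  have h1 := le_of_abs_le (P.abs_mul_flow_le hβ hδ t x)
  have h2 := le_of_abs_le (abs_backwardFlow_le P.bound_g β (T + δ) t x)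
  have h3 := backwardFlow_pos P.cont_g P.bound_g P.pos_g β (T + δ) t x
  simp only [perturbedFlow]
  linarith

theorem perturbedFlow_pos (P : Perturbation β T M g f S η C') (hβ : 0 < β) (hδ : 0 ≤ δ)
    (hε : 0 ≤ ε) (t : ℝ) (x : Space d) : 0 < perturbedFlow g f β T S η δ ε t x := by
  have h1 := P.le_perturbedFlow hβ hδ ε t x
  have h3 := backwardFlow_pos P.cont_g P.bound_g P.pos_g β (T + δ) t x
  linarith

theorem contDiffAt_mul_flow (P : Perturbation β T M g f S η C') (hβ : 0 < β) (hδ : 0 < δ) (t : ℝ)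
    (x : Space d) : ContDiffAt ℝ 2
      (fun z : ℝ × Space d => η z.1 * backwardFlow f β (S + δ) z.1 z.2) (t, x) ∧
      heatOp β (fun s y => η s * backwardFlow f β (S + δ) s y) t x
        = deriv η t * backwardFlow f β (S + δ) t x := by
  rcases lt_or_ge t (S + δ) with ht | ht
  · have hf := contDiffAt_backwardFlow P.cont_f P.bound_f hβ ht x 2
    refine ⟨(P.smooth.comp contDiff_fst).contDiffAt.mul hf, ?_⟩
    rw [heatOp_time_mul β P.smooth.contDiffAt hf,
      heatOp_backwardFlow P.cont_f P.bound_f hβ ht, mul_zero, zero_add]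
  · have h0 : (fun z : ℝ × Space d => η z.1 * backwardFlow f β (S + δ) z.1 z.2)
        =ᶠ[𝓝 (t, x)] fun _ => 0 := by
      filter_upwards [(continuous_fst.tendsto (t, x)).eventually
        (lt_mem_nhds (show S < t by linarith))] with z hz
      rw [P.eq_zero z.1 hz.le, zero_mul]
    refine ⟨contDiffAt_const.congr_of_eventuallyEq h0, ?_⟩
    have h1 : (fun s => η s * backwardFlow f β (S + δ) s x) =ᶠ[𝓝 t] fun _ => 0 :=
      ((by fun_prop : Continuous fun s : ℝ => (s, x)).tendsto t).eventually h0
    have h2 : (fun y => η t * backwardFlow f β (S + δ) t y) = fun _ => 0 := by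
      rw [P.eq_zero t (by linarith)]; simp
    rw [heatOp, h1.deriv_eq, h2, P.deriv_eq_zero (by linarith)]
    simp

theorem contDiffAt_perturbedFlow (P : Perturbation β T M g f S η C') (hβ : 0 < β) (hδ : 0 < δ)
    {t : ℝ} (ht : t < T + δ) (x : Space d) : ContDiffAt ℝ 2
      (fun z : ℝ × Space d => perturbedFlow g f β T S η δ ε z.1 z.2) (t, x) :=
  ((contDiffAt_backwardFlow P.cont_g P.bound_g hβ ht x 2).add contDiffAt_const).add
    (P.contDiffAt_mul_flow hβ hδ t x).1

theorem heatOp_perturbedFlow (P : Perturbation β T M g f S η C') (hβ : 0 < β) (hδ : 0 < δ)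
    {t : ℝ} (ht : t < T + δ) (x : Space d) :
    heatOp β (perturbedFlow g f β T S η δ ε) t x = deriv η t * backwardFlow f β (S + δ) t x := by
  have h1 := contDiffAt_backwardFlow P.cont_g P.bound_g hβ ht x 2
  have h2 : heatOp β (fun (_ : ℝ) (_ : Space d) => ε) t x = 0 := by simp [heatOp]
  have h3 : heatOp β (fun s y => backwardFlow g β (T + δ) s y + ε) t x = 0 := by
    rw [heatOp_add β h1 contDiffAt_const, h2, add_zero]
    exact heatOp_backwardFlow P.cont_g P.bound_g hβ ht x
  unfold perturbedFlow
  rw [heatOp_add β (h1.add contDiffAt_const) (P.contDiffAt_mul_flow hβ hδ t x).1, h3, zero_add]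
  exact (P.contDiffAt_mul_flow hβ hδ t x).2

theorem gradient_perturbedFlow (P : Perturbation β T M g f S η C') (hβ : 0 < β) (hδ : 0 ≤ δ)
    {t : ℝ} (ht : t < T) (x : Space d) :
    DifferentiableAt ℝ (perturbedFlow g f β T S η δ ε t) x ∧
    gradient (perturbedFlow g f β T S η δ ε t) x = gradient (backwardFlow g β (T + δ) t) x
      + η t • gradient (backwardFlow f β (S + δ) t) x := by
  have h1 := (contDiffAt_space (contDiffAt_backwardFlow P.cont_g P.bound_g hβ
    (by linarith : t < T + δ) x 2)).differentiableAt two_ne_zero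
  rcases lt_or_ge t S with hS | hS
  · have h2 := (contDiffAt_space (contDiffAt_backwardFlow P.cont_f P.bound_f hβ
      (by linarith : t < S + δ) x 2)).differentiableAt two_ne_zero
    refine ⟨(h1.add_const ε).add (h2.const_mul (η t)), ?_⟩
    ext i
    simp only [gradient_apply, PiLp.add_apply, PiLp.smul_apply]
    unfold perturbedFlow
    rw [fderiv_fun_add (h1.add_const ε) (h2.const_mul (η t)), fderiv_add_const,
      fderiv_const_mul h2]
    simp
  · have h3 : perturbedFlow g f β T S η δ ε t = fun y => backwardFlow g β (T + δ) t y + ε := by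
      funext y
      simp [perturbedFlow, P.eq_zero t hS]
    rw [h3, P.eq_zero t hS, zero_smul, add_zero]
    refine ⟨h1.add_const ε, ?_⟩
    simp only [gradient, fderiv_add_const]

theorem norm_gradient_perturbedFlow_le (P : Perturbation β T M g f S η C') (hβ : 0 < β)
    (hδ : 0 < δ) {t : ℝ} (ht : t < T) (x : Space d) :
    ‖gradient (perturbedFlow g f β T S η δ ε t) x‖ ≤ 2 * (2 ^ (d / 2 : ℝ) * M / √(β * δ)) := by
  have hM : 0 ≤ M := (abs_nonneg _).trans (P.bound_g 0)
  have hs : 0 < √(β * δ) := Real.sqrt_pos.2 (by positivity)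
  have key : ∀ {h : Space d → ℝ} {R : ℝ}, Continuous h → (∀ x, |h x| ≤ M) → t < R →
      ‖gradient (backwardFlow h β (R + δ) t) x‖ ≤ 2 ^ (d / 2 : ℝ) * M / √(β * δ) := by
    intro h R hc hb hR
    refine (norm_gradient_backwardFlow_le hc hb hβ (by linarith) x).trans ?_
    gcongr
    linarith
  have h1 := key P.cont_g P.bound_g ht
  have h0 : 0 ≤ 2 ^ (d / 2 : ℝ) * M / √(β * δ) := by positivity
  rw [(P.gradient_perturbedFlow hβ hδ.le ht x).2]
  refine (norm_add_le _ _).trans ?_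
  rw [two_mul]
  refine add_le_add h1 ?_
  rcases lt_or_ge t S with hS | hS
  · rw [norm_smul]
    have h2 := key P.cont_f P.bound_f hS
    have h3 : ‖η t‖ ≤ 1 := (P.le_half t).trans (by norm_num)
    calc _ ≤ 1 * (2 ^ (d / 2 : ℝ) * M / √(β * δ)) := by gcongr
      _ = _ := one_mul _
  · rw [P.eq_zero t hS, zero_smul, norm_zero]
    exact h0

theorem continuous_perturbedFlow (P : Perturbation β T M g f S η C') :
    Continuous fun z : ℝ × Space d => perturbedFlow g f β T S η δ ε z.1 z.2 := by
  have h1 := (continuous_backwardFlow P.cont_g P.bound_g β).comp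
    (by fun_prop : Continuous fun z : ℝ × Space d => (T + δ, z.1, z.2))
  have h2 := (continuous_backwardFlow P.cont_f P.bound_f β).comp
    (by fun_prop : Continuous fun z : ℝ × Space d => (S + δ, z.1, z.2))
  exact (h1.add continuous_const).add ((P.smooth.continuous.comp continuous_fst).mul h2)

theorem abs_source_le (P : Perturbation β T M g f S η C') (hβ : 0 < β) (hδ : 0 ≤ δ) (hε : 0 ≤ ε)
    (t : ℝ) (x : Space d) :
    |2 * β * (deriv η t * backwardFlow f β (S + δ) t x) / perturbedFlow g f β T S η δ ε t x|
      ≤ 4 * β * C' := by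
  have hC' : 0 ≤ C' := (abs_nonneg _).trans (P.deriv_le t)
  rcases lt_or_ge t S with hS | hS
  · have hp := P.perturbedFlow_pos hβ hδ hε t x
    have h1 := P.le_perturbedFlow hβ hδ ε t x
    have h2 := P.abs_flow_le hβ (by linarith : t < S + δ) x
    rw [abs_div, abs_of_pos hp, div_le_iff₀ hp, abs_mul, abs_mul (deriv η t),
      abs_of_pos (show 0 < 2 * β by positivity)]
    calc 2 * β * (|deriv η t| * |backwardFlow f β (S + δ) t x|)
        ≤ 2 * β * (C' * (2 * perturbedFlow g f β T S η δ ε t x)) := by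
          gcongr
          · exact P.deriv_le t
          · linarith
      _ = _ := by ring
  · rw [P.deriv_eq_zero hS]
    simp only [zero_mul, mul_zero, zero_div, abs_zero]
    positivity

theorem gradient_log (P : Perturbation β T M g f S η C') (hβ : 0 < β) (hδ : 0 ≤ δ) (hε : 0 ≤ ε)
    {t : ℝ} (ht : t < T) (x : Space d) :
    gradient (fun y => 2 * β * Real.log (perturbedFlow g f β T S η δ ε t y)) x
      = (2 * β / perturbedFlow g f β T S η δ ε t x) •
        (gradient (backwardFlow g β (T + δ) t) x
          + η t • gradient (backwardFlow f β (S + δ) t) x) := by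
  have hp := P.perturbedFlow_pos hβ hδ hε t x
  obtain ⟨h1, h2⟩ := P.gradient_perturbedFlow (ε := ε) hβ hδ ht x
  have h3 : DifferentiableAt ℝ (fun r => 2 * β * Real.log r) (perturbedFlow g f β T S η δ ε t x) :=
    (Real.differentiableAt_log hp.ne').const_mul _
  rw [gradient_comp (h := fun r => 2 * β * Real.log r) h3 h1, h2]
  simp [div_eq_mul_inv]

theorem tendsto_perturbedFlow (P : Perturbation β T M g f S η C') {δs εs : ℕ → ℝ}
    (hδ : Tendsto δs atTop (𝓝 0)) (hε : Tendsto εs atTop (𝓝 ε)) (t : ℝ) (x : Space d) :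
    Tendsto (fun n => perturbedFlow g f β T S η (δs n) (εs n) t x) atTop
      (𝓝 (perturbedFlow g f β T S η 0 ε t x)) := by
  simp only [perturbedFlow, add_zero]
  exact ((tendsto_backwardFlow P.cont_g P.bound_g β T t x hδ).add hε).add
    ((tendsto_backwardFlow P.cont_f P.bound_f β S t x hδ).const_mul _)

theorem tendsto_gradient_log (P : Perturbation β T M g f S η C') (hβ : 0 < β) {δs εs : ℕ → ℝ}
    (hδ : Tendsto δs atTop (𝓝 0)) (hε : Tendsto εs atTop (𝓝 ε)) (hδ0 : ∀ n, 0 ≤ δs n)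
    (hε0 : ∀ n, 0 ≤ εs n) {t : ℝ} (ht : t < T) (x : Space d) :
    Tendsto (fun n => gradient (fun y => 2 * β * Real.log
      (perturbedFlow g f β T S η (δs n) (εs n) t y)) x) atTop
      (𝓝 (gradient (fun y => 2 * β * Real.log (perturbedFlow g f β T S η 0 ε t y)) x)) := by
  have hεnn : 0 ≤ ε := ge_of_tendsto' hε hε0
  simp only [P.gradient_log hβ (hδ0 _) (hε0 _) ht]
  rw [P.gradient_log hβ le_rfl hεnn ht, add_zero, add_zero]
  refine Tendsto.smul ?_ (Tendsto.add ?_ ?_)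
  · exact tendsto_const_nhds.div (P.tendsto_perturbedFlow hδ hε t x)
      (P.perturbedFlow_pos hβ le_rfl hεnn t x).ne'
  · exact tendsto_gradient_backwardFlow P.cont_g P.bound_g hβ ht x hδ
  · rcases lt_or_ge t S with hS | hS
    · exact (tendsto_gradient_backwardFlow P.cont_f P.bound_f hβ hS x hδ).const_smul _
    · simp only [P.eq_zero t hS, zero_smul]
      exact tendsto_const_nhds

section WeakFlow

variable {m : Measure (ℝ × Space d)} {b : ℝ → Space d → Space d} {ν₀ ν₁ : Measure (Space d)}

theorem aestronglyMeasurable_gradient_log_of_pos (P : Perturbation β T M g f S η C') (hβ : 0 < β)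
    (hm : ∀ᵐ z ∂m, z.1 ∈ Ioo 0 T) (hδ : 0 < δ) (hε : 0 ≤ ε) :
    AEStronglyMeasurable (fun z : ℝ × Space d => gradient (fun y => 2 * β * Real.log
      (perturbedFlow g f β T S η δ ε z.1 y)) z.2) m := by
  refine aestronglyMeasurable_of_continuousOn_time hm ?_
  refine (contDiffOn_gradient (n := 1)
    (φ := fun t y => 2 * β * Real.log (perturbedFlow g f β T S η δ ε t y))
    (isOpen_Ioo.prod isOpen_univ) fun z hz => ?_).continuousOn
  have := P.contDiffAt_perturbedFlow (ε := ε) hβ hδ (by linarith [hz.1.2] : z.1 < T + δ) z.2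
  exact (contDiffAt_const.mul
    (this.log (P.perturbedFlow_pos hβ hδ.le hε _ _).ne')).contDiffWithinAt

theorem aestronglyMeasurable_gradient_log (P : Perturbation β T M g f S η C') (hβ : 0 < β)
    (hm : ∀ᵐ z ∂m, z.1 ∈ Ioo 0 T) (hε : 0 ≤ ε) :
    AEStronglyMeasurable (fun z : ℝ × Space d => gradient (fun y => 2 * β * Real.log
      (perturbedFlow g f β T S η 0 ε z.1 y)) z.2) m := by
  have hδ : Tendsto (fun n : ℕ => 1 / ((n : ℝ) + 1)) atTop (𝓝 0) :=
    tendsto_one_div_add_atTop_nhds_zero_nat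
  refine aestronglyMeasurable_of_tendsto_ae (f := fun (n : ℕ) (z : ℝ × Space d) =>
    gradient (fun y => 2 * β * Real.log (perturbedFlow g f β T S η (1 / ((n : ℝ) + 1)) ε z.1 y))
      z.2) atTop
    (fun n => P.aestronglyMeasurable_gradient_log_of_pos hβ hm (by positivity) hε) ?_
  filter_upwards [hm] with z hz
  exact P.tendsto_gradient_log hβ hδ tendsto_const_nhds (fun n => by positivity) (fun _ => hε)
    hz.2 z.2

variable [IsFiniteMeasure m] [IsFiniteMeasure ν₀] [IsFiniteMeasure ν₁]

theorem tendsto_integral_source (P : Perturbation β T M g f S η C') (hβ : 0 < β)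
    {δs εs : ℕ → ℝ} (hδ : Tendsto δs atTop (𝓝 0)) (hε : Tendsto εs atTop (𝓝 ε))
    (hδ0 : ∀ n, 0 ≤ δs n) (hε0 : ∀ n, 0 ≤ εs n) :
    Tendsto (fun n => ∫ z, 2 * β * (deriv η z.1 * backwardFlow f β (S + δs n) z.1 z.2)
        / perturbedFlow g f β T S η (δs n) (εs n) z.1 z.2 ∂m) atTop
      (𝓝 (∫ z, 2 * β * (deriv η z.1 * backwardFlow f β (S + 0) z.1 z.2)
        / perturbedFlow g f β T S η 0 ε z.1 z.2 ∂m)) := by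
  have hεnn : 0 ≤ ε := ge_of_tendsto' hε hε0
  refine tendsto_integral_of_dominated_convergence (fun _ => 4 * β * C') (fun n => ?_)
    (integrable_const _)
    (fun n => Eventually.of_forall fun z => P.abs_source_le hβ (hδ0 n) (hε0 n) z.1 z.2)
    (Eventually.of_forall fun z => ?_)
  · have h2 := (continuous_backwardFlow P.cont_f P.bound_f β).comp
      (by fun_prop : Continuous fun z : ℝ × Space d => (S + δs n, z.1, z.2))
    have h3 : Continuous fun z : ℝ × Space d => deriv η z.1 :=
      (P.smooth.continuous_deriv one_le_two).comp continuous_fst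
    exact ((continuous_const.mul (h3.mul h2)).div P.continuous_perturbedFlow
      fun z => (P.perturbedFlow_pos hβ (hδ0 n) (hε0 n) _ _).ne').aestronglyMeasurable
  · rw [add_zero]
    exact (((tendsto_backwardFlow P.cont_f P.bound_f β S z.1 z.2 hδ).const_mul _).const_mul _).div
      (P.tendsto_perturbedFlow hδ hε z.1 z.2) (P.perturbedFlow_pos hβ le_rfl hεnn _ _).ne'

/-- The verification bound for the regularized potential `2β log N`. -/
theorem verificationBound_of_pos (P : Perturbation β T M g f S η C') (hβ : 0 < β) (hT : 0 < T)
    (h : IsWeakFlow T β m b ν₀ ν₁) (hb : Integrable (fun z : ℝ × Space d => ‖b z.1 z.2‖ ^ 2) m)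
    (hδ : 0 < δ) (hε : 0 < ε) :
    VerificationBound T m b ν₀ ν₁
      (fun t x => 2 * β * Real.log (perturbedFlow g f β T S η δ ε t x))
      (fun t x => 2 * β * (deriv η t * backwardFlow f β (S + δ) t x)
        / perturbedFlow g f β T S η δ ε t x) := by
  have hM : 0 ≤ M := (abs_nonneg _).trans (P.bound_g 0)
  have hC' : 0 ≤ C' := (abs_nonneg _).trans (P.deriv_le 0)
  have h1 : 0 ≤ 2 * (2 ^ (d / 2 : ℝ) * M / √(β * δ)) := by positivity
  have h2 : 0 ≤ C' * M := by positivity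
  refine h.verificationBound_log hT hβ hb (δ := δ) (ε := ε)
    (C := 2 * M + ε + 2 * (2 ^ (d / 2 : ℝ) * M / √(β * δ)) + C' * M) hδ hε
    (fun t ht x => P.contDiffAt_perturbedFlow hβ hδ ht.2 x)
    (fun t _ x => P.perturbedFlow_pos hβ hδ.le hε.le t x)
    (fun t _ x => ?_) (fun t _ x => (P.perturbedFlow_le hβ hδ.le ε t x).trans (by linarith))
    (fun t ht x => (P.norm_gradient_perturbedFlow_le hβ hδ ht.2 x).trans (by linarith))
    (fun t ht x => P.heatOp_perturbedFlow hβ hδ (by linarith [ht.2]) x)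
    (fun t _ x => ?_)
  · have h3 := P.le_perturbedFlow hβ hδ.le ε t x
    have h4 := backwardFlow_pos P.cont_g P.bound_g P.pos_g β (T + δ) t x
    linarith
  · have h3 : |deriv η t * backwardFlow f β (S + δ) t x| ≤ C' * M := by
      rw [abs_mul]
      exact mul_le_mul (P.deriv_le t) (abs_backwardFlow_le P.bound_f _ _ _ _) (abs_nonneg _) hC'
    linarith

/-- The verification bound for the perturbed potential, with its logarithmic singularities. The
horizon shift is removed first, when the lift still keeps the logarithms bounded; then the lift,
when the logarithms are dominated by those of `g` and of the unperturbed flow. -/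
theorem verificationBound (P : Perturbation β T M g f S η C') (hβ : 0 < β) (hT : 0 < T)
    (h : IsWeakFlow T β m b ν₀ ν₁) (hb : Integrable (fun z : ℝ × Space d => ‖b z.1 z.2‖ ^ 2) m)
    (h₁ : Integrable (fun x => Real.log (g x)) ν₁)
    (h₀ : Integrable (fun x => Real.log (backwardFlow g β T 0 x)) ν₀) :
    VerificationBound T m b ν₀ ν₁
      (fun t x => 2 * β * Real.log (perturbedFlow g f β T S η 0 0 t x))
      (fun t x => 2 * β * (deriv η t * backwardFlow f β (S + 0) t x)
        / perturbedFlow g f β T S η 0 0 t x) := by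
  have hM : 0 ≤ M := (abs_nonneg _).trans (P.bound_g 0)
  have hs0 : Tendsto (fun n : ℕ => 1 / ((n : ℝ) + 1)) atTop (𝓝 0) :=
    tendsto_one_div_add_atTop_nhds_zero_nat
  have hspos : ∀ n : ℕ, 0 < 1 / ((n : ℝ) + 1) := fun n => by positivity
  have hsle : ∀ n : ℕ, 1 / ((n : ℝ) + 1) ≤ 1 := fun n => by
    rw [div_le_one (by positivity)]; simp
  have hcont : ∀ {δ ε : ℝ}, 0 ≤ δ → 0 ≤ ε → ∀ t, Continuous fun x =>
      2 * β * Real.log (perturbedFlow g f β T S η δ ε t x) := by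
    intro δ ε hδ hε t
    have : Continuous fun x => perturbedFlow g f β T S η δ ε t x :=
      P.continuous_perturbedFlow.comp (by fun_prop : Continuous fun x : Space d => (t, x))
    exact continuous_const.mul (this.log fun x => (P.perturbedFlow_pos hβ hδ hε t x).ne')
  have hlog : ∀ {ε : ℝ}, 0 ≤ ε → ∀ {δs εs : ℕ → ℝ}, Tendsto δs atTop (𝓝 0) →
      Tendsto εs atTop (𝓝 ε) → ∀ t x, Tendsto (fun n => 2 * β * Real.log
        (perturbedFlow g f β T S η (δs n) (εs n) t x)) atTop
        (𝓝 (2 * β * Real.log (perturbedFlow g f β T S η 0 ε t x))) := by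
    intro ε hε δs εs hδs hεs t x
    exact ((P.tendsto_perturbedFlow hδs hεs t x).log
      (P.perturbedFlow_pos hβ le_rfl hε t x).ne').const_mul _
  have hupper : ∀ {δ ε : ℝ}, 0 ≤ δ → 0 ≤ ε → ε ≤ 1 → ∀ t x,
      Real.log (perturbedFlow g f β T S η δ ε t x) ≤ Real.log (2 * M + 1) := fun hδ hε hε1 t x =>
    Real.log_le_log (P.perturbedFlow_pos hβ hδ hε t x)
      ((P.perturbedFlow_le hβ hδ _ t x).trans (by linarith))
  -- the limit `δ → 0` at fixed `ε`, with `log ε` as lower bound for the logarithms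
  have step : ∀ ε, 0 < ε → ε ≤ 1 → VerificationBound T m b ν₀ ν₁
      (fun t x => 2 * β * Real.log (perturbedFlow g f β T S η 0 ε t x))
      (fun t x => 2 * β * (deriv η t * backwardFlow f β (S + 0) t x)
        / perturbedFlow g f β T S η 0 ε t x) := by
    intro ε hε hε1
    have hbd : ∀ {δ : ℝ}, 0 ≤ δ → ∀ t x,
        ‖2 * β * Real.log (perturbedFlow g f β T S η δ ε t x)‖
          ≤ 2 * β * (|Real.log ε| + |Real.log (2 * M + 1)|) := by
      intro δ hδ t x
      have h1 := hupper hδ hε.le hε1 t x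
      have h2 : Real.log ε ≤ Real.log (perturbedFlow g f β T S η δ ε t x) := by
        refine Real.log_le_log hε ?_
        have h3 := P.le_perturbedFlow hβ hδ ε t x
        have h4 := backwardFlow_pos P.cont_g P.bound_g P.pos_g β (T + δ) t x
        linarith
      rw [norm_mul, Real.norm_of_nonneg (show 0 ≤ 2 * β by positivity), Real.norm_eq_abs]
      gcongr
      rw [abs_le]
      constructor
      · linarith [neg_abs_le (Real.log ε), abs_nonneg (Real.log (2 * M + 1))]
      · linarith [le_abs_self (Real.log (2 * M + 1)), abs_nonneg (Real.log ε)]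
    have hlimν : ∀ (ν : Measure (Space d)) [IsFiniteMeasure ν], ∀ t, Tendsto (fun n : ℕ =>
        ∫ x, 2 * β * Real.log (perturbedFlow g f β T S η (1 / ((n : ℝ) + 1)) ε t x) ∂ν) atTop
        (𝓝 (∫ x, 2 * β * Real.log (perturbedFlow g f β T S η 0 ε t x) ∂ν)) := by
      intro ν _ t
      exact tendsto_integral_of_dominated_convergence _
        (fun n => (hcont (hspos n).le hε.le t).aestronglyMeasurable) (integrable_const _)
        (fun n => Eventually.of_forall fun x => hbd (hspos n).le t x)
        (Eventually.of_forall fun x => hlog hε.le hs0 tendsto_const_nhds t x)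
    refine VerificationBound.of_tendsto
      (fun n => P.verificationBound_of_pos hβ hT h hb (hspos n) hε) (hlimν ν₁ T) (hlimν ν₀ 0)
      (P.tendsto_integral_source hβ hs0 tendsto_const_nhds (fun n => (hspos n).le) fun _ => hε.le)
      (fun n => h.drift.aestronglyMeasurable.sub
        (P.aestronglyMeasurable_gradient_log_of_pos hβ h.time_mem (hspos n) hε.le)) ?_
    filter_upwards [h.time_mem] with z hz
    exact P.tendsto_gradient_log hβ hs0 tendsto_const_nhds (fun n => (hspos n).le)
      (fun _ => hε.le) hz.2 z.2
  -- for the limit `ε → 0`: the perturbed flow is at least half of the unperturbed one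
  have hlimν : ∀ (ν : Measure (Space d)) [IsFiniteMeasure ν], ∀ t,
      Integrable (fun x => Real.log (backwardFlow g β T t x)) ν → Tendsto (fun n : ℕ =>
        ∫ x, 2 * β * Real.log (perturbedFlow g f β T S η 0 (1 / ((n : ℝ) + 1)) t x) ∂ν) atTop
        (𝓝 (∫ x, 2 * β * Real.log (perturbedFlow g f β T S η 0 0 t x) ∂ν)) := by
    intro ν _ t hν
    refine tendsto_integral_of_dominated_convergence
      (fun x => 2 * β * (|Real.log (backwardFlow g β T t x)|
        + (|Real.log (1 / 2)| + |Real.log (2 * M + 1)|)))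
      (fun n => (hcont le_rfl (hspos n).le t).aestronglyMeasurable)
      ((hν.abs.add (integrable_const _)).const_mul _)
      (fun n => Eventually.of_forall fun x => ?_)
      (Eventually.of_forall fun x => hlog le_rfl tendsto_const_nhds hs0 t x)
    have h1 := hupper le_rfl (hspos n).le (hsle n) t x
    have hpos := backwardFlow_pos P.cont_g P.bound_g P.pos_g β T t x
    have h2 : Real.log (1 / 2) + Real.log (backwardFlow g β T t x)
        ≤ Real.log (perturbedFlow g f β T S η 0 (1 / ((n : ℝ) + 1)) t x) := by
      rw [← Real.log_mul (by norm_num) hpos.ne']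
      refine Real.log_le_log (by positivity) ?_
      have h3 := P.le_perturbedFlow hβ le_rfl (1 / ((n : ℝ) + 1)) t x
      rw [add_zero] at h3
      linarith [hspos n]
    rw [norm_mul, Real.norm_of_nonneg (show 0 ≤ 2 * β by positivity), Real.norm_eq_abs]
    gcongr
    rw [abs_le]
    have a1 := abs_nonneg (Real.log (backwardFlow g β T t x))
    have a2 := neg_abs_le (Real.log (backwardFlow g β T t x))
    have a3 := neg_abs_le (Real.log (1 / 2 : ℝ))
    have a4 := abs_nonneg (Real.log (1 / 2 : ℝ))
    have a5 := le_abs_self (Real.log (2 * M + 1))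
    have a6 := abs_nonneg (Real.log (2 * M + 1))
    constructor <;> linarith
  refine VerificationBound.of_tendsto (fun n : ℕ => step _ (hspos n) (hsle n))
    (hlimν ν₁ T ?_) (hlimν ν₀ 0 h₀)
    (P.tendsto_integral_source hβ tendsto_const_nhds hs0 (fun _ => le_rfl) fun n => (hspos n).le)
    (fun n => h.drift.aestronglyMeasurable.sub
      (P.aestronglyMeasurable_gradient_log hβ h.time_mem (hspos n).le)) ?_
  · simpa only [backwardFlow_self] using h₁
  · filter_upwards [h.time_mem] with z hz
    exact P.tendsto_gradient_log hβ tendsto_const_nhds hs0 (fun _ => le_rfl)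
      (fun n => (hspos n).le) hz.2 z.2

end WeakFlow

end Perturbation

/-! ### The bridge density -/

theorem norm_sub_sq_le {η : ℝ} (hη : 0 < η) (x y : Space d) :
    ‖x - y‖ ^ 2 ≤ (1 + η) * ‖x‖ ^ 2 + (1 + 1 / η) * ‖y‖ ^ 2 := by
  have h1 := norm_sub_le x y
  have h2 : ‖x - y‖ ^ 2 ≤ (‖x‖ + ‖y‖) ^ 2 := by gcongr
  have h3 : (1 + η) * ‖x‖ ^ 2 + (1 + 1 / η) * ‖y‖ ^ 2 - (‖x‖ + ‖y‖) ^ 2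
      = (η * ‖x‖ - ‖y‖) ^ 2 / η := by
    field_simp; ring
  have h4 : 0 ≤ (η * ‖x‖ - ‖y‖) ^ 2 / η := by positivity
  linarith

/-- The heat flow of a positive function decays no faster than the heat kernel itself, up to an
arbitrarily small loss in the exponent. -/
theorem exists_le_heatFlow {g : Space d → ℝ} {M : ℝ} (hg : Continuous g) (hM : ∀ x, |g x| ≤ M)
    (hpos : ∀ x, 0 < g x) {s κ : ℝ} (hs : 0 < s) (hκ : 1 / (4 * s) < κ) :
    ∃ c > 0, ∀ x, c * Real.exp (-κ * ‖x‖ ^ 2) ≤ heatFlow g s x := by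
  -- `κ = (1 + η) / 4s`, and the excess `η` pays for the cross term of `‖x - y‖²`
  set η := 4 * s * κ - 1 with hη
  have hηpos : 0 < η := by
    rw [div_lt_iff₀ (by positivity)] at hκ
    rw [hη]; linarith
  set a := (1 + 1 / η) / (4 * s) with ha
  have hapos : 0 < a := by rw [ha]; positivity
  have hbi : Integrable fun y : Space d => Real.exp (-a * ‖y‖ ^ 2) * g y :=
    (integrable_exp_neg_mul_norm_sq hapos).mul_bdd hg.aestronglyMeasurable (Eventually.of_forall hM)
  have hI : 0 < ∫ y : Space d, Real.exp (-a * ‖y‖ ^ 2) * g y := by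
    refine (integral_pos_iff_support_of_nonneg
      (fun y => mul_nonneg (Real.exp_pos _).le (hpos y).le) hbi).2 ?_
    have : Function.support (fun y : Space d => Real.exp (-a * ‖y‖ ^ 2) * g y) = univ := by
      ext y
      simp [(hpos y).ne']
    rw [this, Measure.measure_univ_pos]
    exact NeZero.ne _
  have hA : 0 < (4 * Real.pi * s) ^ (-(d / 2 : ℝ)) := by positivity
  refine ⟨(4 * Real.pi * s) ^ (-(d / 2 : ℝ)) * ∫ y : Space d, Real.exp (-a * ‖y‖ ^ 2) * g y,
    by positivity, fun x => ?_⟩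
  rw [heatFlow_eq g hs, mul_right_comm, ← integral_const_mul]
  refine integral_mono (hbi.const_mul _)
    ((HeatGrowth.of_bounded hg hM).integrable_kernel hs (by simp) x) fun y => ?_
  simp only
  rw [← mul_assoc]
  refine mul_le_mul_of_nonneg_right ?_ (hpos y).le
  rw [heatKernel, mul_assoc, ← Real.exp_add]
  refine mul_le_mul_of_nonneg_left (Real.exp_le_exp.2 ?_) hA.le
  have h1 := norm_sub_sq_le hηpos x y
  have h2 : κ = (1 + η) / (4 * s) := by rw [hη]; field_simp; ring
  rw [h2, ha, ← sub_nonneg]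
  have h3 : -‖x - y‖ ^ 2 / (4 * s) - (-((1 + η) / (4 * s)) * ‖x‖ ^ 2
      + -((1 + 1 / η) / (4 * s)) * ‖y‖ ^ 2)
      = ((1 + η) * ‖x‖ ^ 2 + (1 + 1 / η) * ‖y‖ ^ 2 - ‖x - y‖ ^ 2) / (4 * s) := by ring
  rw [h3]
  exact div_nonneg (by linarith) (by positivity)

/-- The standing assumptions: a positive bounded continuous function `g ≤ M`, in the problem
`exp (-V / 2β)`, and an initial density `ρ₀`. -/
structure BridgeData (β T M : ℝ) (g ρ₀ : Space d → ℝ) : Prop where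
  β_pos : 0 < β
  T_pos : 0 < T
  cont_g : Continuous g
  bound_g : ∀ x, |g x| ≤ M
  pos_g : ∀ x, 0 < g x
  density : IsP2Density ρ₀

/-- The initial density, divided by the backward flow of `g`. -/
noncomputable def initialRatio (g ρ₀ : Space d → ℝ) (β T : ℝ) (z : Space d) : ℝ :=
  ρ₀ z / backwardFlow g β T 0 z

/-- The density of the process obtained from Brownian motion by the Doob transform with the
backward flow of `g`: the product of that flow with the forward heat flow of the initial ratio. -/
noncomputable def bridgeDensity (g ρ₀ : Space d → ℝ) (β T t : ℝ) (x : Space d) : ℝ :=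
  if t = 0 then ρ₀ x else backwardFlow g β T t x * heatFlow (initialRatio g ρ₀ β T) (β * t) x

namespace BridgeData

variable {β T M : ℝ} {g ρ₀ : Space d → ℝ}

theorem M_pos (B : BridgeData β T M g ρ₀) : 0 < M :=
  (B.pos_g 0).trans_le ((le_abs_self _).trans (B.bound_g 0))

theorem flow_pos (B : BridgeData β T M g ρ₀) (t : ℝ) (x : Space d) :
    0 < backwardFlow g β T t x :=
  backwardFlow_pos B.cont_g B.bound_g B.pos_g β T t x

theorem flow_le (B : BridgeData β T M g ρ₀) (t : ℝ) (x : Space d) : backwardFlow g β T t x ≤ M :=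
  (le_abs_self _).trans (abs_backwardFlow_le B.bound_g β T t x)

theorem continuous_flow (B : BridgeData β T M g ρ₀) (t : ℝ) :
    Continuous (backwardFlow g β T t) :=
  continuous_backwardFlow_space B.cont_g B.bound_g β T t

theorem ratio_nonneg (B : BridgeData β T M g ρ₀) (z : Space d) : 0 ≤ initialRatio g ρ₀ β T z :=
  div_nonneg (B.density.nonneg z) (B.flow_pos 0 z).le

theorem ratio_mul_flow (B : BridgeData β T M g ρ₀) (z : Space d) :
    initialRatio g ρ₀ β T z * backwardFlow g β T 0 z = ρ₀ z :=
  div_mul_cancel₀ _ (B.flow_pos 0 z).ne'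

theorem aestronglyMeasurable_ratio (B : BridgeData β T M g ρ₀) :
    AEStronglyMeasurable (initialRatio g ρ₀ β T) := by
  have h : Continuous fun z => (backwardFlow g β T 0 z)⁻¹ :=
    (B.continuous_flow 0).inv₀ fun z => (B.flow_pos 0 z).ne'
  exact (B.density.integrable.aestronglyMeasurable.mul h.aestronglyMeasurable).congr
    (Eventually.of_forall fun z => (div_eq_mul_inv _ _).symm)

/-- As `u 0` decays no faster than the heat kernel at the time `β T`, the ratio `ρ₀ / u 0` has a
heat flow up to that time, although it need not be integrable. -/
theorem heatGrowth_ratio (B : BridgeData β T M g ρ₀) :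
    HeatGrowth (1 / (4 * (β * T))) (initialRatio g ρ₀ β T) := by
  refine ⟨B.aestronglyMeasurable_ratio, fun a ha => ?_⟩
  obtain ⟨c, hc, hle⟩ := exists_le_heatFlow B.cont_g B.bound_g B.pos_g
    (mul_pos B.β_pos B.T_pos) ha
  refine (B.density.integrable.const_mul (1 / c)).mono' ?_ (Eventually.of_forall fun z => ?_)
  · exact (Continuous.aestronglyMeasurable (by fun_prop)).mul B.aestronglyMeasurable_ratio
  · have h1 : c * Real.exp (-a * ‖z‖ ^ 2) ≤ backwardFlow g β T 0 z := by
      simpa [backwardFlow] using hle z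
    have h2 := B.flow_pos 0 z
    rw [norm_mul, Real.norm_eq_abs, Real.abs_exp, Real.norm_of_nonneg (B.ratio_nonneg z),
      initialRatio, mul_div_assoc', div_le_iff₀ h2]
    have h3 : Real.exp (-a * ‖z‖ ^ 2) ≤ 1 / c * backwardFlow g β T 0 z := by
      rw [one_div, ← div_eq_inv_mul, le_div_iff₀ hc, mul_comm]
      exact h1
    calc Real.exp (-a * ‖z‖ ^ 2) * ρ₀ z ≤ 1 / c * backwardFlow g β T 0 z * ρ₀ z :=
          mul_le_mul_of_nonneg_right h3 (B.density.nonneg z)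
      _ = _ := by ring

/-- The initial value of the potential grows at most quadratically. -/
theorem integrable_log_flow_mul (B : BridgeData β T M g ρ₀) :
    Integrable fun z => Real.log (backwardFlow g β T 0 z) * ρ₀ z := by
  have hβT := mul_pos B.β_pos B.T_pos
  obtain ⟨c, hc, hle⟩ := exists_le_heatFlow B.cont_g B.bound_g B.pos_g hβT
    (show 1 / (4 * (β * T)) < 1 / (β * T) by
      rw [div_lt_div_iff₀ (by positivity) hβT]; linarith)
  have hm : Continuous fun z => Real.log (backwardFlow g β T 0 z) :=
    (B.continuous_flow 0).log fun z => (B.flow_pos 0 z).ne'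
  refine ((B.density.integrable.const_mul (|Real.log c| + |Real.log M|)).add
    (B.density.second_moment.const_mul (1 / (β * T)))).mono'
    (hm.aestronglyMeasurable.mul B.density.integrable.aestronglyMeasurable)
    (Eventually.of_forall fun z => ?_)
  have h1 : c * Real.exp (-(1 / (β * T)) * ‖z‖ ^ 2) ≤ backwardFlow g β T 0 z := by
    simpa [backwardFlow] using hle z
  have h2 := Real.log_le_log (by positivity) h1
  rw [Real.log_mul hc.ne' (Real.exp_pos _).ne', Real.log_exp] at h2
  have h3 := Real.log_le_log (B.flow_pos 0 z) (B.flow_le 0 z)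
  have h4 : |Real.log (backwardFlow g β T 0 z)|
      ≤ |Real.log c| + |Real.log M| + 1 / (β * T) * ‖z‖ ^ 2 := by
    have h5 : 0 ≤ 1 / (β * T) * ‖z‖ ^ 2 := by positivity
    rw [abs_le]
    constructor
    · linarith [neg_abs_le (Real.log c), abs_nonneg (Real.log M)]
    · linarith [le_abs_self (Real.log M), abs_nonneg (Real.log c)]
  rw [norm_mul, Real.norm_eq_abs, Real.norm_of_nonneg (B.density.nonneg z)]
  calc _ ≤ (|Real.log c| + |Real.log M| + 1 / (β * T) * ‖z‖ ^ 2) * ρ₀ z :=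
        mul_le_mul_of_nonneg_right h4 (B.density.nonneg z)
    _ = _ := by simp only [Pi.add_apply]; ring

theorem bridgeDensity_eq {t : ℝ} (ht : t ≠ 0) (x : Space d) :
    bridgeDensity g ρ₀ β T t x
      = backwardFlow g β T t x * heatFlow (initialRatio g ρ₀ β T) (β * t) x := if_neg ht

theorem bridgeDensity_eq_integral (B : BridgeData β T M g ρ₀) {t : ℝ} (ht : 0 < t) (x : Space d) :
    bridgeDensity g ρ₀ β T t x = ∫ z, backwardFlow g β T t x * heatKernel (β * t) (x - z)
      * initialRatio g ρ₀ β T z := by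
  rw [bridgeDensity_eq ht.ne', heatFlow_eq _ (mul_pos B.β_pos ht), ← integral_const_mul]
  simp only [mul_assoc]

/-- The transition density of the Doob transform has mass one. -/
theorem integral_flow_mul_kernel (B : BridgeData β T M g ρ₀) {t : ℝ} (ht : t ∈ Ioc 0 T)
    (z : Space d) :
    Integrable (fun x => backwardFlow g β T t x * heatKernel (β * t) (x - z)) ∧
    ∫ x, backwardFlow g β T t x * heatKernel (β * t) (x - z) = backwardFlow g β T 0 z := by
  have hbt := mul_pos B.β_pos ht.1
  refine ⟨(integrable_heatKernel_sub hbt z).bdd_mul (B.continuous_flow t).aestronglyMeasurable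
    (Eventually.of_forall (abs_backwardFlow_le B.bound_g β T t)), ?_⟩
  have h1 := heatFlow_heatFlow B.cont_g B.bound_g hbt
    (mul_nonneg B.β_pos.le (sub_nonneg.2 ht.2)) z
  rw [heatFlow_eq _ hbt] at h1
  have h2 : β * t + β * (T - t) = β * (T - 0) := by ring
  rw [h2] at h1
  unfold backwardFlow
  rw [← h1]
  refine integral_congr_ae (Eventually.of_forall fun x => ?_)
  simp only [heatKernel_sub_comm (β * t) x z, mul_comm]

/-- Fubini's theorem for a marginal of the Doob transform. -/
theorem integral_mul_bridgeDensity (B : BridgeData β T M g ρ₀) {t : ℝ} (ht : t ∈ Ioc 0 T)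
    {F b : Space d → ℝ} (hF : Continuous F)
    (hslice : ∀ z, Integrable fun x => F x * (backwardFlow g β T t x * heatKernel (β * t) (x - z)))
    (hle : ∀ z, ∫ x, |F x| * (backwardFlow g β T t x * heatKernel (β * t) (x - z))
      ≤ b z * backwardFlow g β T 0 z) (hb : Integrable fun z => b z * ρ₀ z) :
    Integrable (fun x => F x * bridgeDensity g ρ₀ β T t x) ∧
    ∫ x, F x * bridgeDensity g ρ₀ β T t x = ∫ z, initialRatio g ρ₀ β T z *
      ∫ x, F x * (backwardFlow g β T t x * heatKernel (β * t) (x - z)) ∧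
    Integrable fun z => initialRatio g ρ₀ β T z *
      ∫ x, F x * (backwardFlow g β T t x * heatKernel (β * t) (x - z)) := by
  have hbt := mul_pos B.β_pos ht.1
  have hu := B.continuous_flow t
  have hG := continuous_heatKernel (d := d) (β * t)
  have hnn : ∀ x z, 0 ≤ backwardFlow g β T t x * heatKernel (β * t) (x - z) := fun x z =>
    mul_nonneg (B.flow_pos t x).le (heatKernel_nonneg hbt.le _)
  have hmeas : AEStronglyMeasurable (fun p : Space d × Space d =>
      F p.1 * (backwardFlow g β T t p.1 * heatKernel (β * t) (p.1 - p.2))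
        * initialRatio g ρ₀ β T p.2) (volume.prod volume) := by
    refine AEStronglyMeasurable.mul (Continuous.aestronglyMeasurable (by fun_prop)) ?_
    exact B.aestronglyMeasurable_ratio.comp_snd
  have hint : Integrable (fun p : Space d × Space d =>
      F p.1 * (backwardFlow g β T t p.1 * heatKernel (β * t) (p.1 - p.2))
        * initialRatio g ρ₀ β T p.2) (volume.prod volume) := by
    rw [integrable_prod_iff' hmeas]
    refine ⟨Eventually.of_forall fun z => (hslice z).mul_const (initialRatio g ρ₀ β T z), ?_⟩
    refine hb.mono' hmeas.norm.prod_swap.integral_prod_right' (Eventually.of_forall fun z => ?_)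
    rw [Real.norm_of_nonneg (integral_nonneg fun x => norm_nonneg _)]
    have h1 : ∀ x, ‖F x * (backwardFlow g β T t x * heatKernel (β * t) (x - z))
        * initialRatio g ρ₀ β T z‖ = |F x| * (backwardFlow g β T t x * heatKernel (β * t) (x - z))
          * initialRatio g ρ₀ β T z := fun x => by
      rw [norm_mul, norm_mul, Real.norm_of_nonneg (hnn x z), Real.norm_of_nonneg (B.ratio_nonneg z),
        Real.norm_eq_abs]
    simp only [h1]
    rw [integral_mul_const]
    refine (mul_le_mul_of_nonneg_right (hle z) (B.ratio_nonneg z)).trans (le_of_eq ?_)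
    rw [mul_assoc, mul_comm (backwardFlow g β T 0 z), B.ratio_mul_flow]
  have h2 : ∀ x, F x * bridgeDensity g ρ₀ β T t x = ∫ z,
      F x * (backwardFlow g β T t x * heatKernel (β * t) (x - z)) * initialRatio g ρ₀ β T z := by
    intro x
    rw [B.bridgeDensity_eq_integral ht.1, ← integral_const_mul]
    simp only [mul_assoc]
  simp only [h2]
  have h3 : ∀ z, ∫ x, F x * (backwardFlow g β T t x * heatKernel (β * t) (x - z))
      * initialRatio g ρ₀ β T z = initialRatio g ρ₀ β T z *
        ∫ x, F x * (backwardFlow g β T t x * heatKernel (β * t) (x - z)) := fun z => by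
    rw [integral_mul_const, mul_comm]
  refine ⟨hint.integral_prod_left, ?_, ?_⟩
  · rw [integral_integral_swap hint]
    simp only [h3]
  · simpa only [h3] using hint.integral_prod_right

theorem bridgeDensity_nonneg (B : BridgeData β T M g ρ₀) {t : ℝ} (ht : 0 ≤ t) (x : Space d) :
    0 ≤ bridgeDensity g ρ₀ β T t x := by
  rcases ht.eq_or_lt with rfl | ht
  · simpa [bridgeDensity] using B.density.nonneg x
  · rw [B.bridgeDensity_eq_integral ht]
    exact integral_nonneg fun z => mul_nonneg (mul_nonneg (B.flow_pos t x).le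
      (heatKernel_nonneg (mul_pos B.β_pos ht).le _)) (B.ratio_nonneg z)

/-- Second moments of the transition density. By the inequality `a b ≤ a log a + e^b`, they are
controlled by the entropy of the transition density relative to the heat kernel. -/
theorem second_moment_kernel_le (B : BridgeData β T M g ρ₀) {t : ℝ} (ht : t ∈ Ioc 0 T)
    (z : Space d) :
    Integrable (fun x => ‖x‖ ^ 2 * (backwardFlow g β T t x * heatKernel (β * t) (x - z))) ∧
    ∫ x, ‖x‖ ^ 2 * (backwardFlow g β T t x * heatKernel (β * t) (x - z))
      ≤ (2 * ‖z‖ ^ 2 + 16 * β * T * (Real.log M - Real.log (backwardFlow g β T 0 z)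
        + 2 ^ (d / 2 : ℝ))) * backwardFlow g β T 0 z := by
  have hbt := mul_pos B.β_pos ht.1
  have hβ := B.β_pos
  have hT := B.T_pos
  obtain ⟨hi, hI⟩ := B.integral_flow_mul_kernel ht z
  set u₀ := backwardFlow g β T 0 z with hu₀
  have hu₀pos : 0 < u₀ := B.flow_pos 0 z
  set D := Real.log M - Real.log u₀ with hD
  have hpt : ∀ x, ‖x‖ ^ 2 * (backwardFlow g β T t x * heatKernel (β * t) (x - z))
      ≤ (2 * ‖z‖ ^ 2 + 16 * β * T * D) * (backwardFlow g β T t x * heatKernel (β * t) (x - z))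
        + 16 * β * T * u₀ * 2 ^ (d / 2 : ℝ) * heatKernel (2 * (β * t)) (x - z) := by
    intro x
    have hu := B.flow_pos t x
    have hk := heatKernel_nonneg hbt.le (x - z)
    have h1 : ‖x‖ ^ 2 ≤ 2 * ‖z‖ ^ 2 + 2 * ‖x - z‖ ^ 2 := by
      have := norm_add_le z (x - z)
      rw [add_sub_cancel] at this
      have h2 : ‖x‖ ^ 2 ≤ (‖z‖ + ‖x - z‖) ^ 2 := by gcongr
      nlinarith [sq_nonneg (‖z‖ - ‖x - z‖)]
    set b := ‖x - z‖ ^ 2 / (8 * (β * T)) with hb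
    have h2 : b * backwardFlow g β T t x ≤ D * backwardFlow g β T t x + u₀ * Real.exp b := by
      -- the inequality `a b ≤ a log a + e^b` with `a = u t x / u 0 z`, where `log a ≤ D`
      set a := backwardFlow g β T t x / u₀ with ha
      have hapos : 0 < a := by positivity
      have h3 := Real.add_one_le_exp (b - Real.log a)
      rw [Real.exp_sub, Real.exp_log hapos, le_div_iff₀ hapos] at h3
      have h4 : Real.log a ≤ D := by
        rw [ha, Real.log_div hu.ne' hu₀pos.ne', hD]
        linarith [Real.log_le_log hu (B.flow_le t x)]
      have h5 : a * u₀ = backwardFlow g β T t x := div_mul_cancel₀ _ hu₀pos.ne'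
      have h6 : b * a ≤ D * a + Real.exp b := by nlinarith
      calc b * backwardFlow g β T t x = (b * a) * u₀ := by rw [← h5]; ring
        _ ≤ (D * a + Real.exp b) * u₀ := by gcongr
        _ = _ := by rw [← h5]; ring
    -- `b` is small enough for `e^b` to consume only half of the decay of the heat kernel
    have h7 : Real.exp b * heatKernel (β * t) (x - z)
        ≤ 2 ^ (d / 2 : ℝ) * heatKernel (2 * (β * t)) (x - z) := by
      rw [← exp_mul_heatKernel hbt]
      have h9 : b ≤ ‖x - z‖ ^ 2 / (8 * (β * t)) := by
        rw [hb]
        have := ht.2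
        gcongr
      gcongr
    have h8 : ‖x - z‖ ^ 2 = 8 * (β * T) * b := by rw [hb]; field_simp
    calc ‖x‖ ^ 2 * (backwardFlow g β T t x * heatKernel (β * t) (x - z))
        ≤ (2 * ‖z‖ ^ 2 + 2 * ‖x - z‖ ^ 2)
          * (backwardFlow g β T t x * heatKernel (β * t) (x - z)) := by gcongr
      _ = 2 * ‖z‖ ^ 2 * (backwardFlow g β T t x * heatKernel (β * t) (x - z))
          + 16 * β * T * ((b * backwardFlow g β T t x) * heatKernel (β * t) (x - z)) := by
          rw [h8]; ring
      _ ≤ 2 * ‖z‖ ^ 2 * (backwardFlow g β T t x * heatKernel (β * t) (x - z))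
          + 16 * β * T * ((D * backwardFlow g β T t x + u₀ * Real.exp b)
            * heatKernel (β * t) (x - z)) := by gcongr
      _ = (2 * ‖z‖ ^ 2 + 16 * β * T * D) * (backwardFlow g β T t x * heatKernel (β * t) (x - z))
          + 16 * β * T * u₀ * (Real.exp b * heatKernel (β * t) (x - z)) := by ring
      _ ≤ (2 * ‖z‖ ^ 2 + 16 * β * T * D) * (backwardFlow g β T t x * heatKernel (β * t) (x - z))
          + 16 * β * T * u₀ * (2 ^ (d / 2 : ℝ) * heatKernel (2 * (β * t)) (x - z)) := by gcongr
      _ = _ := by ring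
  have hR : Integrable fun x => (2 * ‖z‖ ^ 2 + 16 * β * T * D)
      * (backwardFlow g β T t x * heatKernel (β * t) (x - z))
        + 16 * β * T * u₀ * 2 ^ (d / 2 : ℝ) * heatKernel (2 * (β * t)) (x - z) :=
    (hi.const_mul _).add ((integrable_heatKernel_sub (by positivity) z).const_mul _)
  have hL : Integrable fun x =>
      ‖x‖ ^ 2 * (backwardFlow g β T t x * heatKernel (β * t) (x - z)) := by
    refine hR.mono' ?_ (Eventually.of_forall fun x => ?_)
    · have := B.continuous_flow t
      have := continuous_heatKernel (d := d) (β * t)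
      exact Continuous.aestronglyMeasurable (by fun_prop)
    · rw [Real.norm_of_nonneg]
      · exact hpt x
      · exact mul_nonneg (by positivity)
          (mul_nonneg (B.flow_pos t x).le (heatKernel_nonneg hbt.le _))
  refine ⟨hL, (integral_mono hL hR hpt).trans (le_of_eq ?_)⟩
  rw [integral_add (hi.const_mul _) ((integrable_heatKernel_sub (by positivity) z).const_mul _),
    integral_const_mul, integral_const_mul, hI, integral_heatKernel_sub (by positivity)]
  ring

/-- The marginals of the Doob transform are probability densities with finite second moment. -/
theorem isP2Density_bridgeDensity (B : BridgeData β T M g ρ₀) {t : ℝ} (ht : t ∈ Icc 0 T) :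
    IsP2Density (bridgeDensity g ρ₀ β T t) := by
  rcases ht.1.eq_or_lt with rfl | ht0
  · have : bridgeDensity g ρ₀ β T 0 = ρ₀ := by funext x; simp [bridgeDensity]
    rw [this]
    exact B.density
  have ht' : t ∈ Ioc 0 T := ⟨ht0, ht.2⟩
  have hk := fun z => B.integral_flow_mul_kernel ht' z
  have h1 := B.integral_mul_bridgeDensity ht' (F := fun _ => 1) (b := fun _ => 1) continuous_const
    (fun z => by simpa using (hk z).1) (fun z => by simp [(hk z).2])
    (by simpa using B.density.integrable)
  have hm := fun z => B.second_moment_kernel_le ht' z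
  have h2 := B.integral_mul_bridgeDensity ht' (F := fun x => ‖x‖ ^ 2) (by fun_prop)
    (fun z => (hm z).1) (fun z => by simpa using (hm z).2) (by
      have := ((B.density.second_moment.const_mul 2).add ((B.density.integrable.const_mul
        (16 * β * T * (Real.log M + 2 ^ (d / 2 : ℝ)))).sub
        (B.integrable_log_flow_mul.const_mul (16 * β * T))))
      refine this.congr (Eventually.of_forall fun z => ?_)
      simp only [Pi.add_apply, Pi.sub_apply]
      ring)
  refine ⟨B.bridgeDensity_nonneg ht.1, by simpa using h1.1, ?_, h2.1⟩
  have h3 := h1.2.1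
  simp only [one_mul, (hk _).2, B.ratio_mul_flow] at h3
  rw [h3, B.density.integral_eq_one]

end BridgeData

/-! ### The action of the bridge -/

/-- The difference between the heat flow of `g log g` and `u log u`, where `u` is the heat flow of
`g`; up to the normalization by `u`, it is the entropy of the Doob transform of Brownian motion
started at `z` relative to that Brownian motion. -/
noncomputable def bridgeEntropy (g : Space d → ℝ) (β T : ℝ) (z : Space d) : ℝ :=
  (∫ x, g x * Real.log (g x) * heatKernel (β * T) (x - z))
    - backwardFlow g β T 0 z * Real.log (backwardFlow g β T 0 z)

namespace BridgeData

variable {β T M : ℝ} {g ρ₀ : Space d → ℝ}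

theorem trivialPerturbation (B : BridgeData β T M g ρ₀) :
    Perturbation β T M g (fun _ => 0) (T / 2) (fun _ => 0) 0 where
  cont_g := B.cont_g
  bound_g := B.bound_g
  pos_g := B.pos_g
  cont_f := continuous_const
  f_le x := by simpa using (B.flow_pos (T / 2) x).le
  lt := half_lt_self B.T_pos
  smooth := contDiff_const
  le_half t := by simp
  eq_zero t _ := rfl
  deriv_le t := by simp

/-- The function `u log u` is bounded along the flow, and `(∂ₜ + β Δ) (u log u) = β ‖∇u‖² / u`.
Integrating along Brownian motion gives the energy estimate. -/
theorem lintegral_energy_le (B : BridgeData β T M g ρ₀) (z : Space d) :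
    0 ≤ bridgeEntropy g β T z ∧
    ∫⁻ p, ENNReal.ofReal (β * ‖gradient (backwardFlow g β T p.1) p.2‖ ^ 2
      / backwardFlow g β T p.1 p.2) ∂brownianMeasure T β z
      ≤ ENNReal.ofReal (bridgeEntropy g β T z) := by
  have hβ := B.β_pos
  have hT := B.T_pos
  have hM := B.M_pos
  have hbT := mul_pos hβ hT
  have P := B.trivialPerturbation
  have hfm := isFiniteMeasure_brownianMeasure (T := T) hβ z
  have hfm' : IsFiniteMeasure (densityMeasure volume fun x : Space d =>
      heatKernel (β * T) (x - z)) :=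
    isFiniteMeasure_densityMeasure (integrable_heatKernel_sub hbT z)
  have hW := isWeakFlow_brownianMeasure hT hβ z
  set m := brownianMeasure T β z with hm
  set ν := densityMeasure volume fun x : Space d => heatKernel (β * T) (x - z) with hν
  set e : ℕ → ℝ := fun n => 1 / ((n : ℝ) + 1) with he
  have he0 : Tendsto e atTop (𝓝 0) := tendsto_one_div_add_atTop_nhds_zero_nat
  have hepos : ∀ n, 0 < e n := fun n => by simp only [he]; positivity
  have hele : ∀ n, e n ≤ 1 := fun n => by
    simp only [he]
    rw [div_le_one (by positivity)]; simp
  -- the flow with its horizon moved by `e n` and lifted by `e n`: its logarithm is bounded and it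
  -- is smooth up to the time `T`
  set N : ℕ → ℝ → Space d → ℝ := fun n =>
    perturbedFlow g (fun _ => 0) β T (T / 2) (fun _ => 0) (e n) (e n) with hN
  have hNpos : ∀ n t x, 0 < N n t x := fun n t x =>
    P.perturbedFlow_pos hβ (hepos n).le (hepos n).le t x
  have hNle : ∀ n t x, N n t x ≤ 2 * M + 1 := fun n t x =>
    (P.perturbedFlow_le hβ (hepos n).le (e n) t x).trans (by linarith [hele n])
  have hNge : ∀ n t x, e n ≤ N n t x := fun n t x => by
    have := P.le_perturbedFlow hβ (hepos n).le (e n) t x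
    have h2 := backwardFlow_pos B.cont_g B.bound_g B.pos_g β (T + e n) t x
    simp only [hN]
    linarith
  have hNlim : ∀ t x, Tendsto (fun n => N n t x) atTop (𝓝 (backwardFlow g β T t x)) := by
    intro t x
    have := P.tendsto_perturbedFlow he0 he0 t x
    simpa [hN, perturbedFlow] using this
  set h : ℝ → ℝ := fun r => r * Real.log r with hh
  have hhc : Continuous h := Real.continuous_mul_log
  obtain ⟨K, hK⟩ := (isCompact_Icc (a := (0 : ℝ)) (b := 2 * M + 1)).exists_bound_of_continuousOn
    hhc.continuousOn
  have hK' : ∀ n t x, |h (N n t x)| ≤ K := fun n t x => hK _ ⟨(hNpos n t x).le, hNle n t x⟩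
  have hNd : ∀ n, ∀ t < T + e n, ∀ x,
      ContDiffAt ℝ 2 (fun p : ℝ × Space d => N n p.1 p.2) (t, x) := fun n t ht x =>
    P.contDiffAt_perturbedFlow hβ (hepos n) ht x
  have hhd : ∀ r : ℝ, 0 < r → ContDiffAt ℝ 2 h r := fun r hr =>
    contDiffAt_id.mul (Real.contDiffAt_log.2 hr.ne')
  have hd1 : ∀ r : ℝ, 0 < r → deriv h r = Real.log r + 1 := fun r hr =>
    Real.deriv_mul_log hr.ne'
  have hd2 : ∀ r : ℝ, deriv (deriv h) r = r⁻¹ := fun r => Real.deriv2_mul_log r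
  -- `N` solves the backward heat equation, so that only the second derivative `1 / r` of `r log r`
  -- contributes
  have hop : ∀ n, ∀ t < T, ∀ x, heatOp β (fun s y => h (N n s y)) t x
      = β * ‖gradient (N n t) x‖ ^ 2 / N n t x := by
    intro n t ht x
    have ht' : t < T + e n := by linarith [hepos n]
    rw [heatOp_comp β (hhd _ (hNpos n t x)) (hNd n t ht' x),
      P.heatOp_perturbedFlow hβ (hepos n) ht' x, hd2]
    simp only [deriv_const]
    ring
  have hgr : ∀ n, ∀ t < T, ∀ x, ‖gradient (N n t) x‖
      ≤ 2 * (2 ^ (d / 2 : ℝ) * M / √(β * e n)) := fun n t ht x =>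
    P.norm_gradient_perturbedFlow_le hβ (hepos n) ht x
  have hweak : ∀ n, (∫ x, h (N n T x) ∂ν) - h (N n 0 z)
      = ∫ p, β * ‖gradient (N n p.1) p.2‖ ^ 2 / N n p.1 p.2 ∂m := by
    intro n
    set L := 2 * (2 ^ (d / 2 : ℝ) * M / √(β * e n)) with hL
    have hL0 : 0 ≤ L := by positivity
    have hK0 : 0 ≤ K := (abs_nonneg _).trans (hK' n 0 0)
    have hepn := hepos n
    have hlogb : ∀ t x, |Real.log (N n t x) + 1|
        ≤ |Real.log (e n)| + |Real.log (2 * M + 1)| + 1 := by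
      intro t x
      have h1 := Real.log_le_log (hepos n) (hNge n t x)
      have h2 := Real.log_le_log (hNpos n t x) (hNle n t x)
      rw [abs_le]
      constructor
      · linarith [neg_abs_le (Real.log (e n)), abs_nonneg (Real.log (2 * M + 1))]
      · linarith [le_abs_self (Real.log (2 * M + 1)), abs_nonneg (Real.log (e n))]
    have hA : 0 ≤ (|Real.log (e n)| + |Real.log (2 * M + 1)| + 1) * L := by positivity
    have hBn : 0 ≤ β * L ^ 2 / e n := by positivity
    have := hW.equation_of_bounded hT (hepos n) (f := fun t x => h (N n t x))
      (C := K + (|Real.log (e n)| + |Real.log (2 * M + 1)| + 1) * L + β * L ^ 2 / e n)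
      (fun t ht x => ContDiffAt.comp (t, x) (hhd _ (hNpos n t x)) (hNd n t ht.2 x))
      (fun t _ x => (hK' n t x).trans (by linarith))
      (fun t ht x => by
        rw [gradient_comp ((hhd _ (hNpos n t x)).differentiableAt two_ne_zero)
          ((contDiffAt_space (hNd n t (by linarith [ht.2]) x)).differentiableAt two_ne_zero),
          hd1 _ (hNpos n t x), norm_smul]
        have h1 := mul_le_mul (hlogb t x) (hgr n t ht.2 x) (norm_nonneg _) (by positivity)
        rw [Real.norm_eq_abs]
        linarith)
      (fun t ht x => by
        rw [hop n t ht.2 x, abs_of_nonneg (by have := hNpos n t x; positivity)]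
        have h1 := hgr n t ht.2 x
        have h2 := hNge n t x
        have h3 : β * ‖gradient (N n t) x‖ ^ 2 / N n t x ≤ β * L ^ 2 / e n := by gcongr
        linarith)
    rw [integral_dirac] at this
    rw [this]
    refine integral_congr_ae ?_
    filter_upwards [hW.time_mem] with p hp
    rw [backwardOp_eq, hop n p.1 hp.2 p.2, inner_zero_left, add_zero]
  have hE : bridgeEntropy g β T z = (∫ x, h (backwardFlow g β T T x) ∂ν)
      - h (backwardFlow g β T 0 z) := by
    rw [hν, integral_densityMeasure (integrable_heatKernel_sub hbT z).aestronglyMeasurable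
      (Eventually.of_forall fun x => heatKernel_nonneg hbT.le _)]
    simp only [backwardFlow_self, bridgeEntropy, hh]
  have hlim : Tendsto (fun n => ∫ p, β * ‖gradient (N n p.1) p.2‖ ^ 2 / N n p.1 p.2 ∂m) atTop
      (𝓝 (bridgeEntropy g β T z)) := by
    simp only [← hweak]
    rw [hE]
    refine Tendsto.sub ?_ ((hhc.tendsto _).comp (hNlim 0 z))
    refine tendsto_integral_of_dominated_convergence (fun _ => K) (fun n => ?_)
      (integrable_const K) (fun n => Eventually.of_forall fun x => hK' n T x)
      (Eventually.of_forall fun x => (hhc.tendsto _).comp (hNlim T x))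
    have : Continuous fun x => N n T x :=
      P.continuous_perturbedFlow.comp (by fun_prop : Continuous fun x : Space d => (T, x))
    exact (hhc.comp this).aestronglyMeasurable
  have hnn : ∀ n (p : ℝ × Space d), 0 ≤ β * ‖gradient (N n p.1) p.2‖ ^ 2 / N n p.1 p.2 :=
    fun n p => by have := hNpos n p.1 p.2; positivity
  refine ⟨ge_of_tendsto' hlim fun n => integral_nonneg (hnn n), ?_⟩
  have hgm : ∀ n, AEStronglyMeasurable
      (fun p : ℝ × Space d => β * ‖gradient (N n p.1) p.2‖ ^ 2 / N n p.1 p.2) m := by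
    intro n
    refine aestronglyMeasurable_of_continuousOn_time hW.time_mem ?_
    have h1 : ContinuousOn (fun p : ℝ × Space d => gradient (N n p.1) p.2) (Ioo 0 T ×ˢ univ) :=
      (contDiffOn_gradient (n := 1) (isOpen_Ioo.prod isOpen_univ) fun p hp =>
        (hNd n p.1 (by linarith [hp.1.2, hepos n]) p.2).contDiffWithinAt).continuousOn
    exact (continuousOn_const.mul (h1.norm.pow 2)).div P.continuous_perturbedFlow.continuousOn
      fun p _ => (hNpos n p.1 p.2).ne'
  -- the integrands are nonnegative, but the gradient may blow up at the time `T`, so that Fatou's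
  -- lemma replaces dominated convergence
  have hfatou : ∫⁻ p, ENNReal.ofReal (β * ‖gradient (backwardFlow g β T p.1) p.2‖ ^ 2
      / backwardFlow g β T p.1 p.2) ∂m ≤ liminf (fun n => ∫⁻ p, ENNReal.ofReal
        (β * ‖gradient (N n p.1) p.2‖ ^ 2 / N n p.1 p.2) ∂m) atTop := by
    refine le_trans (lintegral_mono_ae ?_) (lintegral_liminf_le' fun n => ?_)
    · filter_upwards [hW.time_mem] with p hp
      refine le_of_eq (Tendsto.liminf_eq ?_).symm
      refine (ENNReal.continuous_ofReal.tendsto _).comp ?_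
      have h1 : Tendsto (fun n => gradient (N n p.1) p.2) atTop
          (𝓝 (gradient (backwardFlow g β T p.1) p.2)) := by
        have h2 := tendsto_gradient_backwardFlow B.cont_g B.bound_g hβ hp.2 p.2 he0
        refine h2.congr fun n => ?_
        simp only [hN]
        rw [(P.gradient_perturbedFlow hβ (hepos n).le hp.2 p.2).2]
        simp
      exact ((h1.norm.pow 2).const_mul β).div (hNlim p.1 p.2) (B.flow_pos p.1 p.2).ne'
    · exact (hgm n).aemeasurable.ennreal_ofReal
  refine hfatou.trans (le_of_eq (Tendsto.liminf_eq ?_))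
  refine ((ENNReal.continuous_ofReal.tendsto _).comp hlim).congr' ?_
  filter_upwards with n
  simp only [Function.comp_apply]
  have hint : Integrable
      (fun p : ℝ × Space d => β * ‖gradient (N n p.1) p.2‖ ^ 2 / N n p.1 p.2) m := by
    refine (integrable_const (β * (2 * (2 ^ (d / 2 : ℝ) * M / √(β * e n))) ^ 2 / e n)).mono'
      (hgm n) ?_
    filter_upwards [hW.time_mem] with p hp
    rw [Real.norm_of_nonneg (hnn n p)]
    have h1 := hgr n p.1 hp.2 p.2
    have h2 := hNge n p.1 p.2
    have h3 := hepos n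
    gcongr
  exact ofReal_integral_eq_lintegral_ofReal hint (Eventually.of_forall (hnn n))

end BridgeData

instance (d : ℕ) (T : ℝ) : SigmaFinite (slab d T) := by
  unfold slab; infer_instance

/-- The Hopf–Cole transform of the backward flow of `g`. -/
noncomputable def hopfCole (g : Space d → ℝ) (β T t : ℝ) (x : Space d) : ℝ :=
  2 * β * Real.log (backwardFlow g β T t x)

theorem isOpen_slabSet (d : ℕ) (T : ℝ) : IsOpen (Ioo 0 T ×ˢ univ : Set (ℝ × Space d)) :=
  isOpen_Ioo.prod isOpen_univ

namespace BridgeData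

variable {β T M : ℝ} {g ρ₀ : Space d → ℝ}

theorem contDiffOn_flow (B : BridgeData β T M g ρ₀) (n : ℕ) :
    ContDiffOn ℝ n (fun p : ℝ × Space d => backwardFlow g β T p.1 p.2) (Ioo 0 T ×ˢ univ) :=
  fun p hp => (contDiffAt_backwardFlow B.cont_g B.bound_g B.β_pos hp.1.2 p.2 n).contDiffWithinAt

theorem contDiffOn_hopfCole (B : BridgeData β T M g ρ₀) (n : ℕ) :
    ContDiffOn ℝ n (fun p : ℝ × Space d => hopfCole g β T p.1 p.2) (Ioo 0 T ×ˢ univ) :=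
  fun p hp => contDiffWithinAt_const.mul
    ((B.contDiffOn_flow n p hp).log (B.flow_pos p.1 p.2).ne')

theorem differentiableAt_flow (B : BridgeData β T M g ρ₀) {t : ℝ} (ht : t < T) (x : Space d) :
    DifferentiableAt ℝ (backwardFlow g β T t) x :=
  (contDiffAt_space (contDiffAt_backwardFlow B.cont_g B.bound_g B.β_pos ht x 2)).differentiableAt
    two_ne_zero

theorem gradient_hopfCole (B : BridgeData β T M g ρ₀) {t : ℝ} (ht : t < T) (x : Space d) :
    gradient (hopfCole g β T t) x
      = (2 * β / backwardFlow g β T t x) • gradient (backwardFlow g β T t) x := by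
  have hp := B.flow_pos t x
  have h1 : DifferentiableAt ℝ (fun r => 2 * β * Real.log r) (backwardFlow g β T t x) :=
    (Real.differentiableAt_log hp.ne').const_mul _
  unfold hopfCole
  rw [gradient_comp (h := fun r => 2 * β * Real.log r) (f := backwardFlow g β T t) h1
    (B.differentiableAt_flow ht x)]
  simp [div_eq_mul_inv]

theorem contDiffOn_bridgeDensity (B : BridgeData β T M g ρ₀) (n : ℕ) :
    ContDiffOn ℝ n (fun p : ℝ × Space d => bridgeDensity g ρ₀ β T p.1 p.2) (Ioo 0 T ×ˢ univ) := by
  have h1 : ContDiffOn ℝ n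
      (fun p : ℝ × Space d => heatFlow (initialRatio g ρ₀ β T) (β * p.1) p.2) 
      (Ioo 0 T ×ˢ univ) := by
    refine (B.heatGrowth_ratio.contDiffOn_heatFlow n).comp
      (f := fun p : ℝ × Space d => (β * p.1, p.2)) (by fun_prop) fun p hp => ?_
    have hβ := B.β_pos
    have hT := B.T_pos
    refine ⟨⟨mul_pos hβ hp.1.1, ?_⟩, mem_univ _⟩
    have : 4 * (1 / (4 * (β * T))) * (β * p.1) = p.1 / T := by field_simp
    rw [this, div_lt_one hT]
    exact hp.1.2
  exact ((B.contDiffOn_flow n).mul h1).congr fun p hp => bridgeDensity_eq hp.1.1.ne' p.2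

theorem aestronglyMeasurable_bridgeDensity (B : BridgeData β T M g ρ₀) :
    AEStronglyMeasurable (fun p : ℝ × Space d => bridgeDensity g ρ₀ β T p.1 p.2) (slab d T) :=
  aestronglyMeasurable_of_continuousOn_time (ae_slab_time_mem d T)
    (B.contDiffOn_bridgeDensity 0).continuousOn

theorem continuousOn_gradient_flow (B : BridgeData β T M g ρ₀) :
    ContinuousOn (fun p : ℝ × Space d => gradient (backwardFlow g β T p.1) p.2)
      (Ioo 0 T ×ˢ univ) :=
  (contDiffOn_gradient (n := 1) (isOpen_slabSet d T) (B.contDiffOn_flow 2)).continuousOn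

theorem continuousOn_gradient_hopfCole (B : BridgeData β T M g ρ₀) :
    ContinuousOn (fun p : ℝ × Space d => gradient (hopfCole g β T p.1) p.2) (Ioo 0 T ×ˢ univ) :=
  (contDiffOn_gradient (n := 1) (isOpen_slabSet d T) (B.contDiffOn_hopfCole 2)).continuousOn

/-- The terminal marginal of the bridge integrates `log g`: the negative part of `g log g` is
controlled by Jensen's inequality. -/
theorem terminal_log (B : BridgeData β T M g ρ₀) :
    Integrable (fun x => Real.log (g x) * bridgeDensity g ρ₀ β T T x) ∧
    (Integrable fun z => initialRatio g ρ₀ β T z * bridgeEntropy g β T z) ∧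
    ∫ z, initialRatio g ρ₀ β T z * bridgeEntropy g β T z
      = (∫ x, Real.log (g x) * bridgeDensity g ρ₀ β T T x)
        - ∫ z, Real.log (backwardFlow g β T 0 z) * ρ₀ z := by
  have hT : T ∈ Ioc 0 T := ⟨B.T_pos, le_rfl⟩
  have hbT := mul_pos B.β_pos B.T_pos
  have hgc : Continuous fun x => Real.log (g x) := B.cont_g.log fun x => (B.pos_g x).ne'
  have hg0 : backwardFlow g β T T = g := funext (backwardFlow_self g β T)
  obtain ⟨K, hK⟩ := (isCompact_Icc (a := (0 : ℝ)) (b := M)).exists_bound_of_continuousOn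
    Real.continuous_mul_log.continuousOn
  have hgM : ∀ x, g x ≤ M := fun x => (le_abs_self _).trans (B.bound_g x)
  have hi : ∀ z, Integrable fun x =>
      Real.log (g x) * (backwardFlow g β T T x * heatKernel (β * T) (x - z)) := by
    intro z
    rw [hg0]
    refine ((integrable_heatKernel_sub hbT z).bdd_mul (c := K)
      (Real.continuous_mul_log.comp B.cont_g).aestronglyMeasurable
      (Eventually.of_forall fun x => hK _ ⟨(B.pos_g x).le, hgM x⟩)).congr
      (Eventually.of_forall fun x => ?_)
    simp only [Function.comp_apply]
    ring
  have heq : ∀ z, ∫ x, Real.log (g x) * (backwardFlow g β T T x * heatKernel (β * T) (x - z))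
      = ∫ x, g x * Real.log (g x) * heatKernel (β * T) (x - z) := by
    intro z
    rw [hg0]
    congr 1
    funext x
    ring
  have h := B.integral_mul_bridgeDensity hT (F := fun x => Real.log (g x))
    (b := fun z => 2 * |Real.log M| - Real.log (backwardFlow g β T 0 z)) hgc hi ?_ ?_
  · have hE : ∀ z, initialRatio g ρ₀ β T z * bridgeEntropy g β T z = initialRatio g ρ₀ β T z *
        (∫ x, Real.log (g x) * (backwardFlow g β T T x * heatKernel (β * T) (x - z)))
          - Real.log (backwardFlow g β T 0 z) * ρ₀ z := by
      intro z
      rw [heq, bridgeEntropy, ← B.ratio_mul_flow z]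
      ring
    refine ⟨h.1, ?_, ?_⟩
    · simp only [hE]
      exact h.2.2.sub B.integrable_log_flow_mul
    · simp only [hE]
      rw [integral_sub h.2.2 B.integrable_log_flow_mul, h.2.1]
  · intro z
    obtain ⟨h1, h2⟩ := B.integral_flow_mul_kernel hT z
    have h3 := (B.lintegral_energy_le z).1
    rw [bridgeEntropy, ← heq] at h3
    -- `log g` is bounded above, so that its absolute value is controlled by `-log g`; the integral
    -- of the latter is bounded by the nonnegativity of `bridgeEntropy`
    have hlog : ∀ x, |Real.log (g x)| ≤ 2 * |Real.log M| - Real.log (g x) := fun x => by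
      have h4 := Real.log_le_log (B.pos_g x) (hgM x)
      have h5 := le_abs_self (Real.log M)
      rw [abs_le]
      constructor <;> linarith [abs_nonneg (Real.log M)]
    have hR : Integrable fun x => 2 * |Real.log M| *
        (backwardFlow g β T T x * heatKernel (β * T) (x - z))
          - Real.log (g x) * (backwardFlow g β T T x * heatKernel (β * T) (x - z)) :=
      (h1.const_mul _).sub (hi z)
    have hnn : ∀ x, 0 ≤ backwardFlow g β T T x * heatKernel (β * T) (x - z) := fun x =>
      mul_nonneg (B.flow_pos T x).le (heatKernel_nonneg hbT.le _)
    calc ∫ x, |Real.log (g x)| * (backwardFlow g β T T x * heatKernel (β * T) (x - z))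
        ≤ ∫ x, (2 * |Real.log M| * (backwardFlow g β T T x * heatKernel (β * T) (x - z))
          - Real.log (g x) * (backwardFlow g β T T x * heatKernel (β * T) (x - z))) := by
          refine integral_mono_of_nonneg (Eventually.of_forall fun x =>
            mul_nonneg (abs_nonneg _) (hnn x)) hR (Eventually.of_forall fun x => ?_)
          simp only
          rw [← sub_mul]
          exact mul_le_mul_of_nonneg_right (hlog x) (hnn x)
      _ = 2 * |Real.log M| * backwardFlow g β T 0 z
          - ∫ x, Real.log (g x) * (backwardFlow g β T T x * heatKernel (β * T) (x - z)) := by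
          rw [integral_sub (h1.const_mul _) (hi z), integral_const_mul, h2]
      _ ≤ _ := by linarith
  · refine ((B.density.integrable.const_mul (2 * |Real.log M|)).sub
      B.integrable_log_flow_mul).congr (Eventually.of_forall fun z => ?_)
    simp only [Pi.sub_apply]
    ring

/-- The action of the bridge is at most the increment of the potential: the energy estimates
from the single starting points are integrated against the initial ratio. -/
theorem lintegral_action_le (B : BridgeData β T M g ρ₀) :
    ∫⁻ p, ENNReal.ofReal (1 / 2 * ‖gradient (hopfCole g β T p.1) p.2‖ ^ 2
      * bridgeDensity g ρ₀ β T p.1 p.2) ∂slab d T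
      ≤ ENNReal.ofReal (2 * β * ((∫ x, Real.log (g x) * bridgeDensity g ρ₀ β T T x)
        - ∫ z, Real.log (backwardFlow g β T 0 z) * ρ₀ z)) := by
  have hβ := B.β_pos
  have hT := B.T_pos
  obtain ⟨-, hEi, hEq⟩ := B.terminal_log
  set D : ℝ × Space d → ℝ := fun p => β * ‖gradient (backwardFlow g β T p.1) p.2‖ ^ 2
      / backwardFlow g β T p.1 p.2 with hD
  set G : ℝ × Space d → Space d → ℝ := fun p z => heatKernel (β * p.1) (p.2 - z) with hG
  have hDnn : ∀ p, 0 ≤ D p := fun p => by have := B.flow_pos p.1 p.2; simp only [hD]; positivity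
  have hDm : AEStronglyMeasurable D (slab d T) :=
    aestronglyMeasurable_of_continuousOn_time (ae_slab_time_mem d T)
      ((continuousOn_const.mul (B.continuousOn_gradient_flow.norm.pow 2)).div
        (B.contDiffOn_flow 0).continuousOn fun p _ => (B.flow_pos p.1 p.2).ne')
  have hGm : Measurable fun q : (ℝ × Space d) × Space d => G q.1 q.2 :=
    measurable_heatKernel.comp
      (by fun_prop : Measurable fun q : (ℝ × Space d) × Space d => (β * q.1.1, q.1.2 - q.2))
  have hpt : ∀ᵐ p ∂slab d T, ENNReal.ofReal (1 / 2 * ‖gradient (hopfCole g β T p.1) p.2‖ ^ 2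
      * bridgeDensity g ρ₀ β T p.1 p.2) = ∫⁻ z, ENNReal.ofReal (2 * β * D p)
        * (ENNReal.ofReal (G p z) * ENNReal.ofReal (initialRatio g ρ₀ β T z)) := by
    filter_upwards [ae_slab_time_mem d T] with p hp
    have hbt := mul_pos hβ hp.1
    have hu := B.flow_pos p.1 p.2
    have hi : Integrable fun z => G p z * initialRatio g ρ₀ β T z := by
      refine B.heatGrowth_ratio.integrable_kernel hbt ?_ p.2
      have : 4 * (1 / (4 * (β * T))) * (β * p.1) = p.1 / T := by field_simp
      rw [this, div_lt_one hT]
      exact hp.2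
    rw [lintegral_const_mul' _ _ ENNReal.ofReal_ne_top]
    have h1 : ∫⁻ z, ENNReal.ofReal (G p z) * ENNReal.ofReal (initialRatio g ρ₀ β T z)
        = ENNReal.ofReal (heatFlow (initialRatio g ρ₀ β T) (β * p.1) p.2) := by
      rw [heatFlow_eq _ hbt, ofReal_integral_eq_lintegral_ofReal hi (Eventually.of_forall fun z =>
        mul_nonneg (heatKernel_nonneg hbt.le _) (B.ratio_nonneg z))]
      refine lintegral_congr fun z => ?_
      rw [ENNReal.ofReal_mul (heatKernel_nonneg hbt.le _)]
    rw [h1, ← ENNReal.ofReal_mul (by have := hDnn p; positivity), B.gradient_hopfCole hp.2,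
      bridgeDensity_eq hp.1.ne', norm_smul, Real.norm_of_nonneg (by positivity)]
    congr 1
    simp only [hD]
    field_simp
  rw [lintegral_congr_ae hpt, lintegral_lintegral_swap]
  · have hle : ∀ z, ∫⁻ p, ENNReal.ofReal (2 * β * D p)
        * (ENNReal.ofReal (G p z) * ENNReal.ofReal (initialRatio g ρ₀ β T z)) ∂slab d T
        ≤ ENNReal.ofReal (2 * β * (initialRatio g ρ₀ β T z * bridgeEntropy g β T z)) := by
      intro z
      have h1 := (B.lintegral_energy_le z).2
      rw [brownianMeasure, lintegral_densityMeasure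
        (measurable_heatKernel_slab β z).aestronglyMeasurable] at h1
      have h2 : ∀ p, ENNReal.ofReal (2 * β * D p)
          * (ENNReal.ofReal (G p z) * ENNReal.ofReal (initialRatio g ρ₀ β T z))
          = ENNReal.ofReal (2 * β * initialRatio g ρ₀ β T z)
            * (ENNReal.ofReal (heatKernel (β * p.1) (p.2 - z)) * ENNReal.ofReal (D p)) := by
        intro p
        rw [ENNReal.ofReal_mul (p := 2 * β) (by positivity),
          ENNReal.ofReal_mul (p := 2 * β) (by positivity)]
        simp only [hG]
        ring
      simp only [h2]
      rw [lintegral_const_mul' _ _ ENNReal.ofReal_ne_top, ← mul_assoc (2 * β),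
        ENNReal.ofReal_mul (mul_nonneg (by positivity) (B.ratio_nonneg z))]
      gcongr
    refine (lintegral_mono hle).trans (le_of_eq ?_)
    rw [← ofReal_integral_eq_lintegral_ofReal (hEi.const_mul _) (Eventually.of_forall fun z => ?_),
      integral_const_mul, hEq]
    exact mul_nonneg (by positivity) (mul_nonneg (B.ratio_nonneg z) (B.lintegral_energy_le z).1)
  · exact (((hDm.const_mul _).aemeasurable.ennreal_ofReal).comp_fst).mul
      (hGm.ennreal_ofReal.aemeasurable.mul
        (B.aestronglyMeasurable_ratio.aemeasurable.ennreal_ofReal.comp_snd))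

end BridgeData

/-! ### The Fokker–Planck equation of the bridge -/

theorem integrableOn_inv_sqrt (T : ℝ) (hT : 0 < T) :
    Integrable (fun t : ℝ => 1 / √(T - t)) (volume.restrict (Ioo 0 T)) := by
  have h1 : IntervalIntegrable (fun x : ℝ => x ^ (-(1 / 2) : ℝ)) volume 0 T :=
    intervalIntegral.intervalIntegrable_rpow' (by norm_num)
  have h2 := (h1.comp_sub_left T).symm
  simp only [sub_self, sub_zero] at h2
  rw [intervalIntegrable_iff_integrableOn_Ioo_of_le hT.le] at h2
  refine h2.congr ?_
  filter_upwards [ae_restrict_mem measurableSet_Ioo] with t ht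
  rw [Real.rpow_neg (sub_nonneg.2 ht.2.le), ← Real.sqrt_eq_rpow, one_div]

theorem continuous_gradient {φ : ℝ → Space d → ℝ}
    (hφ : ContDiff ℝ 2 (fun z : ℝ × Space d => φ z.1 z.2)) :
    Continuous (fun z : ℝ × Space d => gradient (φ z.1) z.2) :=
  continuousOn_univ.1 (contDiffOn_gradient (n := 1) isOpen_univ hφ.contDiffOn).continuousOn

theorem exists_bound_gradient {φ : ℝ → Space d → ℝ}
    (hφ : ContDiff ℝ 2 (fun z : ℝ × Space d => φ z.1 z.2))
    (hc : HasCompactSupport (fun z : ℝ × Space d => φ z.1 z.2)) :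
    ∃ C, ∀ t x, ‖gradient (φ t) x‖ ≤ C := by
  have h0 : HasCompactSupport (fun z : ℝ × Space d => gradient (φ z.1) z.2) := by
    refine HasCompactSupport.intro' hc.isCompact (isClosed_tsupport _) fun z hz => ?_
    have h1 : (fun z : ℝ × Space d => φ z.1 z.2) =ᶠ[𝓝 z] fun _ => 0 :=
      notMem_tsupport_iff_eventuallyEq.1 hz
    have h3 : φ z.1 =ᶠ[𝓝 z.2] fun _ => 0 :=
      ((by fun_prop : Continuous fun y : Space d => (z.1, y)).tendsto z.2).eventually h1
    rw [← norm_eq_zero, norm_gradient_eq, h3.fderiv_eq]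
    simp
  obtain ⟨C, hC⟩ := h0.exists_bound_of_continuous (continuous_gradient hφ)
  exact ⟨C, fun t x => hC (t, x)⟩

theorem integrable_slab_of_density {T : ℝ} {ρ : ℝ → Space d → ℝ}
    (hρ : ∀ t ∈ Icc 0 T, IsP2Density (ρ t))
    (hm : AEStronglyMeasurable (fun z : ℝ × Space d => ρ z.1 z.2) (slab d T)) :
    Integrable (fun z : ℝ × Space d => ρ z.1 z.2) (slab d T) := by
  rw [slab, integrable_prod_iff hm]
  constructor
  · filter_upwards [ae_restrict_mem measurableSet_Ioo] with t ht
    exact (hρ t ⟨ht.1.le, ht.2.le⟩).integrable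
  · refine (integrable_const (1 : ℝ)).congr ?_
    filter_upwards [ae_restrict_mem measurableSet_Ioo] with t ht
    have h := hρ t ⟨ht.1.le, ht.2.le⟩
    simp only [Real.norm_of_nonneg (h.nonneg _)]
    exact h.integral_eq_one.symm

theorem ae_slab_nonneg {T : ℝ} {ρ : ℝ → Space d → ℝ}
    (hρ : ∀ t ∈ Icc 0 T, IsP2Density (ρ t)) : ∀ᵐ z ∂slab d T, 0 ≤ ρ z.1 z.2 := by
  filter_upwards [ae_slab_time_mem d T] with z hz
  exact (hρ z.1 ⟨hz.1.le, hz.2.le⟩).nonneg z.2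

namespace BridgeData

variable {β T M : ℝ} {g ρ₀ : Space d → ℝ}

/-- The weak equation of Brownian motion, tested with `φ` times the backward flow of `g`. -/
theorem brownian_equation (B : BridgeData β T M g ρ₀) {φ : ℝ → Space d → ℝ}
    (hφ : ContDiff ℝ 2 (fun z : ℝ × Space d => φ z.1 z.2))
    (hc : HasCompactSupport (fun z : ℝ × Space d => φ z.1 z.2)) (z : Space d) :
    (∫ x, φ T x * (backwardFlow g β T T x * heatKernel (β * T) (x - z)))
        - φ 0 z * backwardFlow g β T 0 z
      = ∫ p, (backwardFlow g β T p.1 p.2 * heatOp β φ p.1 p.2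
        + 2 * β * inner ℝ (gradient (φ p.1) p.2) (gradient (backwardFlow g β T p.1) p.2))
          * heatKernel (β * p.1) (p.2 - z) ∂slab d T := by
  have hβ := B.β_pos
  have hT := B.T_pos
  have hM := B.M_pos
  have hbT := mul_pos hβ hT
  have hfm := isFiniteMeasure_brownianMeasure (T := T) hβ z
  have hfm' : IsFiniteMeasure (densityMeasure volume fun x : Space d =>
      heatKernel (β * T) (x - z)) :=
    isFiniteMeasure_densityMeasure (integrable_heatKernel_sub hbT z)
  have hW := isWeakFlow_brownianMeasure hT hβ z
  obtain ⟨C₀, hC₀⟩ := hc.exists_bound_of_continuous hφ.continuous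
  have hC₀ : ∀ t x, |φ t x| ≤ C₀ := fun t x => hC₀ (t, x)
  obtain ⟨C₁, hC₁⟩ := exists_bound_gradient hφ hc
  obtain ⟨C₂, hC₂⟩ := exists_bound_heatOp hφ hc β
  have h0 : 0 ≤ C₀ := (abs_nonneg _).trans (hC₀ 0 0)
  have h1 : 0 ≤ C₁ := (norm_nonneg _).trans (hC₁ 0 0)
  have h2 : 0 ≤ C₂ := (abs_nonneg _).trans (hC₂ 0 0)
  set e : ℕ → ℝ := fun n => 1 / ((n : ℝ) + 1) with he
  have he0 : Tendsto e atTop (𝓝 0) := tendsto_one_div_add_atTop_nhds_zero_nat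
  have hepos : ∀ n, 0 < e n := fun n => by simp only [he]; positivity
  -- the horizon is moved by `e n`, so that `φ u` is bounded with bounded derivatives
  set u : ℕ → ℝ → Space d → ℝ := fun n => backwardFlow g β (T + e n) with hu
  set A : ℝ := 2 ^ (d / 2 : ℝ) * M with hA
  have hA0 : 0 ≤ A := by positivity
  have hub : ∀ n t x, |u n t x| ≤ M := fun n t x => abs_backwardFlow_le B.bound_g _ _ _ _
  have hud : ∀ n, ∀ t < T + e n, ∀ x,
      ContDiffAt ℝ 2 (fun p : ℝ × Space d => u n p.1 p.2) (t, x) := fun n t ht x =>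
    contDiffAt_backwardFlow B.cont_g B.bound_g hβ ht x 2
  have hug : ∀ n, ∀ t < T, ∀ x, ‖gradient (u n t) x‖ ≤ A / √(β * (T + e n - t)) :=
    fun n t ht x => norm_gradient_backwardFlow_le B.cont_g B.bound_g hβ (by linarith [hepos n]) x
  have hop : ∀ n, ∀ t < T, ∀ x, heatOp β (fun s y => φ s y * u n s y) t x
      = u n t x * heatOp β φ t x + 2 * β * inner ℝ (gradient (φ t) x) (gradient (u n t) x) := by
    intro n t ht x
    have ht' : t < T + e n := by linarith [hepos n]
    rw [heatOp_mul β hφ.contDiffAt (hud n t ht' x)]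
    simp only [hu]
    rw [heatOp_backwardFlow B.cont_g B.bound_g hβ ht' x]
    ring
  have hopb : ∀ n, ∀ t < T, ∀ x, ∀ L, ‖gradient (u n t) x‖ ≤ L →
      |u n t x * heatOp β φ t x + 2 * β * inner ℝ (gradient (φ t) x) (gradient (u n t) x)|
        ≤ M * C₂ + 2 * β * (C₁ * L) := by
    intro n t ht x L hL
    refine (abs_add_le _ _).trans (add_le_add ?_ ?_)
    · rw [abs_mul]
      exact mul_le_mul (hub n t x) (hC₂ t x) (abs_nonneg _) hM.le
    · rw [abs_mul, abs_of_pos (show 0 < 2 * β by positivity)]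
      refine mul_le_mul_of_nonneg_left ((abs_real_inner_le_norm _ _).trans ?_) (by positivity)
      exact mul_le_mul (hC₁ t x) hL (norm_nonneg _) h1
  have hweak : ∀ n, (∫ x, φ T x * u n T x ∂densityMeasure volume fun x : Space d =>
      heatKernel (β * T) (x - z)) - φ 0 z * u n 0 z
      = ∫ p, (u n p.1 p.2 * heatOp β φ p.1 p.2
        + 2 * β * inner ℝ (gradient (φ p.1) p.2) (gradient (u n p.1) p.2))
          ∂brownianMeasure T β z := by
    intro n
    set L := A / √(β * e n) with hL
    have hL0 : 0 ≤ L := by positivity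
    have hugn : ∀ t < T, ∀ x, ‖gradient (u n t) x‖ ≤ L := fun t ht x => by
      refine (hug n t ht x).trans ?_
      have h3 : 0 < √(β * e n) := Real.sqrt_pos.2 (mul_pos hβ (hepos n))
      rw [hL]
      gcongr
      linarith
    have hX : 0 ≤ C₀ * M := by positivity
    have hY : 0 ≤ C₀ * L + M * C₁ := by positivity
    have hZ : 0 ≤ M * C₂ + 2 * β * (C₁ * L) := by positivity
    have := hW.equation_of_bounded hT (hepos n) (f := fun t x => φ t x * u n t x)
      (C := C₀ * M + (C₀ * L + M * C₁) + (M * C₂ + 2 * β * (C₁ * L)))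
      (fun t ht x => hφ.contDiffAt.mul (hud n t ht.2 x))
      (fun t _ x => by
        rw [abs_mul]
        have := mul_le_mul (hC₀ t x) (hub n t x) (abs_nonneg _) h0
        linarith)
      (fun t ht x => by
        rw [gradient_mul ((contDiffAt_space hφ.contDiffAt).differentiableAt two_ne_zero)
          ((contDiffAt_space (hud n t (by linarith [ht.2, hepos n]) x)).differentiableAt
            two_ne_zero)]
        refine (norm_add_le _ _).trans ?_
        rw [norm_smul, norm_smul, Real.norm_eq_abs, Real.norm_eq_abs]
        have h3 := mul_le_mul (hC₀ t x) (hugn t ht.2 x) (norm_nonneg _) h0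
        have h4 := mul_le_mul (hub n t x) (hC₁ t x) (norm_nonneg _) hM.le
        linarith)
      (fun t ht x => by
        rw [hop n t ht.2 x]
        have := hopb n t ht.2 x L (hugn t ht.2 x)
        linarith)
    rw [integral_dirac] at this
    rw [this]
    refine integral_congr_ae ?_
    filter_upwards [hW.time_mem] with p hp
    rw [backwardOp_eq, hop n p.1 hp.2 p.2, inner_zero_left, add_zero]
  have hgrad := continuous_gradient hφ
  have hheat := continuous_heatOp hφ β
  have hφT : ∀ t, Continuous (φ t) := fun t =>
    hφ.continuous.comp (by fun_prop : Continuous fun x : Space d => (t, x))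
  have hlimL : Tendsto (fun n => (∫ x, φ T x * u n T x ∂densityMeasure volume fun x : Space d =>
      heatKernel (β * T) (x - z)) - φ 0 z * u n 0 z) atTop
      (𝓝 ((∫ x, φ T x * backwardFlow g β T T x ∂densityMeasure volume fun x : Space d =>
      heatKernel (β * T) (x - z)) - φ 0 z * backwardFlow g β T 0 z)) := by
    refine Tendsto.sub ?_ ((tendsto_backwardFlow B.cont_g B.bound_g β T 0 z he0).const_mul _)
    refine tendsto_integral_of_dominated_convergence (fun _ => C₀ * M) (fun n => ?_)
      (integrable_const _) (fun n => Eventually.of_forall fun x => ?_)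
      (Eventually.of_forall fun x =>
        (tendsto_backwardFlow B.cont_g B.bound_g β T T x he0).const_mul _)
    · exact ((hφT T).mul (continuous_backwardFlow_space B.cont_g B.bound_g β (T + e n)
        T)).aestronglyMeasurable
    · rw [norm_mul]
      exact mul_le_mul (hC₀ T x) (hub n T x) (norm_nonneg _) h0
  have hlimR : Tendsto (fun n => ∫ p, (u n p.1 p.2 * heatOp β φ p.1 p.2
        + 2 * β * inner ℝ (gradient (φ p.1) p.2) (gradient (u n p.1) p.2))
          ∂brownianMeasure T β z) atTop
      (𝓝 (∫ p, (backwardFlow g β T p.1 p.2 * heatOp β φ p.1 p.2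
        + 2 * β * inner ℝ (gradient (φ p.1) p.2) (gradient (backwardFlow g β T p.1) p.2))
          ∂brownianMeasure T β z)) := by
    -- the gradients of the shifted flows are dominated by `(T - t)^{-1/2}`, which is integrable
    refine tendsto_integral_of_dominated_convergence
      (fun p => M * C₂ + 2 * β * (C₁ * (A / √β * (1 / √(T - p.1))))) (fun n => ?_) ?_
      (fun n => ?_) ?_
    · refine aestronglyMeasurable_of_continuousOn_time hW.time_mem ?_
      have h3 : ContDiffOn ℝ 2 (fun p : ℝ × Space d => u n p.1 p.2) (Ioo 0 T ×ˢ univ) :=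
        fun p hp => (hud n p.1 (by linarith [hp.1.2, hepos n]) p.2).contDiffWithinAt
      have h4 := (contDiffOn_gradient (n := 1) (isOpen_slabSet d T) h3).continuousOn
      exact (h3.continuousOn.mul hheat.continuousOn).add
        (continuousOn_const.mul (hgrad.continuousOn.inner h4))
    · refine (integrable_const _).add (((Integrable.const_mul ?_ _).const_mul _).const_mul _)
      rw [brownianMeasure, integrable_densityMeasure_iff
        (measurable_heatKernel_slab β z).aestronglyMeasurable (ae_heatKernel_slab_nonneg hβ z)]
      have hm : AEStronglyMeasurable (fun p : ℝ × Space d =>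
          heatKernel (β * p.1) (p.2 - z) • (1 / √(T - p.1))) (slab d T) :=
        ((measurable_heatKernel_slab β z).smul (by fun_prop)).aestronglyMeasurable
      rw [slab, integrable_prod_iff hm]
      constructor
      · filter_upwards [ae_restrict_mem measurableSet_Ioo] with t ht
        exact (integrable_heatKernel_sub (mul_pos hβ ht.1) z).smul_const (1 / √(T - t))
      · refine (integrableOn_inv_sqrt T hT).congr ?_
        filter_upwards [ae_restrict_mem measurableSet_Ioo] with t ht
        simp only [norm_smul, Real.norm_of_nonneg (heatKernel_nonneg (mul_pos hβ ht.1).le _)]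
        rw [integral_mul_const, integral_heatKernel_sub (mul_pos hβ ht.1) z, one_mul,
          Real.norm_of_nonneg (by positivity)]
    · filter_upwards [hW.time_mem] with p hp
      refine hopb n p.1 hp.2 p.2 _ ((hug n p.1 hp.2 p.2).trans ?_)
      have h3 : 0 < T - p.1 := sub_pos.2 hp.2
      rw [div_mul_div_comm, mul_one, ← Real.sqrt_mul hβ.le]
      have h4 : 0 < √(β * (T - p.1)) := Real.sqrt_pos.2 (mul_pos hβ h3)
      have h5 := (hepos n).le
      gcongr
      linarith
    · filter_upwards [hW.time_mem] with p hp
      exact ((tendsto_backwardFlow B.cont_g B.bound_g β T p.1 p.2 he0).mul_const _).add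
        ((tendsto_const_nhds.inner
          (tendsto_gradient_backwardFlow B.cont_g B.bound_g hβ hp.2 p.2 he0)).const_mul _)
  have hfin := tendsto_nhds_unique hlimL (hlimR.congr fun n => (hweak n).symm)
  rw [integral_densityMeasure (integrable_heatKernel_sub hbT z).aestronglyMeasurable
    (Eventually.of_forall fun x => heatKernel_nonneg hbT.le _), brownianMeasure,
    integral_densityMeasure (measurable_heatKernel_slab β z).aestronglyMeasurable
      (ae_heatKernel_slab_nonneg hβ z)] at hfin
  rw [← hfin]
  simp only [mul_assoc]

/-- The action of the bridge is finite. -/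
theorem integrable_action (B : BridgeData β T M g ρ₀) :
    Integrable (fun p : ℝ × Space d => 1 / 2 * ‖gradient (hopfCole g β T p.1) p.2‖ ^ 2
      * bridgeDensity g ρ₀ β T p.1 p.2) (slab d T) ∧
    ∫ p, 1 / 2 * ‖gradient (hopfCole g β T p.1) p.2‖ ^ 2
      * bridgeDensity g ρ₀ β T p.1 p.2 ∂slab d T
      ≤ 2 * β * ((∫ x, Real.log (g x) * bridgeDensity g ρ₀ β T T x)
        - ∫ z, Real.log (backwardFlow g β T 0 z) * ρ₀ z) := by
  have hm : AEStronglyMeasurable (fun p : ℝ × Space d =>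
      1 / 2 * ‖gradient (hopfCole g β T p.1) p.2‖ ^ 2 * bridgeDensity g ρ₀ β T p.1 p.2)
        (slab d T) :=
    aestronglyMeasurable_of_continuousOn_time (ae_slab_time_mem d T)
      ((continuousOn_const.mul (B.continuousOn_gradient_hopfCole.norm.pow 2)).mul
        (B.contDiffOn_bridgeDensity 0).continuousOn)
  have hnn : 0 ≤ᵐ[slab d T] fun p : ℝ × Space d =>
      1 / 2 * ‖gradient (hopfCole g β T p.1) p.2‖ ^ 2 * bridgeDensity g ρ₀ β T p.1 p.2 := by
    filter_upwards [ae_slab_time_mem d T] with p hp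
    have := B.bridgeDensity_nonneg hp.1.le p.2
    simp only [Pi.zero_apply]
    positivity
  have hle := B.lintegral_action_le
  have hi : Integrable (fun p : ℝ × Space d => 1 / 2 * ‖gradient (hopfCole g β T p.1) p.2‖ ^ 2
      * bridgeDensity g ρ₀ β T p.1 p.2) (slab d T) := by
    refine ⟨hm, ?_⟩
    rw [hasFiniteIntegral_iff_ofReal hnn]
    exact hle.trans_lt ENNReal.ofReal_lt_top
  refine ⟨hi, ?_⟩
  rw [← ofReal_integral_eq_lintegral_ofReal hi hnn] at hle
  refine (ENNReal.ofReal_le_ofReal_iff ?_).1 hle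
  obtain ⟨-, -, hEq⟩ := B.terminal_log
  rw [← hEq]
  have hβ := B.β_pos
  exact mul_nonneg (by positivity) (integral_nonneg fun z =>
    mul_nonneg (B.ratio_nonneg z) (B.lintegral_energy_le z).1)

end BridgeData

section FiniteAction

variable {T : ℝ} {ρ : ℝ → Space d → ℝ} {b : ℝ → Space d → Space d}

theorem integrable_smul_drift (hρ : ∀ t ∈ Icc 0 T, IsP2Density (ρ t))
    (hm : AEStronglyMeasurable (fun z : ℝ × Space d => ρ z.1 z.2) (slab d T))
    (hb : AEStronglyMeasurable (fun z : ℝ × Space d => b z.1 z.2) (slab d T))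
    (hA : Integrable (fun z : ℝ × Space d => 1 / 2 * ‖b z.1 z.2‖ ^ 2 * ρ z.1 z.2) (slab d T)) :
    Integrable (fun z : ℝ × Space d => ρ z.1 z.2 • b z.1 z.2) (slab d T) := by
  refine (((integrable_slab_of_density hρ hm).const_mul (1 / 2)).add hA).mono' (hm.smul hb) ?_
  filter_upwards [ae_slab_nonneg hρ] with z hz
  rw [norm_smul, Real.norm_of_nonneg hz]
  simp only [Pi.add_apply]
  nlinarith [mul_nonneg hz (sq_nonneg (‖b z.1 z.2‖ - 1))]

theorem integrable_backwardOp_mul (β : ℝ) (hρ : ∀ t ∈ Icc 0 T, IsP2Density (ρ t))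
    (hm : AEStronglyMeasurable (fun z : ℝ × Space d => ρ z.1 z.2) (slab d T))
    (hb : AEStronglyMeasurable (fun z : ℝ × Space d => b z.1 z.2) (slab d T))
    (hA : Integrable (fun z : ℝ × Space d => 1 / 2 * ‖b z.1 z.2‖ ^ 2 * ρ z.1 z.2) (slab d T))
    {φ : ℝ → Space d → ℝ} (hφ : ContDiff ℝ 2 (fun z : ℝ × Space d => φ z.1 z.2))
    (hc : HasCompactSupport (fun z : ℝ × Space d => φ z.1 z.2)) :
    Integrable (fun z : ℝ × Space d => backwardOp β b φ z.1 z.2 * ρ z.1 z.2) (slab d T) := by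
  obtain ⟨C₁, hC₁⟩ := exists_bound_gradient hφ hc
  obtain ⟨C₂, hC₂⟩ := exists_bound_heatOp hφ hc β
  refine (((integrable_slab_of_density hρ hm).const_mul C₂).add
    ((integrable_smul_drift hρ hm hb hA).norm.const_mul C₁)).mono'
    ((aestronglyMeasurable_backwardOp hb hφ).mul hm) ?_
  filter_upwards [ae_slab_nonneg hρ] with z hz
  rw [backwardOp_eq, norm_mul, Real.norm_of_nonneg hz]
  simp only [Pi.add_apply, norm_smul, Real.norm_of_nonneg hz]
  have h1 : ‖heatOp β φ z.1 z.2 + inner ℝ (b z.1 z.2) (gradient (φ z.1) z.2)‖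
      ≤ C₂ + ‖b z.1 z.2‖ * C₁ := by
    refine (norm_add_le _ _).trans (add_le_add (hC₂ _ _) ?_)
    exact (abs_real_inner_le_norm _ _).trans
      (mul_le_mul_of_nonneg_left (hC₁ _ _) (norm_nonneg _))
  calc _ ≤ (C₂ + ‖b z.1 z.2‖ * C₁) * ρ z.1 z.2 := mul_le_mul_of_nonneg_right h1 hz
    _ = _ := by ring

end FiniteAction

theorem divergence_smul_gradient {w u : Space d → ℝ} {x : Space d} (hw : ContDiffAt ℝ 2 w x)
    (hu : ContDiffAt ℝ 2 u x) :
    divergence (fun y => w y • gradient u y) x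
      = w x * Laplacian.laplacian u x + inner ℝ (gradient w x) (gradient u x) := by
  have hu' : DifferentiableAt ℝ (fderiv ℝ u) x :=
    (hu.fderiv_right (m := 1) le_rfl).differentiableAt one_ne_zero
  have hg : DifferentiableAt ℝ (gradient u) x := by
    have : gradient u = fun y => (InnerProductSpace.toDual ℝ (Space d)).symm (fderiv ℝ u y) := rfl
    rw [this]
    exact (InnerProductSpace.toDual ℝ (Space d)).symm.differentiableAt.comp x hu'
  have hwd := hw.differentiableAt two_ne_zero
  rw [divergence, laplacian_eq_sum_fderiv, inner_eq_sum, Finset.mul_sum, ← Finset.sum_add_distrib]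
  refine Finset.sum_congr rfl fun i _ => ?_
  rw [fderiv_fun_smul hwd hg]
  have h1 : fderiv ℝ (gradient u) x (EuclideanSpace.single i 1) i
      = fderiv ℝ (fderiv ℝ u) x (EuclideanSpace.single i 1) (EuclideanSpace.single i 1) := by
    have h2 : fderiv ℝ (fun y => gradient u y i) x (EuclideanSpace.single i 1)
        = fderiv ℝ (gradient u) x (EuclideanSpace.single i 1) i := by
      have h3 := (EuclideanSpace.proj (𝕜 := ℝ) i).hasFDerivAt.comp x hg.hasFDerivAt
      have h4 := h3.fderiv
      have h5 : (⇑(EuclideanSpace.proj (𝕜 := ℝ) i) ∘ gradient u) = fun y => gradient u y i := rfl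
      rw [h5] at h4
      rw [h4]
      rfl
    rw [← h2]
    simp only [gradient_apply]
    rw [fderiv_clm_apply hu' (differentiableAt_const _)]
    simp
  simp [h1, gradient_apply, smul_eq_mul]

namespace BridgeData

variable {β T M : ℝ} {g ρ₀ : Space d → ℝ}

theorem aestronglyMeasurable_drift (B : BridgeData β T M g ρ₀) : AEStronglyMeasurable
    (fun p : ℝ × Space d => gradient (hopfCole g β T p.1) p.2) (slab d T) :=
  aestronglyMeasurable_of_continuousOn_time (ae_slab_time_mem d T) B.continuousOn_gradient_hopfCole

/-- The bridge solves the Fokker–Planck equation with drift the gradient of the Hopf–Cole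
transform: the weak equations of Brownian motion from the single starting points are integrated
against the initial ratio. -/
theorem solvesWeakly (B : BridgeData β T M g ρ₀) :
    SolvesFokkerPlanckWeakly T β (bridgeDensity g ρ₀ β T)
      (fun t => gradient (hopfCole g β T t)) := by
  intro φ hφ hc
  have hβ := B.β_pos
  have hT := B.T_pos
  have hbT := mul_pos hβ hT
  have hTm : T ∈ Ioc 0 T := ⟨hT, le_rfl⟩
  obtain ⟨C₀, hC₀⟩ := hc.exists_bound_of_continuous hφ.continuous
  have hC₀ : ∀ t x, |φ t x| ≤ C₀ := fun t x => hC₀ (t, x)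
  have hφc : ∀ t, Continuous (φ t) := fun t =>
    hφ.continuous.comp (by fun_prop : Continuous fun x : Space d => (t, x))
  set f₀ := initialRatio g ρ₀ β T with hf₀
  set Ψ : ℝ × Space d → ℝ := fun p => backwardFlow g β T p.1 p.2 * heatOp β φ p.1 p.2
    + 2 * β * inner ℝ (gradient (φ p.1) p.2) (gradient (backwardFlow g β T p.1) p.2) with hΨ
  have hΨm : AEStronglyMeasurable Ψ (slab d T) :=
    aestronglyMeasurable_of_continuousOn_time (ae_slab_time_mem d T)
      (((B.contDiffOn_flow 0).continuousOn.mul (continuous_heatOp hφ β).continuousOn).add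
        (continuousOn_const.mul
          ((continuous_gradient hφ).continuousOn.inner B.continuousOn_gradient_flow)))
  have hsl : ∀ p : ℝ × Space d, p.1 ∈ Ioo 0 T →
      Integrable fun z => heatKernel (β * p.1) (p.2 - z) * f₀ z := fun p hp => by
    refine B.heatGrowth_ratio.integrable_kernel (mul_pos hβ hp.1) ?_ p.2
    have : 4 * (1 / (4 * (β * T))) * (β * p.1) = p.1 / T := by field_simp
    rw [this, div_lt_one hT]
    exact hp.2
  have hop : ∀ p : ℝ × Space d, p.1 ∈ Ioo 0 T →
      backwardOp β (fun t => gradient (hopfCole g β T t)) φ p.1 p.2 * bridgeDensity g ρ₀ β T p.1 p.2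
        = Ψ p * heatFlow f₀ (β * p.1) p.2 := by
    intro p hp
    have hu := B.flow_pos p.1 p.2
    rw [backwardOp_eq, B.gradient_hopfCole hp.2, bridgeDensity_eq hp.1.ne', real_inner_smul_left,
      real_inner_comm]
    simp only [hΨ, hf₀]
    field_simp
  have hopi := integrable_backwardOp_mul (ρ := bridgeDensity g ρ₀ β T)
    (b := fun t => gradient (hopfCole g β T t)) β (fun _ ht => B.isP2Density_bridgeDensity ht)
    B.aestronglyMeasurable_bridgeDensity B.aestronglyMeasurable_drift B.integrable_action.1 hφ hc
  have hGm : Measurable fun q : (ℝ × Space d) × Space d => heatKernel (β * q.1.1) (q.1.2 - q.2) :=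
    measurable_heatKernel.comp
      (by fun_prop : Measurable fun q : (ℝ × Space d) × Space d => (β * q.1.1, q.1.2 - q.2))
  have hm : AEStronglyMeasurable (fun q : (ℝ × Space d) × Space d =>
      Ψ q.1 * (heatKernel (β * q.1.1) (q.1.2 - q.2) * f₀ q.2)) ((slab d T).prod volume) :=
    hΨm.comp_fst.mul (hGm.aestronglyMeasurable.mul B.aestronglyMeasurable_ratio.comp_snd)
  -- the inner integral over `z` restores the bridge density, so that the finite action of the
  -- bridge justifies the use of Fubini's theorem
  have hint : Integrable (fun q : (ℝ × Space d) × Space d =>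
      Ψ q.1 * (heatKernel (β * q.1.1) (q.1.2 - q.2) * f₀ q.2)) ((slab d T).prod volume) := by
    rw [integrable_prod_iff hm]
    constructor
    · filter_upwards [ae_slab_time_mem d T] with p hp
      exact (hsl p hp).const_mul (Ψ p)
    · refine hopi.norm.congr ?_
      filter_upwards [ae_slab_time_mem d T] with p hp
      have hw : ∀ z, 0 ≤ heatKernel (β * p.1) (p.2 - z) * f₀ z := fun z =>
        mul_nonneg (heatKernel_nonneg (mul_pos hβ hp.1).le _) (B.ratio_nonneg z)
      simp only [norm_mul (Ψ p), Real.norm_of_nonneg (hw _)]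
      rw [hop p hp, norm_mul, integral_const_mul, heatFlow_eq _ (mul_pos hβ hp.1),
        Real.norm_of_nonneg (integral_nonneg hw)]
  have hterm := B.integral_mul_bridgeDensity hTm (F := φ T) (b := fun _ => C₀) (hφc T)
    (fun z => (B.integral_flow_mul_kernel hTm z).1.bdd_mul (hφc T).aestronglyMeasurable
      (Eventually.of_forall (hC₀ T)))
    (fun z => by
      obtain ⟨h1, h2⟩ := B.integral_flow_mul_kernel hTm z
      rw [← h2, ← integral_const_mul]
      have hnn : ∀ x, 0 ≤ backwardFlow g β T T x * heatKernel (β * T) (x - z) := fun x =>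
        mul_nonneg (B.flow_pos T x).le (heatKernel_nonneg hbT.le _)
      exact integral_mono_of_nonneg (Eventually.of_forall fun x =>
        mul_nonneg (abs_nonneg _) (hnn x)) (h1.const_mul _)
        (Eventually.of_forall fun x => mul_le_mul_of_nonneg_right (hC₀ T x) (hnn x)))
    (B.density.integrable.const_mul _)
  have hinit : Integrable fun z => φ 0 z * ρ₀ z :=
    B.density.integrable.bdd_mul (hφc 0).aestronglyMeasurable (Eventually.of_forall (hC₀ 0))
  have h0 : bridgeDensity g ρ₀ β T 0 = ρ₀ := by funext x; simp [bridgeDensity]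
  rw [h0, hterm.2.1, ← integral_sub hterm.2.2 hinit]
  have hR : ∫ p, backwardOp β (fun t => gradient (hopfCole g β T t)) φ p.1 p.2
      * bridgeDensity g ρ₀ β T p.1 p.2 ∂slab d T
      = ∫ p, (∫ z, Ψ p * (heatKernel (β * p.1) (p.2 - z) * f₀ z)) ∂slab d T := by
    refine integral_congr_ae ?_
    filter_upwards [ae_slab_time_mem d T] with p hp
    rw [hop p hp, integral_const_mul, heatFlow_eq _ (mul_pos hβ hp.1)]
  rw [hR, integral_integral_swap hint]
  refine integral_congr_ae (Eventually.of_forall fun z => ?_)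
  simp only
  have h1 := B.brownian_equation hφ hc z
  have h2 : ∫ p, Ψ p * (heatKernel (β * p.1) (p.2 - z) * f₀ z) ∂slab d T
      = f₀ z * ∫ p, Ψ p * heatKernel (β * p.1) (p.2 - z) ∂slab d T := by
    rw [← integral_const_mul]
    congr 1
    funext p
    ring
  rw [h2, ← h1, mul_sub, ← B.ratio_mul_flow z]
  ring

/-! ### Classical solutions -/

theorem continuous_hopfCole (B : BridgeData β T M g ρ₀) :
    Continuous fun p : ℝ × Space d => hopfCole g β T p.1 p.2 := by
  have h1 : Continuous fun p : ℝ × Space d => backwardFlow g β T p.1 p.2 :=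
    (continuous_backwardFlow B.cont_g B.bound_g β).comp
      (by fun_prop : Continuous fun p : ℝ × Space d => (T, p.1, p.2))
  exact continuous_const.mul (h1.log fun p => (B.flow_pos p.1 p.2).ne')

/-- The Hamilton–Jacobi equation in terms of `∂ₜ + β Δ`. -/
theorem heatOp_hopfCole (B : BridgeData β T M g ρ₀) {t : ℝ} (ht : t < T) (x : Space d) :
    heatOp β (hopfCole g β T) t x = -(1 / 2 * ‖gradient (hopfCole g β T t) x‖ ^ 2) := by
  have h := heatOp_log β (contDiffAt_backwardFlow B.cont_g B.bound_g B.β_pos ht x 2)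
    (B.flow_pos t x)
  rw [heatOp_backwardFlow B.cont_g B.bound_g B.β_pos ht x] at h
  unfold hopfCole
  rw [h]
  ring

theorem solvesHamiltonJacobi (B : BridgeData β T M g ρ₀) {V : Space d → ℝ}
    (hV : ∀ x, 2 * β * Real.log (g x) = -V x) :
    SolvesHamiltonJacobi T β V (hopfCole g β T) where
  continuousOn := B.continuous_hopfCole.continuousOn
  regular := B.contDiffOn_hopfCole 2
  equation t ht x := by
    have h := B.heatOp_hopfCole ht.2 x
    simp only [heatOp] at h
    linarith
  terminal x := by
    rw [hopfCole, backwardFlow_self, hV]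

theorem solvesClassically (B : BridgeData β T M g ρ₀) :
    SolvesFokkerPlanckClassically T β (bridgeDensity g ρ₀ β T)
      (fun t => gradient (hopfCole g β T t)) where
  regular := B.contDiffOn_bridgeDensity 2
  drift_regular := contDiffOn_gradient (n := 1) (isOpen_slabSet d T) (B.contDiffOn_hopfCole 2)
  equation t ht x := by
    have hβ := B.β_pos
    have hT := B.T_pos
    set f₀ := initialRatio g ρ₀ β T with hf₀
    set u : ℝ → Space d → ℝ := backwardFlow g β T with hu
    set w : ℝ → Space d → ℝ := fun s y => heatFlow f₀ (β * s) y with hw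
    have hsT : 4 * (1 / (4 * (β * T))) * (β * t) < 1 := by
      have : 4 * (1 / (4 * (β * T))) * (β * t) = t / T := by field_simp
      rw [this, div_lt_one hT]
      exact ht.2
    have hbt := mul_pos hβ ht.1
    have hu2 : ∀ y, ContDiffAt ℝ 2 (fun p : ℝ × Space d => u p.1 p.2) (t, y) := fun y =>
      contDiffAt_backwardFlow B.cont_g B.bound_g hβ ht.2 y 2
    have hw2 : ∀ y, ContDiffAt ℝ 2 (fun p : ℝ × Space d => w p.1 p.2) (t, y) := fun y => by
      have h1 := (B.heatGrowth_ratio.contDiffOn_heatFlow 2).contDiffAt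
        ((isOpen_heatDomain _).mem_nhds (x := (β * t, y)) ⟨⟨hbt, hsT⟩, mem_univ _⟩)
      exact ContDiffAt.comp (f := fun p : ℝ × Space d => (β * p.1, p.2)) (t, y) h1 (by fun_prop)
    have e1 : (fun s => bridgeDensity g ρ₀ β T s x) =ᶠ[𝓝 t] fun s => u s x * w s x := by
      filter_upwards [isOpen_Ioo.mem_nhds ht] with s hs using bridgeDensity_eq hs.1.ne' x
    have e2 : bridgeDensity g ρ₀ β T t = fun y => u t y * w t y :=
      funext fun y => bridgeDensity_eq ht.1.ne' y
    -- the flux `ρ ∇Φ` is `2β w ∇u`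
    have e3 : (fun y => bridgeDensity g ρ₀ β T t y • gradient (hopfCole g β T t) y)
        = fun y => (2 * β * w t y) • gradient (u t) y := by
      funext y
      have := B.flow_pos t y
      rw [e2, B.gradient_hopfCole ht.2, smul_smul]
      congr 1
      simp only [hu]
      field_simp
    have hut := (contDiffAt_time (hu2 x)).differentiableAt two_ne_zero
    have hwt := (contDiffAt_time (hw2 x)).differentiableAt two_ne_zero
    have hwe : deriv (fun s => w s x) t = β * Laplacian.laplacian (w t) x := by
      have h1 : HasDerivAt (fun r : ℝ => β * r) β t := by
        simpa using (hasDerivAt_id t).const_mul β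
      have h2 := B.heatGrowth_ratio.hasDerivAt_heatFlow hbt hsT x
      have h3 := (h2.comp t h1).deriv
      have h4 : w t = heatFlow f₀ (β * t) := rfl
      rw [h4, ← B.heatGrowth_ratio.deriv_heatFlow_eq_laplacian hbt hsT, h2.deriv, mul_comm]
      exact h3
    have hue : deriv (fun s => u s x) t = -(β * Laplacian.laplacian (u t) x) := by
      have h1 := heatOp_backwardFlow B.cont_g B.bound_g hβ ht.2 x
      rw [heatOp] at h1
      linarith
    have hws := contDiffAt_space (hw2 x)
    have hdiv : divergence (fun y => (2 * β * w t y) • gradient (u t) y) x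
        = 2 * β * (w t x * Laplacian.laplacian (u t) x
          + inner ℝ (gradient (w t) x) (gradient (u t) x)) := by
      rw [divergence_smul_gradient (w := fun y => 2 * β * w t y) (contDiffAt_const.mul hws)
        (contDiffAt_space (hu2 x))]
      have h1 : gradient (fun y => 2 * β * w t y) x = (2 * β) • gradient (w t) x := by
        ext i
        rw [gradient_apply, fderiv_const_mul (hws.differentiableAt two_ne_zero), PiLp.smul_apply,
          gradient_apply]
        rfl
      rw [h1, real_inner_smul_left]
      ring
    rw [e1.deriv_eq, deriv_fun_mul hut hwt, e3, hdiv, e2,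
      laplacian_mul (contDiffAt_space (hu2 x)) hws, hwe, hue,
      real_inner_comm (gradient (w t) x) (gradient (u t) x)]
    ring

end BridgeData

/-! ### Verification -/

section Admissible

variable {T β : ℝ} {V ρ₀ q : Space d → ℝ} {ρ : ℝ → Space d → ℝ} {v : ℝ → Space d → Space d}

theorem IsTrial.terminal_density (h : IsTrial T V ρ₀ ρ v q) (hT : 0 < T) : IsP2Density q := by
  have := h.density T ⟨hT.le, le_rfl⟩
  rwa [show ρ T = q from funext h.terminal] at this

theorem IsAdmissible.isWeakFlow (h : IsAdmissible T β V ρ₀ ρ v q) (hT : 0 < T) :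
    IsWeakFlow T β (densityMeasure (slab d T) fun z => ρ z.1 z.2) v (densityMeasure volume ρ₀)
      (densityMeasure volume q) := by
  have h0 := ae_slab_nonneg h.density
  have hρ0 := h.density 0 ⟨le_rfl, hT.le⟩
  rw [show ρ 0 = ρ₀ from funext h.initial] at hρ0
  have hq := h.terminal_density hT
  refine ⟨?_, ?_, fun φ hφ hc => ?_⟩
  · rw [ae_densityMeasure_iff h.density_measurable]
    filter_upwards [ae_slab_time_mem d T] with z hz _ using hz
  · rw [integrable_densityMeasure_iff h.density_measurable h0]
    exact integrable_smul_drift h.density h.density_measurable h.drift_measurable h.finite_action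
  · rw [integral_densityMeasure h.density_measurable h0,
      integral_densityMeasure hq.integrable.aestronglyMeasurable (Eventually.of_forall hq.nonneg),
      integral_densityMeasure hρ0.integrable.aestronglyMeasurable (Eventually.of_forall hρ0.nonneg),
      ← h.fokkerPlanck φ hφ hc]
    simp only [h.terminal, h.initial]

/-- The bound of weak duality for admissible triples and perturbed potentials. The terminal value of
such a potential is `-V`, so that the terminal term joins the action to give the cost. -/
theorem IsAdmissible.verification {M S C' : ℝ} {g f : Space d → ℝ} {η : ℝ → ℝ}
    (h : IsAdmissible T β V ρ₀ ρ v q) (B : BridgeData β T M g ρ₀)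
    (hV : ∀ x, 2 * β * Real.log (g x) = -V x) (P : Perturbation β T M g f S η C') :
    0 ≤ cost T V ρ v q
      + (∫ x, 2 * β * Real.log (perturbedFlow g f β T S η 0 0 0 x) * ρ₀ x)
      + (∫ z, 2 * β * (deriv η z.1 * backwardFlow f β (S + 0) z.1 z.2)
        / perturbedFlow g f β T S η 0 0 z.1 z.2 * ρ z.1 z.2 ∂slab d T) ∧
    ∫⁻ z, ENNReal.ofReal (1 / 2 * ‖v z.1 z.2 - gradient (fun y =>
      2 * β * Real.log (perturbedFlow g f β T S η 0 0 z.1 y)) z.2‖ ^ 2)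
        ∂densityMeasure (slab d T) (fun z => ρ z.1 z.2)
      ≤ ENNReal.ofReal (cost T V ρ v q
      + (∫ x, 2 * β * Real.log (perturbedFlow g f β T S η 0 0 0 x) * ρ₀ x)
      + (∫ z, 2 * β * (deriv η z.1 * backwardFlow f β (S + 0) z.1 z.2)
        / perturbedFlow g f β T S η 0 0 z.1 z.2 * ρ z.1 z.2 ∂slab d T)) := by
  have hT := B.T_pos
  have hβ := B.β_pos
  have h0 := ae_slab_nonneg h.density
  have hq := h.terminal_density hT
  have hqm := hq.integrable.aestronglyMeasurable
  have hqn : ∀ᵐ x, 0 ≤ q x := Eventually.of_forall hq.nonneg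
  have hρm := B.density.integrable.aestronglyMeasurable
  have hρn : ∀ᵐ x, 0 ≤ ρ₀ x := Eventually.of_forall B.density.nonneg
  have hW := h.isWeakFlow hT
  have i1 := isFiniteMeasure_densityMeasure
    (integrable_slab_of_density h.density h.density_measurable)
  have i2 := isFiniteMeasure_densityMeasure B.density.integrable
  have i3 := isFiniteMeasure_densityMeasure hq.integrable
  have hb : Integrable (fun z : ℝ × Space d => ‖v z.1 z.2‖ ^ 2)
      (densityMeasure (slab d T) fun z => ρ z.1 z.2) := by
    rw [integrable_densityMeasure_iff h.density_measurable h0]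
    refine (h.finite_action.const_mul 2).congr (Eventually.of_forall fun z => ?_)
    simp only [smul_eq_mul]
    ring
  have hlog : ∀ x, Real.log (g x) = -(1 / (2 * β)) * V x := fun x => by
    have := hV x
    field_simp
    linarith
  have h₁ : Integrable (fun x => Real.log (g x)) (densityMeasure volume q) := by
    rw [integrable_densityMeasure_iff hqm hqn]
    refine (h.finite_potential.const_mul (-(1 / (2 * β)))).congr (Eventually.of_forall fun x => ?_)
    simp only [smul_eq_mul, hlog]
    ring
  have h₀ : Integrable (fun x => Real.log (backwardFlow g β T 0 x)) (densityMeasure volume ρ₀) := by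
    rw [integrable_densityMeasure_iff hρm hρn]
    simpa only [smul_eq_mul, mul_comm] using B.integrable_log_flow_mul
  have hvb := P.verificationBound hβ hT hW hb h₁ h₀
  have hterm : ∀ x, 2 * β * Real.log (perturbedFlow g f β T S η 0 0 T x) = -V x := fun x => by
    rw [perturbedFlow, P.eq_zero T P.lt.le, add_zero, add_zero, zero_mul, add_zero,
      backwardFlow_self, hV]
  have hkey : (∫ z, 1 / 2 * ‖v z.1 z.2‖ ^ 2 ∂densityMeasure (slab d T) fun z => ρ z.1 z.2)
      - ((∫ x, 2 * β * Real.log (perturbedFlow g f β T S η 0 0 T x) ∂densityMeasure volume q)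
        - (∫ x, 2 * β * Real.log (perturbedFlow g f β T S η 0 0 0 x) ∂densityMeasure volume ρ₀)
        - ∫ z, 2 * β * (deriv η z.1 * backwardFlow f β (S + 0) z.1 z.2)
          / perturbedFlow g f β T S η 0 0 z.1 z.2 ∂densityMeasure (slab d T) fun z => ρ z.1 z.2)
      = cost T V ρ v q
      + (∫ x, 2 * β * Real.log (perturbedFlow g f β T S η 0 0 0 x) * ρ₀ x)
      + (∫ z, 2 * β * (deriv η z.1 * backwardFlow f β (S + 0) z.1 z.2)
        / perturbedFlow g f β T S η 0 0 z.1 z.2 * ρ z.1 z.2 ∂slab d T) := by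
    rw [integral_densityMeasure h.density_measurable h0,
      integral_densityMeasure h.density_measurable h0, integral_densityMeasure hqm hqn,
      integral_densityMeasure hρm hρn, cost]
    simp only [hterm, neg_mul, integral_neg]
    ring
  exact ⟨hkey ▸ hvb.nonneg, hkey ▸ hvb.gap⟩

end Admissible

/-- The optimal cost. -/
noncomputable def bridgeCost (g ρ₀ : Space d → ℝ) (β T : ℝ) : ℝ :=
  -∫ x, hopfCole g β T 0 x * ρ₀ x

namespace BridgeData

variable {β T M : ℝ} {g ρ₀ V : Space d → ℝ}

theorem integrable_hopfCole_mul (B : BridgeData β T M g ρ₀) :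
    Integrable fun x => hopfCole g β T 0 x * ρ₀ x := by
  simpa only [hopfCole, mul_assoc] using B.integrable_log_flow_mul.const_mul (2 * β)

/-- Weak duality: the cost of an admissible triple exceeds the dual value by at least the
weighted distance of its drift from the feedback `∇Φ`. -/
theorem bridgeCost_le (B : BridgeData β T M g ρ₀) (hV : ∀ x, 2 * β * Real.log (g x) = -V x)
    {ρ : ℝ → Space d → ℝ} {v : ℝ → Space d → Space d} {q : Space d → ℝ}
    (h : IsAdmissible T β V ρ₀ ρ v q) :
    bridgeCost g ρ₀ β T ≤ cost T V ρ v q ∧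
    ∫⁻ z, ENNReal.ofReal (1 / 2 * ‖v z.1 z.2 - gradient (hopfCole g β T z.1) z.2‖ ^ 2)
      ∂densityMeasure (slab d T) (fun z => ρ z.1 z.2)
      ≤ ENNReal.ofReal (cost T V ρ v q - bridgeCost g ρ₀ β T) := by
  obtain ⟨h1, h2⟩ := h.verification B hV B.trivialPerturbation
  have e1 : ∀ t : ℝ, (fun y : Space d => 2 * β * Real.log
      (perturbedFlow g (fun _ => 0) β T (T / 2) (fun _ => 0) 0 0 t y)) = hopfCole g β T t := by
    intro t
    funext y
    simp [perturbedFlow, hopfCole]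
  have e2 : ∀ y : Space d, 2 * β * Real.log
      (perturbedFlow g (fun _ => 0) β T (T / 2) (fun _ => 0) 0 0 0 y) = hopfCole g β T 0 y :=
    fun y => congrFun (e1 0) y
  simp only [e1, e2, deriv_const, zero_mul, mul_zero, zero_div, integral_zero, add_zero] at h1 h2
  have e3 : cost T V ρ v q + ∫ x, hopfCole g β T 0 x * ρ₀ x
      = cost T V ρ v q - bridgeCost g ρ₀ β T := by
    rw [bridgeCost, sub_neg_eq_add]
  rw [e3] at h1 h2
  exact ⟨by linarith, h2⟩

theorem isAdmissible_bridge (B : BridgeData β T M g ρ₀)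
    (hV : ∀ x, 2 * β * Real.log (g x) = -V x) :
    IsAdmissible T β V ρ₀ (bridgeDensity g ρ₀ β T) (fun t => gradient (hopfCole g β T t))
      (bridgeDensity g ρ₀ β T T) where
  density _ ht := B.isP2Density_bridgeDensity ht
  density_measurable := B.aestronglyMeasurable_bridgeDensity
  drift_measurable := B.aestronglyMeasurable_drift
  initial x := by simp [bridgeDensity]
  terminal x := rfl
  finite_action := B.integrable_action.1
  finite_potential := by
    refine (B.terminal_log.1.const_mul (-(2 * β))).congr (Eventually.of_forall fun x => ?_)
    have := hV x
    simp only
    linear_combination (-bridgeDensity g ρ₀ β T T x) * this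
  fokkerPlanck := B.solvesWeakly

theorem cost_bridge_le (B : BridgeData β T M g ρ₀) (hV : ∀ x, 2 * β * Real.log (g x) = -V x) :
    cost T V (bridgeDensity g ρ₀ β T) (fun t => gradient (hopfCole g β T t))
      (bridgeDensity g ρ₀ β T T) ≤ bridgeCost g ρ₀ β T := by
  have h1 := B.integrable_action.2
  have h2 : ∫ x, V x * bridgeDensity g ρ₀ β T T x
      = -(2 * β * ∫ x, Real.log (g x) * bridgeDensity g ρ₀ β T T x) := by
    rw [← integral_const_mul, ← integral_neg]
    congr 1
    funext x
    have := hV x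
    linear_combination (bridgeDensity g ρ₀ β T T x) * this
  have h3 : bridgeCost g ρ₀ β T
      = -(2 * β * ∫ z, Real.log (backwardFlow g β T 0 z) * ρ₀ z) := by
    rw [bridgeCost, ← integral_const_mul]
    simp only [hopfCole, mul_assoc]
  rw [cost, h2, h3]
  linarith

theorem isOptimizer_bridge (B : BridgeData β T M g ρ₀)
    (hV : ∀ x, 2 * β * Real.log (g x) = -V x) :
    IsOptimizer T β V ρ₀ (bridgeDensity g ρ₀ β T) (fun t => gradient (hopfCole g β T t))
      (bridgeDensity g ρ₀ β T T) :=
  ⟨B.isAdmissible_bridge hV, fun _ _ _ h => (B.cost_bridge_le hV).trans (B.bridgeCost_le hV h).1⟩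

section Optimizer

variable {ρ : ℝ → Space d → ℝ} {v : ℝ → Space d → Space d} {q : Space d → ℝ}

theorem cost_eq (B : BridgeData β T M g ρ₀) (hV : ∀ x, 2 * β * Real.log (g x) = -V x)
    (h : IsOptimizer T β V ρ₀ ρ v q) : cost T V ρ v q = bridgeCost g ρ₀ β T :=
  le_antisymm ((h.2 _ _ _ (B.isAdmissible_bridge hV)).trans (B.cost_bridge_le hV))
    (B.bridgeCost_le hV h.1).1

theorem ae_drift_eq (B : BridgeData β T M g ρ₀) (hV : ∀ x, 2 * β * Real.log (g x) = -V x)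
    (h : IsOptimizer T β V ρ₀ ρ v q) :
    ∀ᵐ z ∂slab d T, 0 < ρ z.1 z.2 → v z.1 z.2 = gradient (hopfCole g β T z.1) z.2 := by
  have h1 := (B.bridgeCost_le hV h.1).2
  rw [B.cost_eq hV h, sub_self, ENNReal.ofReal_zero, nonpos_iff_eq_zero, lintegral_eq_zero_iff',
    Filter.EventuallyEq, ae_densityMeasure_iff h.1.density_measurable] at h1
  · filter_upwards [h1] with z hz hp
    have h2 := hz hp
    rw [Pi.zero_apply, ENNReal.ofReal_eq_zero] at h2
    have h3 : ‖v z.1 z.2 - gradient (hopfCole g β T z.1) z.2‖ ^ 2 = 0 :=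
      le_antisymm (by linarith) (sq_nonneg _)
    exact sub_eq_zero.1 (norm_eq_zero.1 (pow_eq_zero_iff two_ne_zero |>.1 h3))
  · have h2 : AEStronglyMeasurable (fun z : ℝ × Space d => 1 / 2 *
        ‖v z.1 z.2 - gradient (hopfCole g β T z.1) z.2‖ ^ 2) (slab d T) :=
      ((h.1.drift_measurable.sub B.aestronglyMeasurable_drift).norm.pow 2).const_mul _
    exact (h2.mono_ac (withDensity_absolutelyContinuous _ _)).aemeasurable.ennreal_ofReal

end Optimizer

/-! ### The Lagrange multiplier -/

/-- Completing the square in the Lagrangian with the multiplier `Φ`. -/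
theorem lagrangian_hopfCole (B : BridgeData β T M g ρ₀) (hV : ∀ x, 2 * β * Real.log (g x) = -V x)
    {ρ : ℝ → Space d → ℝ} {v : ℝ → Space d → Space d} {q : Space d → ℝ}
    (h : IsTrial T V ρ₀ ρ v q) (hp : IsPairable T β ρ₀ ρ v q (hopfCole g β T)) :
    lagrangian T β V ρ₀ ρ v q (hopfCole g β T) = bridgeCost g ρ₀ β T
      + ∫ z, 1 / 2 * ‖v z.1 z.2 - gradient (hopfCole g β T z.1) z.2‖ ^ 2 * ρ z.1 z.2
        ∂slab d T := by
  have h1 : ∀ᵐ z ∂slab d T,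
      1 / 2 * ‖v z.1 z.2 - gradient (hopfCole g β T z.1) z.2‖ ^ 2 * ρ z.1 z.2
      = 1 / 2 * ‖v z.1 z.2‖ ^ 2 * ρ z.1 z.2
        - backwardOp β v (hopfCole g β T) z.1 z.2 * ρ z.1 z.2 := by
    filter_upwards [ae_slab_time_mem d T] with z hz
    rw [backwardOp_eq, B.heatOp_hopfCole hz.2, norm_sub_sq_real]
    ring
  have h2 : ∫ x, hopfCole g β T T x * q x = -∫ x, V x * q x := by
    rw [← integral_neg]
    congr 1
    funext x
    rw [hopfCole, backwardFlow_self, hV, neg_mul]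
  rw [integral_congr_ae h1, integral_sub h.finite_action hp.interior, lagrangian, cost, h2,
    bridgeCost]
  ring

theorem isLagrangeMultiplier (B : BridgeData β T M g ρ₀)
    (hV : ∀ x, 2 * β * Real.log (g x) = -V x) {ρ : ℝ → Space d → ℝ} {v : ℝ → Space d → Space d}
    {q : Space d → ℝ} (h : IsOptimizer T β V ρ₀ ρ v q) :
    IsLagrangeMultiplier T β V ρ₀ ρ v q (hopfCole g β T) := by
  have h0 := ae_slab_nonneg h.1.density
  have hdrift := B.ae_drift_eq hV h
  have hp : IsPairable T β ρ₀ ρ v q (hopfCole g β T) := by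
    refine ⟨B.integrable_hopfCole_mul, ?_, ?_⟩
    · refine h.1.finite_potential.neg.congr (Eventually.of_forall fun x => ?_)
      simp only [Pi.neg_apply]
      rw [hopfCole, backwardFlow_self, hV, neg_mul]
    · -- where `v = ∇Φ`, the Hamilton–Jacobi equation turns the integrand into `½ ‖v‖² ρ`
      refine h.1.finite_action.congr ?_
      filter_upwards [h0, hdrift, ae_slab_time_mem d T] with z hz hv ht
      rcases hz.eq_or_lt with hz | hz
      · rw [← hz, mul_zero, mul_zero]
      · rw [backwardOp_eq, B.heatOp_hopfCole ht.2, hv hz, real_inner_self_eq_norm_sq]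
        ring
  have heq : lagrangian T β V ρ₀ ρ v q (hopfCole g β T) = bridgeCost g ρ₀ β T := by
    rw [B.lagrangian_hopfCole hV h.1.toIsTrial hp, add_eq_left]
    refine integral_eq_zero_of_ae ?_
    filter_upwards [h0, hdrift] with z hz hv
    rcases hz.eq_or_lt with hz | hz
    · rw [← hz, mul_zero, Pi.zero_apply]
    · rw [hv hz]
      simp
  refine ⟨hp, heq.trans (B.cost_eq hV h).symm, fun ρ' v' q' h' hp' => ?_⟩
  rw [heq, B.lagrangian_hopfCole hV h' hp']
  refine le_add_of_nonneg_right (integral_nonneg_of_ae ?_)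
  filter_upwards [ae_slab_nonneg h'.density] with z hz
  simp only [Pi.zero_apply]
  positivity

end BridgeData

/-! ### Uniqueness of the optimizer -/

theorem eq_zero_of_forall_small {a X Y : ℝ} (ha : 0 < a)
    (h : ∀ l : ℝ, |l| ≤ a → 0 ≤ l * X + l ^ 2 * Y) : X = 0 := by
  have hmin : IsLocalMin (fun l : ℝ => l * X + l ^ 2 * Y) 0 := by
    filter_upwards [Metric.closedBall_mem_nhds (0 : ℝ) ha] with l hl
    simpa using h l (by simpa using hl)
  have hd : HasDerivAt (fun l : ℝ => l * X + l ^ 2 * Y) (1 * X + 2 * 0 * Y) 0 := by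
    exact (((hasDerivAt_id (0 : ℝ)).mul_const X).fun_add
      ((hasDerivAt_pow 2 (0 : ℝ)).mul_const Y)).congr_deriv (by simp)
  simpa using hmin.hasDerivAt_eq_zero hd

namespace Perturbation

variable {β T M S C' : ℝ} {g f : Space d → ℝ} {η : ℝ → ℝ}

theorem perturbedFlow_eq (η : ℝ → ℝ) (t : ℝ) (x : Space d) (hu : 0 < backwardFlow g β T t x) :
    perturbedFlow g f β T S η 0 0 t x = backwardFlow g β T t x *
      (1 + η t * (backwardFlow f β S t x / backwardFlow g β T t x)) := by
  simp only [perturbedFlow, add_zero]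
  field_simp

end Perturbation

/-- The backward flow of `f` from the time `S`, relative to the backward flow of `g`. By the
comparison principle it is bounded by `1` before `S` if `|f|` is at most the backward flow of `g`
at `S`. -/
noncomputable def relativeFlow (g f : Space d → ℝ) (β T S t : ℝ) (x : Space d) : ℝ :=
  backwardFlow f β S t x / backwardFlow g β T t x

namespace BridgeData

variable {β T M S : ℝ} {g f ρ₀ V : Space d → ℝ} {η : ℝ → ℝ}

theorem continuous_relativeFlow (B : BridgeData β T M g ρ₀) (hf : Continuous f)
    (hfu : ∀ x, |f x| ≤ backwardFlow g β T S x) :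
    Continuous fun z : ℝ × Space d => relativeFlow g f β T S z.1 z.2 := by
  have hfM : ∀ x, |f x| ≤ M := fun x => (hfu x).trans (B.flow_le S x)
  have h1 := (continuous_backwardFlow hf hfM β).comp
    (by fun_prop : Continuous fun z : ℝ × Space d => (S, z.1, z.2))
  have h2 := (continuous_backwardFlow B.cont_g B.bound_g β).comp
    (by fun_prop : Continuous fun z : ℝ × Space d => (T, z.1, z.2))
  exact h1.div h2 fun z => (B.flow_pos z.1 z.2).ne'

theorem abs_relativeFlow_le (B : BridgeData β T M g ρ₀) (hf : Continuous f)
    (hfu : ∀ x, |f x| ≤ backwardFlow g β T S x) (hST : S < T) {t : ℝ} (ht : t < S) (x : Space d) :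
    |relativeFlow g f β T S t x| ≤ 1 := by
  have P : Perturbation β T M g f S (fun _ => 0) 0 :=
    ⟨B.cont_g, B.bound_g, B.pos_g, hf, hfu, hST, contDiff_const, by simp, by simp, by simp⟩
  have h1 := P.abs_flow_le (δ := 0) B.β_pos (by simpa using ht) x
  simp only [add_zero] at h1
  rw [relativeFlow, abs_div, abs_of_pos (B.flow_pos t x), div_le_one (B.flow_pos t x)]
  exact h1

/-- The first variation of the dual bound at an optimizer vanishes. -/
theorem stationarity (B : BridgeData β T M g ρ₀) (hV : ∀ x, 2 * β * Real.log (g x) = -V x)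
    {ρ : ℝ → Space d → ℝ} {v : ℝ → Space d → Space d} {q : Space d → ℝ}
    (h : IsOptimizer T β V ρ₀ ρ v q) (hS : S ∈ Ioo 0 T) (hf : Continuous f)
    (hfu : ∀ x, |f x| ≤ backwardFlow g β T S x) (hη : ContDiff ℝ 2 η) (hηS : ∀ t ≥ S, η t = 0)
    {C₀ C₁ : ℝ} (hC₀ : ∀ t, |η t| ≤ C₀) (hC₁ : ∀ t, |deriv η t| ≤ C₁) :
    η 0 * (∫ x, relativeFlow g f β T S 0 x * ρ₀ x)
      + ∫ z, deriv η z.1 * relativeFlow g f β T S z.1 z.2 * ρ z.1 z.2 ∂slab d T = 0 := by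
  have hβ := B.β_pos
  have h00 : 0 ≤ C₀ := (abs_nonneg _).trans (hC₀ 0)
  have h01 : 0 ≤ C₁ := (abs_nonneg _).trans (hC₁ 0)
  set ζ := relativeFlow g f β T S with hζ
  have hζc : Continuous fun z : ℝ × Space d => ζ z.1 z.2 := B.continuous_relativeFlow hf hfu
  have hζ1 : ∀ t < S, ∀ x, |ζ t x| ≤ 1 := fun t ht x => B.abs_relativeFlow_le hf hfu hS.2 ht x
  have hη'c : Continuous (deriv η) := hη.continuous_deriv one_le_two
  -- for these `l` the perturbation `l η` is at most `1 / 2` in absolute value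
  have hP : ∀ l : ℝ, |l| ≤ 1 / (2 * (C₀ + 1)) →
      Perturbation β T M g f S (fun t => l * η t) (|l| * C₁) := by
    intro l hl
    refine ⟨B.cont_g, B.bound_g, B.pos_g, hf, hfu, hS.2, contDiff_const.mul hη, fun t => ?_,
      fun t ht => by rw [hηS t ht, mul_zero], fun t => ?_⟩
    · rw [abs_mul]
      calc |l| * |η t| ≤ 1 / (2 * (C₀ + 1)) * (C₀ + 1) :=
            mul_le_mul hl ((hC₀ t).trans (by linarith)) (abs_nonneg _) (by positivity)
        _ = 1 / 2 := by field_simp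
    · rw [deriv_const_mul_field, abs_mul]
      exact mul_le_mul_of_nonneg_left (hC₁ t) (abs_nonneg _)
  have hη'S : ∀ t ≥ S, deriv η t = 0 := by
    have P := hP (1 / (2 * (C₀ + 1))) (by rw [abs_of_pos (by positivity)])
    intro t ht
    have h1 := P.deriv_eq_zero ht
    rw [deriv_const_mul_field] at h1
    exact (mul_eq_zero.1 h1).resolve_left (by positivity)
  have hρi := integrable_slab_of_density h.1.density h.1.density_measurable
  have hρn := ae_slab_nonneg h.1.density
  have hζ0i : Integrable fun x => ζ 0 x * ρ₀ x := by
    refine B.density.integrable.bdd_mul (c := 1) ?_ (Eventually.of_forall (hζ1 0 hS.1))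
    exact (hζc.comp (by fun_prop : Continuous fun x : Space d => ((0 : ℝ), x))).aestronglyMeasurable
  have hζη : ∀ z : ℝ × Space d, |deriv η z.1 * ζ z.1 z.2| ≤ C₁ := by
    intro z
    rcases lt_or_ge z.1 S with hz | hz
    · rw [abs_mul]
      exact (mul_le_mul (hC₁ _) (hζ1 _ hz _) (abs_nonneg _) h01).trans (by rw [mul_one])
    · rw [hη'S _ hz, zero_mul, abs_zero]
      exact h01
  have hζi : Integrable (fun z : ℝ × Space d => deriv η z.1 * ζ z.1 z.2 * ρ z.1 z.2) (slab d T) :=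
    hρi.bdd_mul ((hη'c.comp continuous_fst).mul hζc).aestronglyMeasurable
      (Eventually.of_forall hζη)
  suffices hX : 2 * β * (η 0 * (∫ x, ζ 0 x * ρ₀ x)
      + ∫ z, deriv η z.1 * ζ z.1 z.2 * ρ z.1 z.2 ∂slab d T) = 0 from
    (mul_eq_zero.1 hX).resolve_left (by positivity)
  -- the lower bound for the cost, perturbed by `l`, is at most the optimal cost; its part linear in
  -- `l` is the claimed expression, and the rest is quadratic
  refine eq_zero_of_forall_small (a := 1 / (2 * (C₀ + 1)))
    (Y := 4 * β * C₁ * C₀ * ∫ z, ρ z.1 z.2 ∂slab d T) (by positivity) fun l hl => ?_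
  have P := hP l hl
  have hr : ∀ t < S, ∀ x, |l * η t * ζ t x| ≤ 1 / 2 := fun t ht x => by
    rw [abs_mul]
    exact (mul_le_mul (P.le_half t) (hζ1 t ht x) (abs_nonneg _) (by norm_num)).trans (by norm_num)
  have hN : ∀ t x, perturbedFlow g f β T S (fun t => l * η t) 0 0 t x
      = backwardFlow g β T t x * (1 + l * η t * ζ t x) := fun t x =>
    Perturbation.perturbedFlow_eq _ t x (B.flow_pos t x)
  have hv := (h.1.verification B hV P).1
  have hlog : ∀ x, |Real.log (1 + l * η 0 * ζ 0 x)| ≤ 1 ∧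
      Real.log (1 + l * η 0 * ζ 0 x) ≤ l * η 0 * ζ 0 x := by
    intro x
    have h1 := abs_le.1 (hr 0 hS.1 x)
    have h2 : 0 < 1 + l * η 0 * ζ 0 x := by linarith
    have h3 := Real.log_le_sub_one_of_pos h2
    have h4 := Real.one_sub_inv_le_log_of_pos h2
    have h5 : (1 + l * η 0 * ζ 0 x)⁻¹ ≤ 2 := by
      rw [inv_le_comm₀ h2 two_pos]
      linarith
    refine ⟨abs_le.2 ⟨by linarith, by linarith⟩, by linarith⟩
  have hlogm : Continuous fun x => Real.log (1 + l * η 0 * ζ 0 x) := by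
    have h1 : Continuous fun x => ζ 0 x :=
      hζc.comp (by fun_prop : Continuous fun x : Space d => ((0 : ℝ), x))
    refine Continuous.log (by fun_prop) fun x => ?_
    have h2 := abs_le.1 (hr 0 hS.1 x)
    linarith
  have hlogi : Integrable fun x => Real.log (1 + l * η 0 * ζ 0 x) * ρ₀ x :=
    B.density.integrable.bdd_mul hlogm.aestronglyMeasurable
      (Eventually.of_forall fun x => (hlog x).1)
  -- by `log (1 + r) ≤ r`, the initial term has no quadratic remainder
  have hinit : ∫ x, 2 * β * Real.log (perturbedFlow g f β T S (fun t => l * η t) 0 0 0 x) * ρ₀ x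
      ≤ -bridgeCost g ρ₀ β T + 2 * β * (l * (η 0 * ∫ x, ζ 0 x * ρ₀ x)) := by
    have e1 : ∀ x, 2 * β * Real.log (perturbedFlow g f β T S (fun t => l * η t) 0 0 0 x) * ρ₀ x
        = hopfCole g β T 0 x * ρ₀ x + 2 * β * (Real.log (1 + l * η 0 * ζ 0 x) * ρ₀ x) := by
      intro x
      have h1 := abs_le.1 (hr 0 hS.1 x)
      rw [hN, Real.log_mul (B.flow_pos 0 x).ne' (by linarith), hopfCole]
      ring
    simp only [e1]
    rw [integral_add B.integrable_hopfCole_mul (hlogi.const_mul _), bridgeCost, neg_neg,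
      integral_const_mul]
    have h1 : ∫ x, Real.log (1 + l * η 0 * ζ 0 x) * ρ₀ x
        ≤ ∫ x, l * η 0 * (ζ 0 x * ρ₀ x) := by
      refine integral_mono hlogi (hζ0i.const_mul _) fun x => ?_
      simp only
      rw [← mul_assoc]
      exact mul_le_mul_of_nonneg_right (hlog x).2 (B.density.nonneg x)
    rw [integral_const_mul] at h1
    have h2 : l * η 0 * (∫ x, ζ 0 x * ρ₀ x) = l * (η 0 * ∫ x, ζ 0 x * ρ₀ x) := by ring
    rw [h2] at h1
    gcongr
  have hsrc : ∫ z, 2 * β * (deriv (fun t => l * η t) z.1 * backwardFlow f β (S + 0) z.1 z.2)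
        / perturbedFlow g f β T S (fun t => l * η t) 0 0 z.1 z.2 * ρ z.1 z.2 ∂slab d T
      ≤ 2 * β * (l * ∫ z, deriv η z.1 * ζ z.1 z.2 * ρ z.1 z.2 ∂slab d T)
        + l ^ 2 * (4 * β * C₁ * C₀ * ∫ z, ρ z.1 z.2 ∂slab d T) := by
    have hki : Integrable (fun z : ℝ × Space d =>
        2 * β * (deriv (fun t => l * η t) z.1 * backwardFlow f β (S + 0) z.1 z.2)
        / perturbedFlow g f β T S (fun t => l * η t) 0 0 z.1 z.2 * ρ z.1 z.2) (slab d T) := by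
      refine hρi.bdd_mul ?_
        (Eventually.of_forall fun z => P.abs_source_le hβ le_rfl le_rfl z.1 z.2)
      have h1 : Continuous (deriv fun t => l * η t) := by
        have : (deriv fun t => l * η t) = fun t => l * deriv η t :=
          funext fun t => deriv_const_mul_field l
        rw [this]
        fun_prop
      have h2 := (continuous_backwardFlow P.cont_f P.bound_f β).comp
        (by fun_prop : Continuous fun z : ℝ × Space d => (S + 0, z.1, z.2))
      exact ((continuous_const.mul ((h1.comp continuous_fst).mul h2)).div
        P.continuous_perturbedFlow fun z =>
          (P.perturbedFlow_pos hβ le_rfl le_rfl z.1 z.2).ne').aestronglyMeasurable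
    rw [← integral_const_mul, ← integral_const_mul, ← integral_const_mul, ← integral_const_mul,
      ← integral_add ((hζi.const_mul _).const_mul _) ((hρi.const_mul _).const_mul _)]
    refine integral_mono_ae hki (((hζi.const_mul _).const_mul _).add
      ((hρi.const_mul _).const_mul _)) ?_
    filter_upwards [hρn] with z hz
    have hpt : 2 * β * (deriv (fun t => l * η t) z.1 * backwardFlow f β (S + 0) z.1 z.2)
        / perturbedFlow g f β T S (fun t => l * η t) 0 0 z.1 z.2
        ≤ 2 * β * l * (deriv η z.1 * ζ z.1 z.2) + 4 * β * l ^ 2 * (C₁ * C₀) := by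
      rw [deriv_const_mul_field, add_zero, hN]
      rcases lt_or_ge z.1 S with ht | ht
      · have hu := B.flow_pos z.1 z.2
        have h1 := abs_le.1 (hr _ ht z.2)
        set r := l * η z.1 * ζ z.1 z.2 with hrdef
        have h2 : 0 < 1 + r := by linarith
        set a := l * (deriv η z.1 * ζ z.1 z.2) with ha
        have e1 : 2 * β * (l * deriv η z.1 * backwardFlow f β S z.1 z.2)
            / (backwardFlow g β T z.1 z.2 * (1 + r)) = 2 * β * (a / (1 + r)) := by
          rw [ha, hζ, relativeFlow]
          field_simp
        have h3 : a / (1 + r) ≤ a + 2 * (|a| * |r|) := by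
          rw [div_le_iff₀ h2, ← abs_mul]
          nlinarith [neg_abs_le (a * r), abs_nonneg (a * r)]
        have h4 : |a| * |r| ≤ l ^ 2 * (C₁ * C₀) := by
          have h5 : |a| ≤ |l| * C₁ := by
            rw [ha, abs_mul]
            exact mul_le_mul_of_nonneg_left (hζη z) (abs_nonneg _)
          have h6 : |r| ≤ |l| * C₀ := by
            rw [hrdef, mul_assoc, abs_mul, abs_mul]
            refine mul_le_mul_of_nonneg_left ?_ (abs_nonneg _)
            exact (mul_le_mul (hC₀ _) (hζ1 _ ht _) (abs_nonneg _) h00).trans (by rw [mul_one])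
          calc |a| * |r| ≤ (|l| * C₁) * (|l| * C₀) :=
                mul_le_mul h5 h6 (abs_nonneg _) (by positivity)
            _ = _ := by rw [← sq_abs l]; ring
        rw [e1]
        calc 2 * β * (a / (1 + r)) ≤ 2 * β * (a + 2 * (l ^ 2 * (C₁ * C₀))) := by
              refine mul_le_mul_of_nonneg_left (h3.trans ?_) (by positivity)
              linarith
          _ = _ := by rw [ha]; ring
      · rw [hη'S _ ht]
        simp only [mul_zero, zero_mul, zero_div, zero_add]
        positivity
    calc _ ≤ (2 * β * l * (deriv η z.1 * ζ z.1 z.2) + 4 * β * l ^ 2 * (C₁ * C₀)) * ρ z.1 z.2 :=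
          mul_le_mul_of_nonneg_right hpt hz
      _ = _ := by ring
  rw [B.cost_eq hV h] at hv
  linarith

end BridgeData

theorem exists_antiderivative {θ : ℝ → ℝ} {S : ℝ} (hθ : ContDiff ℝ 1 θ) (hc : HasCompactSupport θ)
    (hS : ∀ t ≥ S, θ t = 0) : ∃ (η : ℝ → ℝ) (C : ℝ), ContDiff ℝ 2 η ∧ deriv η = θ ∧
      (∀ t ≥ S, η t = 0) ∧ ∀ t, |η t| ≤ C := by
  have hd : ∀ t, HasDerivAt (fun u => ∫ s in S..u, θ s) (θ t) t := fun t =>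
    (hθ.continuous.integral_hasStrictDerivAt S t).hasDerivAt
  have hd' : deriv (fun u => ∫ s in S..u, θ s) = θ := funext fun t => (hd t).deriv
  refine ⟨fun u => ∫ s in S..u, θ s, ∫ s, ‖θ s‖, ?_, hd', fun t ht => ?_, fun t => ?_⟩
  · exact contDiff_succ_iff_deriv (n := 1).2
      ⟨fun t => (hd t).differentiableAt, by simp, by rw [hd']; exact hθ⟩
  · refine (intervalIntegral.integral_congr (g := fun _ => (0 : ℝ)) fun s hs => ?_).trans (by simp)
    rw [uIcc_of_le ht] at hs
    exact hS s hs.1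
  · exact intervalIntegral.norm_integral_le_integral_norm_uIoc.trans
      (setIntegral_le_integral (hθ.continuous.integrable_of_hasCompactSupport hc).norm
        (Eventually.of_forall fun _ => norm_nonneg _))

namespace BridgeData

variable {β T M S : ℝ} {g f ρ₀ V : Space d → ℝ} {ρ ρ' : ℝ → Space d → ℝ}
  {v v' : ℝ → Space d → Space d} {q q' : Space d → ℝ}

/-- Two optimizers have the same integral against a relative flow, at almost all times. -/
theorem ae_integral_relativeFlow (B : BridgeData β T M g ρ₀)
    (hV : ∀ x, 2 * β * Real.log (g x) = -V x) (h : IsOptimizer T β V ρ₀ ρ v q)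
    (h' : IsOptimizer T β V ρ₀ ρ' v' q') (hS : S ∈ Ioo 0 T) (hf : Continuous f)
    (hfu : ∀ x, |f x| ≤ backwardFlow g β T S x) :
    ∀ᵐ t, t ∈ Ioo 0 S →
      ∫ x, relativeFlow g f β T S t x * (ρ t x - ρ' t x) = 0 := by
  have hρ := integrable_slab_of_density h.1.density h.1.density_measurable
  have hρ' := integrable_slab_of_density h'.1.density h'.1.density_measurable
  have hσ : Integrable (fun z : ℝ × Space d => ρ z.1 z.2 - ρ' z.1 z.2) (slab d T) := hρ.sub hρ'
  have hζc := B.continuous_relativeFlow hf hfu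
  set ζ := relativeFlow g f β T S with hζ
  have hζ1 : ∀ t < S, ∀ x, |ζ t x| ≤ 1 := fun t ht x => B.abs_relativeFlow_le hf hfu hS.2 ht x
  -- the relative flow is bounded before the time `S` only, hence the cutoff `χ`
  set χ : ℝ → ℝ := (Iio S).indicator fun _ => 1 with hχ
  have hχ1 : ∀ t < S, χ t = 1 := fun t ht => indicator_of_mem (mem_Iio.2 ht) _
  have hχ0 : ∀ t ≥ S, χ t = 0 := fun t ht => indicator_of_notMem (notMem_Iio.2 ht) _
  have hχm : Measurable χ := measurable_const.indicator measurableSet_Iio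
  have hχζ : ∀ z : ℝ × Space d, ‖χ z.1 * ζ z.1 z.2‖ ≤ 1 := by
    intro z
    rcases lt_or_ge z.1 S with hz | hz
    · rw [hχ1 _ hz, one_mul]
      exact hζ1 _ hz _
    · rw [hχ0 _ hz, zero_mul, norm_zero]
      exact zero_le_one
  have hG : Integrable (fun z : ℝ × Space d => χ z.1 * ζ z.1 z.2 * (ρ z.1 z.2 - ρ' z.1 z.2))
      (slab d T) := by
    refine hσ.bdd_mul ?_ (Eventually.of_forall hχζ)
    exact ((hχm.comp measurable_fst).mul hζc.measurable).aestronglyMeasurable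
  have hGt : IntegrableOn (fun t => ∫ x, χ t * ζ t x * (ρ t x - ρ' t x)) (Ioo 0 T) := by
    unfold slab at hG
    exact hG.integral_prod_left
  have hsub : Ioo 0 S ⊆ Ioo 0 T := Ioo_subset_Ioo_right hS.2.le
  have key := isOpen_Ioo.ae_eq_zero_of_integral_contDiff_smul_eq_zero
    ((hGt.mono_set hsub).locallyIntegrableOn) (fun θ hθ hc hsupp => ?_)
  · filter_upwards [key] with t ht hts
    have h1 := ht hts
    simpa only [hχ1 t hts.2, one_mul] using h1
  · have hθ0 : ∀ t ∉ Ioo 0 S, θ t = 0 := fun t ht =>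
      image_eq_zero_of_notMem_tsupport fun h => ht (hsupp h)
    have hθS : ∀ t ≥ S, θ t = 0 := fun t ht => hθ0 t fun h => absurd h.2 (not_lt.2 ht)
    -- the antiderivative of `θ` which vanishes after `S`: stationarity tests `ρ` with `η' = θ`, and
    -- the initial terms of the two optimizers agree
    obtain ⟨η, C₀, hη, hηθ, hηS, hC₀⟩ :=
      exists_antiderivative (hθ.of_le (by exact_mod_cast le_top)) hc hθS
    obtain ⟨C₁, hC₁⟩ := hc.exists_bound_of_continuous hθ.continuous
    have s1 := B.stationarity hV h hS hf hfu hη hηS hC₀ (C₁ := C₁) (by rw [hηθ]; exact hC₁)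
    have s2 := B.stationarity hV h' hS hf hfu hη hηS hC₀ (C₁ := C₁) (by rw [hηθ]; exact hC₁)
    rw [hηθ] at s1 s2
    have hθζ : ∀ z : ℝ × Space d, θ z.1 * ζ z.1 z.2 = θ z.1 * (χ z.1 * ζ z.1 z.2) := by
      intro z
      rcases lt_or_ge z.1 S with hz | hz
      · rw [hχ1 _ hz, one_mul]
      · rw [hθS _ hz, zero_mul, zero_mul]
    have hθζm : AEStronglyMeasurable (fun z : ℝ × Space d => θ z.1 * ζ z.1 z.2) (slab d T) :=
      ((hθ.continuous.comp continuous_fst).mul hζc).aestronglyMeasurable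
    have hθζb : ∀ z : ℝ × Space d, ‖θ z.1 * ζ z.1 z.2‖ ≤ C₁ := fun z => by
      rw [hθζ, norm_mul]
      exact (mul_le_mul (hC₁ _) (hχζ z) (norm_nonneg _) ((norm_nonneg _).trans (hC₁ 0))).trans
        (by rw [mul_one])
    have i1 := hρ.bdd_mul hθζm (Eventually.of_forall hθζb)
    have i2 := hρ'.bdd_mul hθζm (Eventually.of_forall hθζb)
    have hdiff : ∫ z, θ z.1 * (χ z.1 * ζ z.1 z.2 * (ρ z.1 z.2 - ρ' z.1 z.2)) ∂slab d T = 0 := by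
      have e : ∀ z : ℝ × Space d, θ z.1 * (χ z.1 * ζ z.1 z.2 * (ρ z.1 z.2 - ρ' z.1 z.2))
          = θ z.1 * ζ z.1 z.2 * ρ z.1 z.2 - θ z.1 * ζ z.1 z.2 * ρ' z.1 z.2 := fun z => by
        rw [hθζ]
        ring
      simp only [e]
      rw [integral_sub i1 i2]
      linarith
    have hprod : ∫ z, θ z.1 * (χ z.1 * ζ z.1 z.2 * (ρ z.1 z.2 - ρ' z.1 z.2)) ∂slab d T
        = ∫ t in Ioo 0 T, θ t * ∫ x, χ t * ζ t x * (ρ t x - ρ' t x) := by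
      have hi : Integrable (fun z : ℝ × Space d =>
          θ z.1 * (χ z.1 * ζ z.1 z.2 * (ρ z.1 z.2 - ρ' z.1 z.2))) (slab d T) :=
        hG.bdd_mul (hθ.continuous.comp continuous_fst).aestronglyMeasurable
          (Eventually.of_forall fun z => hC₁ z.1)
      unfold slab at hi ⊢
      rw [integral_prod _ hi]
      simp only [integral_const_mul]
    rw [hprod] at hdiff
    rw [← hdiff]
    refine (setIntegral_eq_integral_of_forall_compl_eq_zero fun t ht => ?_).symm
    rw [hθ0 t fun h => ht (hsub h), zero_smul]

/-- As the intermediate time `S` decreases to `t`, the relative flow of `ψ` times the backward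
flow of `g` tends to `ψ`. -/
theorem ae_integral_eq (B : BridgeData β T M g ρ₀)
    (hV : ∀ x, 2 * β * Real.log (g x) = -V x) (h : IsOptimizer T β V ρ₀ ρ v q)
    (h' : IsOptimizer T β V ρ₀ ρ' v' q') {ψ : Space d → ℝ} (hψ : Continuous ψ)
    (hψ1 : ∀ x, |ψ x| ≤ 1) :
    ∀ᵐ t, t ∈ Ioo 0 T → ∫ x, ψ x * ρ t x = ∫ x, ψ x * ρ' t x := by
  have hfc : ∀ S, Continuous fun x => ψ x * backwardFlow g β T S x := fun S =>
    hψ.mul (B.continuous_flow S)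
  have hfu : ∀ S x, |ψ x * backwardFlow g β T S x| ≤ backwardFlow g β T S x := fun S x => by
    rw [abs_mul, abs_of_pos (B.flow_pos S x)]
    exact mul_le_of_le_one_left (B.flow_pos S x).le (hψ1 x)
  -- rational intermediate times suffice, and give a common null set
  have hall : ∀ᵐ t, ∀ r : ℚ, (r : ℝ) ∈ Ioo 0 T → t ∈ Ioo 0 (r : ℝ) →
      ∫ x, relativeFlow g (fun x => ψ x * backwardFlow g β T r x) β T r t x
        * (ρ t x - ρ' t x) = 0 := by
    rw [ae_all_iff]
    intro r
    by_cases hr : (r : ℝ) ∈ Ioo 0 T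
    · filter_upwards [B.ae_integral_relativeFlow hV h h' hr (hfc r) (hfu r)] with t ht _ using ht
    · exact Eventually.of_forall fun t hr' => absurd hr' hr
  filter_upwards [hall] with t ht htT
  obtain ⟨r, -, hrt, hrlim⟩ := Real.exists_seq_rat_strictAnti_tendsto t
  have hdt := h.1.density t ⟨htT.1.le, htT.2.le⟩
  have hdt' := h'.1.density t ⟨htT.1.le, htT.2.le⟩
  have hσ : Integrable fun x => ρ t x - ρ' t x := hdt.integrable.sub hdt'.integrable
  have hrT : ∀ᶠ n in atTop, (r n : ℝ) < T := hrlim.eventually (gt_mem_nhds htT.2)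
  have hlim : Tendsto (fun n => ∫ x, relativeFlow g (fun x => ψ x * backwardFlow g β T (r n) x) β T
      (r n) t x * (ρ t x - ρ' t x)) atTop (𝓝 (∫ x, ψ x * (ρ t x - ρ' t x))) := by
    refine tendsto_integral_filter_of_dominated_convergence (fun x => ‖ρ t x - ρ' t x‖)
      (Eventually.of_forall fun n => ?_) ?_ hσ.norm (Eventually.of_forall fun x => ?_)
    · exact ((B.continuous_relativeFlow (hfc (r n)) (hfu (r n))).comp
        (by fun_prop : Continuous fun x : Space d => (t, x))).aestronglyMeasurable.mul
          hσ.aestronglyMeasurable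
    · filter_upwards [hrT] with n hn
      refine Eventually.of_forall fun x => ?_
      rw [norm_mul]
      exact mul_le_of_le_one_left (norm_nonneg _)
        (B.abs_relativeFlow_le (hfc (r n)) (hfu (r n)) hn (hrt n) x)
    · refine Tendsto.mul_const _ ?_
      have hu := B.flow_pos t x
      have h1 : Tendsto (fun n => heatFlow (fun y => ψ y * backwardFlow g β T (r n) y)
          (β * (r n - t)) x) atTop
          (𝓝 (heatFlow (fun y => ψ y * backwardFlow g β T t y) 0 x)) := by
        refine tendsto_heatFlow (M := M) (fun n => hfc (r n))
          (fun n y => (hfu (r n) y).trans (B.flow_le _ _)) ?_ tendsto_const_nhds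
          fun y y₀ hy => ?_
        · simpa using (hrlim.sub_const t).const_mul β
        · refine ((hψ.tendsto y₀).comp hy).mul ?_
          exact ((continuous_backwardFlow B.cont_g B.bound_g β).tendsto (T, t, y₀)).comp
            (tendsto_const_nhds.prodMk_nhds (hrlim.prodMk_nhds hy))
      have h2 := h1.div_const (backwardFlow g β T t x)
      rw [heatFlow_zero, mul_div_cancel_right₀ _ hu.ne'] at h2
      exact h2
  have hzero : ∫ x, ψ x * (ρ t x - ρ' t x) = 0 := by
    refine tendsto_nhds_unique hlim (tendsto_const_nhds.congr' ?_)
    filter_upwards [hrT] with n hn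
    exact (ht (r n) ⟨htT.1.trans (hrt n), hn⟩ ⟨htT.1, hrt n⟩).symm
  simp only [mul_sub] at hzero
  rw [integral_sub (hdt.integrable.bdd_mul hψ.aestronglyMeasurable (Eventually.of_forall hψ1))
    (hdt'.integrable.bdd_mul hψ.aestronglyMeasurable (Eventually.of_forall hψ1))] at hzero
  linarith

theorem ae_density_eq (B : BridgeData β T M g ρ₀)
    (hV : ∀ x, 2 * β * Real.log (g x) = -V x) (h : IsOptimizer T β V ρ₀ ρ v q)
    (h' : IsOptimizer T β V ρ₀ ρ' v' q') :
    ∀ᵐ z ∂slab d T, ρ z.1 z.2 = ρ' z.1 z.2 := by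
  have hρ := integrable_slab_of_density h.1.density h.1.density_measurable
  have hρ' := integrable_slab_of_density h'.1.density h'.1.density_measurable
  have hn := ae_slab_nonneg h.1.density
  have hn' := ae_slab_nonneg h'.1.density
  have i1 := isFiniteMeasure_densityMeasure hρ
  have i2 := isFiniteMeasure_densityMeasure hρ'
  have hm : densityMeasure (slab d T) (fun z => ρ z.1 z.2)
      = densityMeasure (slab d T) (fun z => ρ' z.1 z.2) := by
    refine Measure.ext_of_integral_mul_boundedContinuousFunction fun a ψ => ?_
    rw [integral_densityMeasure h.1.density_measurable hn,
      integral_densityMeasure h'.1.density_measurable hn']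
    have hb : ∀ z : ℝ × Space d, ‖a z.1 * ψ z.2‖ ≤ ‖a‖ * ‖ψ‖ := fun z => by
      rw [norm_mul]
      exact mul_le_mul (a.norm_coe_le_norm _) (ψ.norm_coe_le_norm _) (norm_nonneg _)
        (norm_nonneg _)
    have hc : AEStronglyMeasurable (fun z : ℝ × Space d => a z.1 * ψ z.2) (slab d T) :=
      ((a.continuous.comp continuous_fst).mul (ψ.continuous.comp
        continuous_snd)).aestronglyMeasurable
    have j1 := hρ.bdd_mul hc (Eventually.of_forall hb)
    have j2 := hρ'.bdd_mul hc (Eventually.of_forall hb)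
    unfold slab at j1 j2 ⊢
    rw [integral_prod _ j1, integral_prod _ j2]
    -- the test function is scaled to be bounded by `1`
    have hψ := B.ae_integral_eq hV h h' (ψ := fun x => ψ x / (‖ψ‖ + 1))
      (ψ.continuous.div_const _) (fun x => by
        have h1 := ψ.norm_coe_le_norm x
        have h2 : 0 < ‖ψ‖ + 1 := by positivity
        rw [abs_div, abs_of_pos h2, div_le_one h2]
        exact h1.trans (by linarith))
    refine integral_congr_ae ?_
    filter_upwards [ae_restrict_of_ae hψ, ae_restrict_mem measurableSet_Ioo] with t ht hts
    have h1 := ht hts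
    simp only [div_mul_eq_mul_div, integral_div] at h1
    have h2 : ‖ψ‖ + 1 ≠ 0 := by positivity
    rw [div_left_inj' h2] at h1
    simp only [mul_assoc, integral_const_mul, h1]
  rw [densityMeasure, densityMeasure, withDensity_eq_iff_of_sigmaFinite
    h.1.density_measurable.aemeasurable.ennreal_ofReal
    h'.1.density_measurable.aemeasurable.ennreal_ofReal] at hm
  filter_upwards [hm, hn, hn'] with z hz h1 h2
  exact (ENNReal.ofReal_eq_ofReal_iff h1 h2).1 hz

theorem backwardOp_mul_ae_eq (B : BridgeData β T M g ρ₀)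
    (hV : ∀ x, 2 * β * Real.log (g x) = -V x) (h : IsOptimizer T β V ρ₀ ρ v q)
    (φ : ℝ → Space d → ℝ) : ∀ᵐ z ∂slab d T, backwardOp β v φ z.1 z.2 * ρ z.1 z.2
      = backwardOp β (fun t => gradient (hopfCole g β T t)) φ z.1 z.2 * ρ z.1 z.2 := by
  filter_upwards [ae_slab_nonneg h.1.density, B.ae_drift_eq hV h] with z hz hv
  rcases hz.eq_or_lt with hz | hz
  · rw [← hz, mul_zero, mul_zero]
  · simp only [backwardOp_eq, hv hz]

theorem solvesWeakly_of_isOptimizer (B : BridgeData β T M g ρ₀)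
    (hV : ∀ x, 2 * β * Real.log (g x) = -V x) (h : IsOptimizer T β V ρ₀ ρ v q) :
    SolvesFokkerPlanckWeakly T β ρ (fun t => gradient (hopfCole g β T t)) := by
  intro φ hφ hc
  rw [h.1.fokkerPlanck φ hφ hc]
  exact integral_congr_ae (B.backwardOp_mul_ae_eq hV h φ)

theorem terminal_ae_eq (B : BridgeData β T M g ρ₀)
    (hV : ∀ x, 2 * β * Real.log (g x) = -V x) (h : IsOptimizer T β V ρ₀ ρ v q)
    (h' : IsOptimizer T β V ρ₀ ρ' v' q') : q =ᵐ[volume] q' := by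
  have hq := h.1.terminal_density B.T_pos
  have hq' := h'.1.terminal_density B.T_pos
  have key := ae_eq_zero_of_integral_contDiff_smul_eq_zero
    (hq.integrable.sub hq'.integrable).locallyIntegrable fun ψ hψ hc => ?_
  · filter_upwards [key] with x hx
    exact sub_eq_zero.1 hx
  · -- the weak equations tested with `χ ψ`, where `χ T = 1`, differ only in their terminal terms
    obtain ⟨χ, hχ, hχc, hχT⟩ : ∃ χ : ℝ → ℝ, ContDiff ℝ 2 χ ∧ HasCompactSupport χ ∧ χ T = 1 := by
      let χ : ContDiffBump T := ⟨1, 2, one_pos, one_lt_two⟩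
      exact ⟨χ, χ.contDiff, χ.hasCompactSupport,
        χ.one_of_mem_closedBall (Metric.mem_closedBall_self zero_le_one)⟩
    have hψ2 : ContDiff ℝ 2 ψ := contDiff_infty.1 hψ 2
    have hφ : ContDiff ℝ 2 fun z : ℝ × Space d => χ z.1 * ψ z.2 :=
      (hχ.comp contDiff_fst).mul (hψ2.comp contDiff_snd)
    have hφc : HasCompactSupport fun z : ℝ × Space d => χ z.1 * ψ z.2 := by
      refine HasCompactSupport.of_support_subset_isCompact
        (hχc.isCompact.prod hc.isCompact) fun z hz => ?_
      rw [Function.mem_support, mul_ne_zero_iff] at hz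
      exact ⟨subset_tsupport _ hz.1, subset_tsupport _ hz.2⟩
    have e1 := B.solvesWeakly_of_isOptimizer hV h (fun t x => χ t * ψ x) hφ hφc
    have e2 := B.solvesWeakly_of_isOptimizer hV h' (fun t x => χ t * ψ x) hφ hφc
    have e3 : ∫ z, backwardOp β (fun t => gradient (hopfCole g β T t)) (fun t x => χ t * ψ x)
        z.1 z.2 * ρ z.1 z.2 ∂slab d T
        = ∫ z, backwardOp β (fun t => gradient (hopfCole g β T t)) (fun t x => χ t * ψ x)
        z.1 z.2 * ρ' z.1 z.2 ∂slab d T := by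
      refine integral_congr_ae ?_
      filter_upwards [B.ae_density_eq hV h h'] with z hz
      rw [hz]
    simp only [h.1.initial, h.1.terminal, hχT, one_mul] at e1
    simp only [h'.1.initial, h'.1.terminal, hχT, one_mul] at e2
    obtain ⟨C, hC⟩ := hc.exists_bound_of_continuous hψ.continuous
    simp only [Pi.sub_apply, smul_eq_mul, mul_sub]
    rw [integral_sub
      (hq.integrable.bdd_mul hψ.continuous.aestronglyMeasurable (Eventually.of_forall hC))
      (hq'.integrable.bdd_mul hψ.continuous.aestronglyMeasurable (Eventually.of_forall hC))]
    linarith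

end BridgeData

end RegWProx

theorem mainTheorem4 (d : ℕ) (T β : ℝ) (hT : 0 < T) (hβ : 0 < β)
    (V : RegWProx.Space d → ℝ) (hV : ContDiff ℝ 1 V) (hVb : ∃ c : ℝ, ∀ x, c ≤ V x)
    (ρ₀ : RegWProx.Space d → ℝ) (hρ₀ : RegWProx.IsP2Density ρ₀) :
    ∃ (Φ ρ : ℝ → RegWProx.Space d → ℝ) (q : RegWProx.Space d → ℝ),
      -- the backward equation, with its terminal condition
      RegWProx.SolvesHamiltonJacobi T β V Φ ∧
      -- there is an optimizer with drift `∇Φ`, and its density solves the forward equation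
      RegWProx.IsOptimizer T β V ρ₀ ρ (fun t => gradient (Φ t)) q ∧
      RegWProx.SolvesFokkerPlanckClassically T β ρ (fun t => gradient (Φ t)) ∧
      (∀ x, ρ 0 x = ρ₀ x) ∧
      -- the terminal density is the regularized proximal, which is unique up to null sets
      (∀ x, ρ T x = q x) ∧
      q ∈ RegWProx.regWProx T β V ρ₀ ∧
      (∀ q' ∈ RegWProx.regWProx T β V ρ₀, q' =ᵐ[volume] q) ∧
      -- every optimizer has the multiplier `Φ`, solves the forward equation with drift `∇Φ`, and
      -- is the one above up to null sets
      ∀ (ρ' : ℝ → RegWProx.Space d → ℝ) (v' : ℝ → RegWProx.Space d → RegWProx.Space d)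
        (q' : RegWProx.Space d → ℝ), RegWProx.IsOptimizer T β V ρ₀ ρ' v' q' →
        RegWProx.IsLagrangeMultiplier T β V ρ₀ ρ' v' q' Φ ∧
        (∀ᵐ z ∂(RegWProx.slab d T), ρ' z.1 z.2 • (v' z.1 z.2 - gradient (Φ z.1) z.2) = 0) ∧
        RegWProx.SolvesFokkerPlanckWeakly T β ρ' (fun t => gradient (Φ t)) ∧
        (∀ x, ρ' 0 x = ρ₀ x) ∧ (∀ x, ρ' T x = q' x) ∧
        (∀ᵐ z ∂(RegWProx.slab d T), ρ' z.1 z.2 = ρ z.1 z.2) := by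
  obtain ⟨c, hc⟩ := hVb
  set g : RegWProx.Space d → ℝ := fun x => Real.exp (-V x / (2 * β)) with hg
  have B : RegWProx.BridgeData β T (Real.exp (-c / (2 * β))) g ρ₀ :=
    { β_pos := hβ
      T_pos := hT
      cont_g := Real.continuous_exp.comp (hV.continuous.neg.div_const _)
      bound_g := fun x => by
        rw [hg, Real.abs_exp]
        have := hc x
        gcongr
      pos_g := fun x => Real.exp_pos _
      density := hρ₀ }
  have hVg : ∀ x, 2 * β * Real.log (g x) = -V x := fun x => by
    rw [hg, Real.log_exp]
    field_simp
  have hopt := B.isOptimizer_bridge hVg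
  refine ⟨RegWProx.hopfCole g β T, RegWProx.bridgeDensity g ρ₀ β T,
    RegWProx.bridgeDensity g ρ₀ β T T, B.solvesHamiltonJacobi hVg, hopt, B.solvesClassically,
    hopt.1.initial, fun _ => rfl, ⟨_, _, hopt⟩, ?_, fun ρ' v' q' h' => ?_⟩
  · rintro q' ⟨ρ', v', h'⟩
    exact B.terminal_ae_eq hVg h' hopt
  · refine ⟨B.isLagrangeMultiplier hVg h', ?_, B.solvesWeakly_of_isOptimizer hVg h',
      h'.1.initial, h'.1.terminal, B.ae_density_eq hVg h' hopt⟩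
    filter_upwards [RegWProx.ae_slab_nonneg h'.1.density, B.ae_drift_eq hVg h'] with z hz hv
    rcases hz.eq_or_lt with hz | hz
    · rw [← hz, zero_smul]
    · rw [hv hz, sub_self, smul_zero]
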